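/- Let $1\le k<n$ be integers, let $\mathbb{k}$ be a field containing a primitive $n$-th root of unity, and let $G=\{\zeta\in\mathbb{k}^*:\zeta^n=1\}$. Let $R=\mathbb{k}[[x,y]]/(x^k-y^{n-k})$, on which $\zeta\in G$ acts by $x\mapsto\zeta x$, $y\mapsto\zeta^{-1}y$, let $A=R*G$ be the twisted group ring, and let $Z=\mathbb{k}[[t]]\subseteq A$ with $t=xy$. Write $\mathrm{CM}(A)$ for the category of (maximal) Cohen–Macaulay $A$-modules, that is, finitely generated left $A$-modules that are free over $Z$. For $j\in\mathbb{Z}/n$ let $e_j=\frac1n\sum_{\zeta\in G}\zeta^{-j}[\zeta]\in A$, where $[\zeta]$ is the group element $\zeta$ regarded as an element of $A$, and let $(e_n)$ be the two-sided ideal of $A$ generated by $e_n=e_0$. Let $\Pi$ be the preprojective algebra over $\mathbb{k}$ of type $A_{n-1}$: the path algebra of the quiver with vertices $1,\dots,n-1$ and arrows $x_a\colon a-1\to a$, $y_a\colon a\to a-1$ $(2\le a\le n-1)$, modulo $xy=yx$, where $x=\sum_a x_a$, $y=\sum_a y_a$ (left modules are representations of the quiver). Let $B$ be the quotient of $\Pi$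 by the relations $x^k=0=y^{n-k}$. There is a canonical homomorphism (in fact an isomorphism) $B\to A/(e_n)$, with $e_j\mapsto e_j$ for $1\le j\le n-1$, $x\mapsto x$, $y\mapsto y$, and through it $M\mapsto M/(e_n)M$ defines a functor $\pi$ from $A$-modules to $B$-modules. Let $\mathrm{Sub}\,Q_k$ be the full subcategory of those finitely generated $B$-modules whose socle, as a $\Pi$-module, is concentrated at the vertex $k$. Give $\mathrm{CM}(A)$ and $\mathrm{Sub}\,Q_k$ the exact structures in which the admissible exact sequences are the short exact sequences of modules with all terms in the category. Both are Frobenius categories, and $\pi$ restricts to a functor $\mathrm{CM}(A)\to\mathrm{Sub}\,Q_k$. This functor induces a triangle equivalence of stable categories $$\underline{\pi}\colon\underline{\mathrm{CM}}(A)\to\underline{\mathrm{Sub}}\,Q_k ,$$ where the stable categories carry Happel's triangulated structures. Moreover, for all $X,Y$ in $\mathrm{CM}(A)$, the functor $\pi$ induces an isomorphism of groups $$\mathrm{Ext}^1_A(X,Y)\cong\mathrm{Ext}^1_B(\pi X,\pi Y):$$ for every short exact sequence $0\to Y\to E\to X\to0$ of $A$-modules, the sequence $0\to\pi Y\to\pi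 E\to\pi X\to0$ is exact, and the isomorphism sends the class of the former to the class of the latter. -/

import Mathlib

universe u v

open CategoryTheory

namespace StableCat

section Frobenius

open CategoryTheory.Limits

variable {C : Type u} [Category.{v} C] [Abelian C] (P : ObjectProperty C)

/-- A pair of composable morphisms `X ⟶ Y ⟶ Z` of the full subcategory `P` is a *conflation*
(admissible exact sequence) if `0 ⟶ X ⟶ Y ⟶ Z ⟶ 0` is exact in the ambient abelian category. -/
structure IsConflation {X Y Z : P.FullSubcategory} (f : X ⟶ Y) (g : Y ⟶ Z) : Prop where
  zero : f.hom ≫ g.hom = 0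
  shortExact : (ShortComplex.mk f.hom g.hom zero).ShortExact

/-- Projective objects of the exact category `P`. -/
def IsProjective (Q : P.FullSubcategory) : Prop :=
  ∀ ⦃X Y Z : P.FullSubcategory⦄ (f : X ⟶ Y) (g : Y ⟶ Z), IsConflation P f g →
    ∀ h : Q ⟶ Z, ∃ l : Q ⟶ Y, l ≫ g = h

/-- Injective objects of the exact category `P`. -/
def IsInjective (I : P.FullSubcategory) : Prop :=
  ∀ ⦃X Y Z : P.FullSubcategory⦄ (f : X ⟶ Y) (g : Y ⟶ Z), IsConflation P f g →
    ∀ h : X ⟶ I, ∃ l : Y ⟶ I, f ≫ l = h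

/-- `P` is a Frobenius category: it is an exact category (an extension-closed full subcategory
of an abelian category, with the induced exact structure) with enough projective and
enough injective objects, and these two classes of objects coincide. -/
structure IsFrobenius : Prop where
  containsZero : P.ContainsZero
  closedUnderExtensions : P.IsClosedUnderExtensions
  enoughProjectives : ∀ X : P.FullSubcategory, ∃ (K Q : P.FullSubcategory) (f : K ⟶ Q)
    (g : Q ⟶ X), IsConflation P f g ∧ IsProjective P Q
  enoughInjectives : ∀ X : P.FullSubcategory, ∃ (I S : P.FullSubcategory) (f : X ⟶ I)
    (g : I ⟶ S), IsConflation P f g ∧ IsInjective P I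
  projective_iff_injective : ∀ X : P.FullSubcategory, IsProjective P X ↔ IsInjective P X

/-- The ideal of morphisms generated by those that factor through a projective object.
(When `P` has finite direct sums, these factoring morphisms already form a subgroup.) -/
def projectiveIdeal (X Y : P.FullSubcategory) : AddSubgroup (X ⟶ Y) :=
  AddSubgroup.closure
    {h | ∃ Q : P.FullSubcategory, IsProjective P Q ∧ ∃ (a : X ⟶ Q) (b : Q ⟶ Y), a ≫ b = h}

variable {P} in
theorem comp_mem_projectiveIdeal {X Y Z : P.FullSubcategory} (f : X ⟶ Y) {g : Y ⟶ Z}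
    (hg : g ∈ projectiveIdeal P Y Z) : f ≫ g ∈ projectiveIdeal P X Z := by
  induction hg using AddSubgroup.closure_induction with
  | mem x hx =>
    obtain ⟨Q, hQ, a, b, rfl⟩ := hx
    exact AddSubgroup.subset_closure ⟨Q, hQ, f ≫ a, b, by simp⟩
  | zero => simp
  | add x y _ _ hx hy => rw [Preadditive.comp_add]; exact add_mem hx hy
  | neg x _ hx => rw [Preadditive.comp_neg]; exact neg_mem hx

variable {P} in
theorem mem_projectiveIdeal_comp {X Y Z : P.FullSubcategory} {f : X ⟶ Y} (g : Y ⟶ Z)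
    (hf : f ∈ projectiveIdeal P X Y) : f ≫ g ∈ projectiveIdeal P X Z := by
  induction hf using AddSubgroup.closure_induction with
  | mem x hx =>
    obtain ⟨Q, hQ, a, b, rfl⟩ := hx
    exact AddSubgroup.subset_closure ⟨Q, hQ, a, b ≫ g, by simp⟩
  | zero => simp
  | add x y _ _ hx hy => rw [Preadditive.add_comp]; exact add_mem hx hy
  | neg x _ hx => rw [Preadditive.neg_comp]; exact neg_mem hx

/-- Two morphisms are stably equal if their difference lies in the ideal of projectives. -/
def stableRel : HomRel P.FullSubcategory :=
  fun X Y f g => f - g ∈ projectiveIdeal P X Y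

instance stableRel_congruence : Congruence (stableRel P) where
  equivalence :=
    { refl := fun f => by simp [stableRel]
      symm := fun {f g} h => by
        have := neg_mem (show f - g ∈ projectiveIdeal P _ _ from h)
        simpa [stableRel] using this
      trans := fun {f g k} h h' => by
        have := add_mem (show f - g ∈ projectiveIdeal P _ _ from h)
          (show g - k ∈ projectiveIdeal P _ _ from h')
        simpa [stableRel] using this }
  comp_left := fun {_ _ _} f {g g'} h => by
    have := comp_mem_projectiveIdeal f (show g - g' ∈ projectiveIdeal P _ _ from h)
    simpa [stableRel, Preadditive.comp_sub] using this
  comp_right := fun {_ _ _} {f f'} g h => by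
    have := mem_projectiveIdeal_comp g (show f - f' ∈ projectiveIdeal P _ _ from h)
    simpa [stableRel, Preadditive.sub_comp] using this

/-- The stable category: the objects are those of `P`, the morphisms are the morphisms of `P`
modulo those that factor through projectives. -/
abbrev StableCategory : Type u := CategoryTheory.Quotient (stableRel P)

/-- The quotient functor from `P` to its stable category. -/
abbrev toStable : P.FullSubcategory ⥤ StableCategory P := CategoryTheory.Quotient.functor (stableRel P)

noncomputable instance stablePreadditive : Preadditive (StableCategory P) :=
  CategoryTheory.Quotient.preadditive (stableRel P) (fun X Y f₁ f₂ g₁ g₂ hf hg => by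
    have := add_mem (show f₁ - f₂ ∈ projectiveIdeal P X Y from hf)
      (show g₁ - g₂ ∈ projectiveIdeal P X Y from hg)
    rwa [show f₁ - f₂ + (g₁ - g₂) = f₁ + g₁ - (f₂ + g₂) by abel] at this)

/-- A choice, for every object `X`, of a conflation `X ⟶ I X ⟶ S X` with `I X` injective. -/
structure InjectiveEmbeddings where
  I : P.FullSubcategory → P.FullSubcategory
  S : P.FullSubcategory → P.FullSubcategory
  i : ∀ X, X ⟶ I X
  p : ∀ X, I X ⟶ S X
  conflation : ∀ X, IsConflation P (i X) (p X)
  injective : ∀ X, IsInjective P (I X)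

namespace InjectiveEmbeddings

variable {P} (H : InjectiveEmbeddings P)

/-- `c : S X ⟶ S Y` covers `f : X ⟶ Y` if `f` and `c` are the outer components of a morphism
from the chosen conflation of `X` to that of `Y`. -/
def Covers {X Y : P.FullSubcategory} (f : X ⟶ Y) (c : H.S X ⟶ H.S Y) : Prop :=
  ∃ b : H.I X ⟶ H.I Y, H.i X ≫ b = f ≫ H.i Y ∧ H.p X ≫ c = b ≫ H.p Y

theorem exists_desc {X Y Z W : P.FullSubcategory} {f : X ⟶ Y} {g : Y ⟶ Z}
    (h : IsConflation P f g) (b : Y ⟶ W) (hb : f ≫ b = 0) : ∃ c : Z ⟶ W, g ≫ c = b := by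
  have hb' : f.hom ≫ b.hom = 0 := congrArg InducedCategory.Hom.hom hb
  have := h.shortExact.epi_g
  refine ⟨P.homMk (h.shortExact.exact.desc b.hom hb'), ?_⟩
  ext
  exact h.shortExact.exact.g_desc b.hom hb'

theorem p_cancel {X W : P.FullSubcategory} {a b : H.S X ⟶ W} (h : H.p X ≫ a = H.p X ≫ b) :
    a = b := by
  have : Epi (H.p X).hom := (H.conflation X).shortExact.epi_g
  ext
  exact (cancel_epi (H.p X).hom).1 (congrArg InducedCategory.Hom.hom h)

theorem i_p (X : P.FullSubcategory) : H.i X ≫ H.p X = 0 := by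
  ext
  exact (H.conflation X).zero

theorem exists_covers {X Y : P.FullSubcategory} (f : X ⟶ Y) : ∃ c, H.Covers f c := by
  obtain ⟨b, hb⟩ := H.injective Y _ _ (H.conflation X) (f ≫ H.i Y)
  obtain ⟨c, hc⟩ := exists_desc (H.conflation X) (b ≫ H.p Y)
    (by rw [← Category.assoc, hb, Category.assoc, H.i_p, comp_zero])
  exact ⟨c, b, hb, hc⟩

theorem Covers.id (X : P.FullSubcategory) : H.Covers (𝟙 X) (𝟙 (H.S X)) :=
  ⟨𝟙 _, by simp, by simp⟩

variable {H}

theorem Covers.comp {X Y Z : P.FullSubcategory} {f : X ⟶ Y} {g : Y ⟶ Z} {c d}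
    (hf : H.Covers f c) (hg : H.Covers g d) : H.Covers (f ≫ g) (c ≫ d) := by
  obtain ⟨b, h1, h2⟩ := hf
  obtain ⟨b', h1', h2'⟩ := hg
  refine ⟨b ≫ b', ?_, ?_⟩
  · rw [← Category.assoc, h1, Category.assoc, h1', Category.assoc]
  · rw [← Category.assoc, h2, Category.assoc, h2', Category.assoc]

theorem Covers.add {X Y : P.FullSubcategory} {f g : X ⟶ Y} {c d}
    (hf : H.Covers f c) (hg : H.Covers g d) : H.Covers (f + g) (c + d) := by
  obtain ⟨b, h1, h2⟩ := hf
  obtain ⟨b', h1', h2'⟩ := hg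
  exact ⟨b + b', by simp [h1, h1'], by simp [h2, h2']⟩

theorem Covers.neg {X Y : P.FullSubcategory} {f : X ⟶ Y} {c}
    (hf : H.Covers f c) : H.Covers (-f) (-c) := by
  obtain ⟨b, h1, h2⟩ := hf
  exact ⟨-b, by simp [h1], by simp [h2]⟩

theorem Covers.mem_of_zero (hP : IsFrobenius P) {X Y : P.FullSubcategory} {c}
    (h : H.Covers (0 : X ⟶ Y) c) : c ∈ projectiveIdeal P (H.S X) (H.S Y) := by
  obtain ⟨b, h1, h2⟩ := h
  obtain ⟨d, hd⟩ := exists_desc (H.conflation X) b (by rw [h1, zero_comp])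
  refine AddSubgroup.subset_closure
    ⟨H.I Y, (hP.projective_iff_injective _).2 (H.injective Y), d, H.p Y, ?_⟩
  apply H.p_cancel
  rw [← Category.assoc, hd, h2]

theorem exists_covers_mem (hP : IsFrobenius P) {X Y : P.FullSubcategory} {f : X ⟶ Y}
    (hf : f ∈ projectiveIdeal P X Y) :
    ∃ c ∈ projectiveIdeal P (H.S X) (H.S Y), H.Covers f c := by
  induction hf using AddSubgroup.closure_induction with
  | mem x hx =>
    obtain ⟨Q, hQ, a, b, rfl⟩ := hx
    obtain ⟨a', ha'⟩ := (hP.projective_iff_injective _).1 hQ _ _ (H.conflation X) a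
    refine ⟨0, zero_mem _, a' ≫ b ≫ H.i Y, ?_, ?_⟩
    · rw [← Category.assoc, ha', Category.assoc]
    · simp [H.i_p]
  | zero => exact ⟨0, zero_mem _, 0, by simp, by simp⟩
  | add x y _ _ hx hy =>
    obtain ⟨c, hc, h⟩ := hx
    obtain ⟨d, hd, h'⟩ := hy
    exact ⟨c + d, add_mem hc hd, h.add h'⟩
  | neg x _ hx =>
    obtain ⟨c, hc, h⟩ := hx
    exact ⟨-c, neg_mem hc, h.neg⟩

theorem Covers.map_eq (hP : IsFrobenius P) {X Y : P.FullSubcategory} {f g : X ⟶ Y} {c d}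
    (hf : H.Covers f c) (hg : H.Covers g d) (h : stableRel P f g) :
    (toStable P).map c = (toStable P).map d := by
  apply CategoryTheory.Quotient.sound
  obtain ⟨e, he, h'⟩ := exists_covers_mem (H := H) hP (show f - g ∈ projectiveIdeal P X Y from h)
  have h0 : H.Covers (0 : X ⟶ Y) (c + -d + -e) := by
    have := (hf.add hg.neg).add h'.neg
    rwa [show f + -g + -(f - g) = 0 by abel] at this
  have := add_mem (h0.mem_of_zero hP) he
  rwa [show c + -d + -e + e = c - d by abel] at this

variable (H)

/-- The suspension functor of the stable category of a Frobenius category. -/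
noncomputable def suspension (hP : IsFrobenius P) : StableCategory P ⥤ StableCategory P :=
  CategoryTheory.Quotient.lift (stableRel P)
    { obj := fun X => (toStable P).obj (H.S X)
      map := fun f => (toStable P).map (H.exists_covers f).choose
      map_id := fun X => by
        rw [← (toStable P).map_id]
        exact Covers.map_eq hP (H.exists_covers _).choose_spec (Covers.id H X)
          ((stableRel_congruence P).equivalence.refl _)
      map_comp := fun f g => by
        rw [← (toStable P).map_comp]
        exact Covers.map_eq hP (H.exists_covers _).choose_spec
          ((H.exists_covers f).choose_spec.comp (H.exists_covers g).choose_spec)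
          ((stableRel_congruence P).equivalence.refl _) }
    (fun _ _ f g h => Covers.map_eq hP (H.exists_covers f).choose_spec
      (H.exists_covers g).choose_spec h)

end InjectiveEmbeddings

end Frobenius

/-- The data of a triangulated structure on a category: a shift functor and a
class of distinguished triangles `X ⟶ Y ⟶ Z ⟶ ΣX`. -/
structure TriangleData (T : Type u) [Category.{v} T] where
  shift : T ⥤ T
  distinguished : ∀ {X Y Z : T}, (X ⟶ Y) → (Y ⟶ Z) → (Z ⟶ shift.obj X) → Prop

/-- The triangulated structure on the stable category of a Frobenius category. The shift is the
suspension. Given `u : X ⟶ Y` in `P`, a morphism of conflations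
```
  X ──i──> I X ──p──> S X
  │u        │q         ║
  Y ──v───> Z ───w──> S X
```
(so that `Z` is the pushout of `i` and `u`) yields the standard triangle `X ⟶ Y ⟶ Z ⟶ S X`
with morphisms `u`, `v`, `w`. The distinguished triangles are those which, in the
stable category, are isomorphic to a standard one. -/
noncomputable def stableTriangles {C : Type u} [Category.{v} C] [Abelian C] {P : ObjectProperty C}
    (hP : IsFrobenius P) (H : InjectiveEmbeddings P) : TriangleData (StableCategory P) where
  shift := H.suspension hP
  distinguished := fun {X Y Z} u v w =>
    ∃ (X' Y' Z' : P.FullSubcategory) (u' : X' ⟶ Y') (v' : Y' ⟶ Z') (w' : Z' ⟶ H.S X')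
      (q : H.I X' ⟶ Z'),
      IsConflation P v' w' ∧ H.i X' ≫ q = u' ≫ v' ∧ q ≫ w' = H.p X' ∧
      ∃ (a : X ≅ (toStable P).obj X') (b : Y ≅ (toStable P).obj Y')
        (c : Z ≅ (toStable P).obj Z'),
        u ≫ b.hom = a.hom ≫ (toStable P).map u' ∧
        v ≫ c.hom = b.hom ≫ (toStable P).map v' ∧
        w ≫ (H.suspension hP).map a.hom = c.hom ≫ (toStable P).map w'

/-- A functor is a triangle equivalence if it is an additive equivalence of categories which,
by means of a natural isomorphism, commutes with the shifts, and
under which the distinguished triangles correspond to each other. -/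
def IsTriangleEquivalence {T : Type*} [Category* T] [Preadditive T]
    {T' : Type*} [Category* T'] [Preadditive T']
    (Δ : TriangleData T) (Δ' : TriangleData T') (F : T ⥤ T') : Prop :=
  F.Additive ∧ F.IsEquivalence ∧
    ∃ φ : Δ.shift ⋙ F ≅ F ⋙ Δ'.shift,
      ∀ {X Y Z : T} (u : X ⟶ Y) (v : Y ⟶ Z) (w : Z ⟶ Δ.shift.obj X),
        Δ.distinguished u v w ↔
          Δ'.distinguished (F.map u) (F.map v) (F.map w ≫ φ.hom.app X)

end StableCat
namespace GrassmannianCM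

section Algebras

variable (𝕜 : Type u) [Field 𝕜] (n k : ℕ)

/-- The group `G = {ζ ∈ 𝕜ˣ : ζ ^ n = 1}`. (A type synonym, so that the action
below is not confused with scalar multiplication.) -/
def G : Type u := rootsOfUnity n 𝕜

instance : CommGroup (G 𝕜 n) := inferInstanceAs (CommGroup (rootsOfUnity n 𝕜))

noncomputable instance [NeZero n] : Fintype (G 𝕜 n) := 
  letI : Finite (G 𝕜 n) := inferInstanceAs (Finite (rootsOfUnity n 𝕜))
  Fintype.ofFinite _

/-- The inclusion of `G` into the units of `𝕜`. -/
def G.toUnits : G 𝕜 n →* 𝕜ˣ := (rootsOfUnity n 𝕜).subtype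

variable {𝕜 n} in
theorem G.toUnits_pow (g : G 𝕜 n) : ((G.toUnits 𝕜 n g : 𝕜ˣ) : 𝕜) ^ n = 1 := by
  have := g.2
  rw [mem_rootsOfUnity] at this
  exact congrArg Units.val this

/-- The ideal generated by `x ^ k - y ^ (n - k)` in `𝕜[[x, y]]`. -/
noncomputable def curveIdeal : Ideal (MvPowerSeries (Fin 2) 𝕜) :=
  Ideal.span {MvPowerSeries.X 0 ^ k - MvPowerSeries.X 1 ^ (n - k)}

/-- The complete coordinate ring `R = 𝕜[[x, y]] / (x ^ k - y ^ (n - k))`. -/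
abbrev R : Type u := MvPowerSeries (Fin 2) 𝕜 ⧸ curveIdeal 𝕜 n k

/-- The automorphism `x ↦ g x`, `y ↦ g⁻¹ y` of `𝕜[[x, y]]`. -/
noncomputable def rescaleXY (u : 𝕜ˣ) : MvPowerSeries (Fin 2) 𝕜 →+* MvPowerSeries (Fin 2) 𝕜 :=
  MvPowerSeries.rescale ![(u : 𝕜), ((u⁻¹ : 𝕜ˣ) : 𝕜)]

theorem rescaleXY_X0 (u : 𝕜ˣ) : rescaleXY 𝕜 u (MvPowerSeries.X 0) =
    MvPowerSeries.C (u : 𝕜) * MvPowerSeries.X 0 := by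
  ext m
  rw [rescaleXY, MvPowerSeries.coeff_rescale, MvPowerSeries.coeff_C_mul, MvPowerSeries.coeff_X]
  split_ifs with h
  · subst h; simp
  · simp

theorem rescaleXY_X1 (u : 𝕜ˣ) : rescaleXY 𝕜 u (MvPowerSeries.X 1) =
    MvPowerSeries.C ((u⁻¹ : 𝕜ˣ) : 𝕜) * MvPowerSeries.X 1 := by
  ext m
  rw [rescaleXY, MvPowerSeries.coeff_rescale, MvPowerSeries.coeff_C_mul, MvPowerSeries.coeff_X]
  split_ifs with h
  · subst h; simp
  · simp

theorem rescaleXY_one : rescaleXY 𝕜 1 = RingHom.id _ := by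
  have : ![((1 : 𝕜ˣ) : 𝕜), ((1⁻¹ : 𝕜ˣ) : 𝕜)] = 1 := by ext i; fin_cases i <;> simp
  rw [rescaleXY, this, MvPowerSeries.rescale_one]

theorem rescaleXY_mul (u v : 𝕜ˣ) :
    rescaleXY 𝕜 (u * v) = (rescaleXY 𝕜 u).comp (rescaleXY 𝕜 v) := by
  have : ![((u * v : 𝕜ˣ) : 𝕜), (((u * v)⁻¹ : 𝕜ˣ) : 𝕜)] =
      ![(v : 𝕜), ((v⁻¹ : 𝕜ˣ) : 𝕜)] * ![(u : 𝕜), ((u⁻¹ : 𝕜ˣ) : 𝕜)] := by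
    ext i; fin_cases i <;> simp [mul_comm]
  rw [rescaleXY, this, MvPowerSeries.rescale_mul]
  rfl

theorem curveIdeal_le_comap [hk : Fact (k < n)] (g : G 𝕜 n) :
    curveIdeal 𝕜 n k ≤ (curveIdeal 𝕜 n k).comap (rescaleXY 𝕜 (G.toUnits 𝕜 n g)) := by
  rw [curveIdeal, Ideal.span_le, Set.singleton_subset_iff]
  set u := G.toUnits 𝕜 n g with hu
  have h1 : ((u⁻¹ : 𝕜ˣ) : 𝕜) ^ (n - k) = (u : 𝕜) ^ k := by
    have h := G.toUnits_pow g
    rw [← hu] at h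
    have h2 : (u : 𝕜) ^ (n - k) * (u : 𝕜) ^ k = 1 := by
      rw [← pow_add, Nat.sub_add_cancel hk.out.le, h]
    rw [Units.val_inv_eq_inv_val, inv_pow]
    exact inv_eq_of_mul_eq_one_right h2
  simp only [SetLike.mem_coe, Ideal.mem_comap, map_sub, map_pow, rescaleXY_X0, rescaleXY_X1,
    mul_pow]
  rw [← map_pow, ← map_pow, h1, ← mul_sub]
  exact Ideal.mul_mem_left _ _ (Ideal.subset_span rfl)

/-- The action of `g ∈ G` on `R`, induced by `x ↦ g x`, `y ↦ g⁻¹ y`. -/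
noncomputable def actR [Fact (k < n)] (g : G 𝕜 n) : R 𝕜 n k →+* R 𝕜 n k :=
  Ideal.quotientMap _ (rescaleXY 𝕜 (G.toUnits 𝕜 n g)) (curveIdeal_le_comap 𝕜 n k g)

noncomputable instance [Fact (k < n)] : MulSemiringAction (G 𝕜 n) (R 𝕜 n k) where
  smul g r := actR 𝕜 n k g r
  one_smul r := by
    obtain ⟨f, rfl⟩ := Ideal.Quotient.mk_surjective r
    change actR 𝕜 n k 1 _ = _
    rw [actR, Ideal.quotientMap_mk, map_one, rescaleXY_one]
    rfl
  mul_smul g h r := by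
    obtain ⟨f, rfl⟩ := Ideal.Quotient.mk_surjective r
    change actR 𝕜 n k (g * h) _ = actR 𝕜 n k g (actR 𝕜 n k h _)
    simp only [actR, Ideal.quotientMap_mk, map_mul, rescaleXY_mul]
    rfl
  smul_zero g := map_zero (actR 𝕜 n k g)
  smul_add g := map_add (actR 𝕜 n k g)
  smul_one g := map_one (actR 𝕜 n k g)
  smul_mul g := map_mul (actR 𝕜 n k g)

variable {𝕜 n k} in
theorem smul_mk [Fact (k < n)] (g : G 𝕜 n) (f : MvPowerSeries (Fin 2) 𝕜) :
    g • (Ideal.Quotient.mk (curveIdeal 𝕜 n k) f) =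
      Ideal.Quotient.mk (curveIdeal 𝕜 n k) (rescaleXY 𝕜 (G.toUnits 𝕜 n g) f) := rfl

instance [Fact (k < n)] : SMulCommClass (G 𝕜 n) 𝕜 (R 𝕜 n k) where
  smul_comm g c r := by
    obtain ⟨f, rfl⟩ := Ideal.Quotient.mk_surjective r
    change g • (Ideal.Quotient.mk (curveIdeal 𝕜 n k) (c • f)) =
      Ideal.Quotient.mk (curveIdeal 𝕜 n k) (c • rescaleXY 𝕜 (G.toUnits 𝕜 n g) f)
    rw [smul_mk]
    congr 1
    ext m
    simp only [rescaleXY, MvPowerSeries.coeff_rescale, MvPowerSeries.coeff_smul]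
    ring

/-- The twisted group ring `A = R * G`. -/
def A [Fact (k < n)] : Type u := SkewMonoidAlgebra (R 𝕜 n k) (G 𝕜 n)

noncomputable instance [Fact (k < n)] : Ring (A 𝕜 n k) :=
  inferInstanceAs (Ring (SkewMonoidAlgebra (R 𝕜 n k) (G 𝕜 n)))

noncomputable instance [Fact (k < n)] : Algebra 𝕜 (A 𝕜 n k) :=
  inferInstanceAs (Algebra 𝕜 (SkewMonoidAlgebra (R 𝕜 n k) (G 𝕜 n)))


variable [Fact (k < n)]

/-- The element `r g` of `A`, for `r ∈ R` and `g ∈ G`. -/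
noncomputable def sgl (g : G 𝕜 n) (r : R 𝕜 n k) : A 𝕜 n k := SkewMonoidAlgebra.single g r

/-- The inclusion of `R` into `A`. -/
noncomputable def RtoA : R 𝕜 n k →+* A 𝕜 n k := SkewMonoidAlgebra.singleOneRingHom

/-- The images of `x` and `y` in `A`. -/
noncomputable def xA : A 𝕜 n k :=
  RtoA 𝕜 n k (Ideal.Quotient.mk (curveIdeal 𝕜 n k) (MvPowerSeries.X 0))

noncomputable def yA : A 𝕜 n k :=
  RtoA 𝕜 n k (Ideal.Quotient.mk (curveIdeal 𝕜 n k) (MvPowerSeries.X 1))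

/-- The idempotent `e_j = (1 / n) ∑_g g ^ (-j) g` of `A` at the vertex `j` (mod `n`): it acts on
an `A`-module as the projection to the subspace on which each `g ∈ G` acts as the scalar `g ^ j`. -/
noncomputable def eA [NeZero n] (j : ℕ) : A 𝕜 n k :=
  ∑ g : G 𝕜 n, sgl 𝕜 n k g
    (algebraMap 𝕜 (R 𝕜 n k) ((n : 𝕜)⁻¹ * (((G.toUnits 𝕜 n g)⁻¹ : 𝕜ˣ) : 𝕜) ^ j))

/-- The central subalgebra `Z = 𝕜[[t]]` of `A`, with `t = x y`. -/
noncomputable def ZtoA : PowerSeries 𝕜 →+* A 𝕜 n k :=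
  (RtoA 𝕜 n k).comp ((Ideal.Quotient.mk (curveIdeal 𝕜 n k)).comp
    (PowerSeries.substAlgHom (R := 𝕜) (S := 𝕜)
      (a := (MvPowerSeries.X 0 * MvPowerSeries.X 1 : MvPowerSeries (Fin 2) 𝕜))
      (PowerSeries.HasSubst.of_constantCoeff_zero (by simp))).toRingHom)

/-- The two-sided ideal `(e_n)` of `A`. -/
noncomputable def idealEn [NeZero n] : Ideal (A 𝕜 n k) :=
  (TwoSidedIdeal.span {eA 𝕜 n k n}).asIdeal

instance [NeZero n] : (idealEn 𝕜 n k).IsTwoSided :=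
  inferInstanceAs (TwoSidedIdeal.span {eA 𝕜 n k n}).asIdeal.IsTwoSided

/-- Generators of the path algebra of the double quiver of the Dynkin graph `A_{n-1}`: the
idempotents `e j` at the vertices `1 ≤ j ≤ n - 1`, and the arrows `x a : a - 1 → a` and
`y a : a → a - 1` for `2 ≤ a ≤ n - 1`. (Generators with an index outside
these ranges are killed by the relations.) -/
inductive Gen : Type
  | e (j : ℕ)
  | x (a : ℕ)
  | y (a : ℕ)

/-- The generators as elements of the free algebra. -/
abbrev gen (s : Gen) : FreeAlgebra 𝕜 Gen := FreeAlgebra.ι 𝕜 s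

/-- The defining relations of the preprojective algebra of type `A_{n-1}`: those of the path algebra
(arrows are composed from right to left, so that left modules are representations),
and `∑ [x_a, y_a] = 0`, that is, `x y = y x` with `x = ∑ x_a` and `y = ∑ y_a`. -/
inductive PreprojRel : FreeAlgebra 𝕜 Gen → FreeAlgebra 𝕜 Gen → Prop
  | e_outside (j : ℕ) (hj : j ∉ Finset.Icc 1 (n - 1)) : PreprojRel (gen 𝕜 (.e j)) 0
  | e_idem (j : ℕ) : PreprojRel (gen 𝕜 (.e j) * gen 𝕜 (.e j)) (gen 𝕜 (.e j))
  | e_orth (i j : ℕ) (hij : i ≠ j) : PreprojRel (gen 𝕜 (.e i) * gen 𝕜 (.e j)) 0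
  | e_sum : PreprojRel (∑ j ∈ Finset.Icc 1 (n - 1), gen 𝕜 (.e j)) 1
  | x_target (a : ℕ) : PreprojRel (gen 𝕜 (.e a) * gen 𝕜 (.x a)) (gen 𝕜 (.x a))
  | x_source (a : ℕ) : PreprojRel (gen 𝕜 (.x a) * gen 𝕜 (.e (a - 1))) (gen 𝕜 (.x a))
  | y_target (a : ℕ) : PreprojRel (gen 𝕜 (.e (a - 1)) * gen 𝕜 (.y a)) (gen 𝕜 (.y a))
  | y_source (a : ℕ) : PreprojRel (gen 𝕜 (.y a) * gen 𝕜 (.e a)) (gen 𝕜 (.y a))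
  | comm : PreprojRel
      ((∑ a ∈ Finset.Icc 2 (n - 1), gen 𝕜 (.x a)) * (∑ a ∈ Finset.Icc 2 (n - 1), gen 𝕜 (.y a)))
      ((∑ a ∈ Finset.Icc 2 (n - 1), gen 𝕜 (.y a)) * (∑ a ∈ Finset.Icc 2 (n - 1), gen 𝕜 (.x a)))

/-- The preprojective algebra `Π` of type `A_{n-1}`. -/
def Preproj : Type u := RingQuot (PreprojRel 𝕜 n)

noncomputable instance : Ring (Preproj 𝕜 n) := inferInstanceAs (Ring (RingQuot (PreprojRel 𝕜 n)))

noncomputable instance : Algebra 𝕜 (Preproj 𝕜 n) :=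
  inferInstanceAs (Algebra 𝕜 (RingQuot (PreprojRel 𝕜 n)))

/-- The quotient map from the free algebra to `Π`. -/
noncomputable def freeToPreproj : FreeAlgebra 𝕜 Gen →ₐ[𝕜] Preproj 𝕜 n :=
  RingQuot.mkAlgHom 𝕜 (PreprojRel 𝕜 n)

/-- The image of a generator in `Π`. -/
noncomputable def toPreproj (s : Gen) : Preproj 𝕜 n :=
  freeToPreproj 𝕜 n (gen 𝕜 s)

/-- The elements `x = ∑ x_a` and `y = ∑ y_a` of `Π`. -/
noncomputable def xP : Preproj 𝕜 n := ∑ a ∈ Finset.Icc 2 (n - 1), toPreproj 𝕜 n (.x a)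

noncomputable def yP : Preproj 𝕜 n := ∑ a ∈ Finset.Icc 2 (n - 1), toPreproj 𝕜 n (.y a)

/-- The additional relations `x ^ k = 0 = y ^ (n - k)`. -/
inductive BRel : Preproj 𝕜 n → Preproj 𝕜 n → Prop
  | x_pow : BRel (xP 𝕜 n ^ k) 0
  | y_pow : BRel (yP 𝕜 n ^ (n - k)) 0

/-- The quotient `B` of the preprojective algebra `Π` by `x ^ k = 0 = y ^ (n - k)`. -/
def B : Type u := RingQuot (BRel 𝕜 n k)

noncomputable instance : Ring (B 𝕜 n k) := inferInstanceAs (Ring (RingQuot (BRel 𝕜 n k)))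

noncomputable instance : Algebra 𝕜 (B 𝕜 n k) :=
  inferInstanceAs (Algebra 𝕜 (RingQuot (BRel 𝕜 n k)))

/-- The quotient map `Π → B`. -/
noncomputable def PreprojToB : Preproj 𝕜 n →ₐ[𝕜] B 𝕜 n k := RingQuot.mkAlgHom 𝕜 (BRel 𝕜 n k)


section Lemmas

variable {𝕜 n k}

theorem smul_algebraMap_R (g : G 𝕜 n) (a : 𝕜) :
    g • algebraMap 𝕜 (R 𝕜 n k) a = algebraMap 𝕜 (R 𝕜 n k) a := by
  rw [Algebra.algebraMap_eq_smul_one, smul_comm, smul_one]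

theorem sgl_mul (g h : G 𝕜 n) (r s : R 𝕜 n k) :
    sgl 𝕜 n k g r * sgl 𝕜 n k h s = sgl 𝕜 n k (g * h) (r * g • s) :=
  SkewMonoidAlgebra.single_mul_single

theorem sgl_smul (a b : 𝕜) (g : G 𝕜 n) :
    a • sgl 𝕜 n k g (algebraMap 𝕜 _ b) = sgl 𝕜 n k g (algebraMap 𝕜 _ (a * b)) := by
  refine (SkewMonoidAlgebra.smul_single a g _).trans ?_
  rw [map_mul]
  exact congrArg (sgl 𝕜 n k g) (Algebra.smul_def a (algebraMap 𝕜 (R 𝕜 n k) b))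

theorem sgl_sum {ι : Type*} (s : Finset ι) (g : G 𝕜 n) (r : ι → R 𝕜 n k) :
    ∑ i ∈ s, sgl 𝕜 n k g (r i) = sgl 𝕜 n k g (∑ i ∈ s, r i) :=
  (map_sum (SkewMonoidAlgebra.singleAddHom g) r s).symm

theorem sgl_zero (g : G 𝕜 n) : sgl 𝕜 n k g 0 = 0 :=
  SkewMonoidAlgebra.single_zero g

theorem sgl_one_one : sgl 𝕜 n k 1 1 = 1 := rfl

theorem sgl_mul_eA [NeZero n] (h : G 𝕜 n) (a : 𝕜) (j : ℕ) :
    sgl 𝕜 n k h (algebraMap 𝕜 _ a) * eA 𝕜 n k j =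
      (a * (G.toUnits 𝕜 n h : 𝕜) ^ j) • eA 𝕜 n k j := by
  rw [eA, Finset.mul_sum, Finset.smul_sum]
  refine Fintype.sum_equiv (Equiv.mulLeft h) _ _ (fun g => ?_)
  rw [sgl_mul, smul_algebraMap_R, sgl_smul, Equiv.coe_mulLeft, ← map_mul]
  congr 2
  have hh : ((G.toUnits 𝕜 n h : 𝕜ˣ) : 𝕜) ≠ 0 := Units.ne_zero _
  simp only [map_mul, mul_inv, Units.val_mul, mul_pow, Units.val_inv_eq_inv_val]
  have h1 : ((G.toUnits 𝕜 n h : 𝕜ˣ) : 𝕜) ^ j * ((G.toUnits 𝕜 n h : 𝕜ˣ) : 𝕜)⁻¹ ^ j = 1 := by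
    rw [← mul_pow, mul_inv_cancel₀ hh, one_pow]
  linear_combination (-(a * (n : 𝕜)⁻¹ * ((G.toUnits 𝕜 n g : 𝕜ˣ) : 𝕜)⁻¹ ^ j)) * h1

section Idempotents

variable [HasEnoughRootsOfUnity 𝕜 n]

variable (𝕜 n) in
theorem natCast_ne_zero [NeZero n] : (n : 𝕜) ≠ 0 := by
  obtain ⟨ζ, hζ⟩ := HasEnoughRootsOfUnity.exists_primitiveRoot 𝕜 n
  exact hζ.neZero'.out

variable (𝕜 n) in
theorem card_G [NeZero n] : Fintype.card (G 𝕜 n) = n := by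
  rw [← Nat.card_eq_fintype_card]
  exact HasEnoughRootsOfUnity.natCard_rootsOfUnity 𝕜 n

theorem eA_mul_self [NeZero n] (j : ℕ) : eA 𝕜 n k j * eA 𝕜 n k j = eA 𝕜 n k j := by
  conv_lhs => lhs; rw [eA]
  rw [Finset.sum_mul]
  simp_rw [sgl_mul_eA]
  rw [← Finset.sum_smul, Finset.sum_congr rfl (g := fun _ => (n : 𝕜)⁻¹), Finset.sum_const,
    Finset.card_univ, card_G, nsmul_eq_mul, mul_inv_cancel₀ (natCast_ne_zero 𝕜 n), one_smul]
  intro g _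
  rw [mul_assoc, ← mul_pow, Units.inv_mul, one_pow, mul_one]

theorem eA_mul_of_ne [NeZero n] {i j : ℕ} (hi : i ∈ Finset.Icc 1 (n - 1))
    (hj : j ∈ Finset.Icc 1 (n - 1)) (hij : i ≠ j) : eA 𝕜 n k i * eA 𝕜 n k j = 0 := by
  rw [Finset.mem_Icc] at hi hj
  conv_lhs => lhs; rw [eA]
  rw [Finset.sum_mul]
  simp_rw [sgl_mul_eA, mul_assoc]
  rw [← Finset.sum_smul, ← Finset.mul_sum]
  let f : G 𝕜 n →* 𝕜 := (Units.coeHom 𝕜).comp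
    (((zpowGroupHom ((j : ℤ) - i) : 𝕜ˣ →* 𝕜ˣ)).comp (G.toUnits 𝕜 n))
  have hf : ∀ g, (((G.toUnits 𝕜 n g)⁻¹ : 𝕜ˣ) : 𝕜) ^ i * ((G.toUnits 𝕜 n g : 𝕜ˣ) : 𝕜) ^ j = f g := by
    intro g
    simp only [f, MonoidHom.coe_comp, Function.comp_apply, zpowGroupHom_apply, Units.coeHom_apply]
    rw [← Units.val_pow_eq_pow_val, ← Units.val_pow_eq_pow_val, ← Units.val_mul, inv_pow,
      zpow_sub, zpow_natCast, zpow_natCast, mul_comm]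
  have hf1 : f ≠ 1 := by
    intro h
    obtain ⟨ζ, hζ⟩ := HasEnoughRootsOfUnity.exists_primitiveRoot 𝕜 n
    have hζu := hζ.isUnit_unit (NeZero.ne n)
    set z := (hζ.isUnit (NeZero.ne n)).unit with hz
    have hzm : z ∈ rootsOfUnity n 𝕜 := by
      rw [mem_rootsOfUnity]; exact hζu.pow_eq_one
    have h1 := DFunLike.congr_fun h (⟨z, hzm⟩ : rootsOfUnity n 𝕜)
    have h2 : z ^ ((j : ℤ) - i) = 1 := Units.ext h1
    rw [hζu.zpow_eq_one_iff_dvd] at h2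
    obtain ⟨m, hm⟩ := h2
    have h3 : |(j : ℤ) - i| < n := by rw [abs_lt]; omega
    have h4 := Int.eq_zero_of_abs_lt_dvd ⟨m, hm⟩ h3
    omega
  rw [Finset.sum_congr rfl (fun g _ => hf g), sum_hom_units_eq_zero f hf1, mul_zero, zero_smul]

theorem eA_sum [NeZero n] : ∑ j ∈ Finset.Icc 1 n, eA 𝕜 n k j = 1 := by
  classical
  have hcoef : ∀ g : G 𝕜 n, ∑ j ∈ Finset.Icc 1 n,
      (n : 𝕜)⁻¹ * (((G.toUnits 𝕜 n g)⁻¹ : 𝕜ˣ) : 𝕜) ^ j = if g = 1 then 1 else 0 := by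
    intro g
    rw [← Finset.mul_sum]
    split_ifs with h
    · subst h
      simp [natCast_ne_zero 𝕜 n]
    · set w := (((G.toUnits 𝕜 n g)⁻¹ : 𝕜ˣ) : 𝕜) with hw
      have hwn : w ^ n = 1 := by
        rw [hw, ← map_inv]; exact G.toUnits_pow _
      have hw1 : w ≠ 1 := by
        intro h'
        apply h
        have h'' : (G.toUnits 𝕜 n g)⁻¹ = 1 := Units.ext h'
        rw [inv_eq_one] at h''
        exact Subtype.ext h''
      have hs : ∑ j ∈ Finset.Icc 1 n, w ^ j = w * ∑ j ∈ Finset.range n, w ^ j := by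
        rw [Finset.mul_sum, ← Finset.Ico_add_one_right_eq_Icc, Finset.sum_Ico_eq_sum_range]
        simp [pow_add]
      have hg := mul_geom_sum w n
      rw [hwn, sub_self, mul_eq_zero, or_iff_right (sub_ne_zero.2 hw1)] at hg
      rw [hs, hg, mul_zero, mul_zero]
  simp only [eA]
  rw [Finset.sum_comm]
  simp_rw [sgl_sum, ← map_sum, hcoef]
  rw [Finset.sum_eq_single 1]
  · simp [sgl_one_one]
  · intro g _ hg
    simp [hg, sgl_zero]
  · simp

end Idempotents

theorem xA_mul_eA [NeZero n] (j : ℕ) : xA 𝕜 n k * eA 𝕜 n k j = eA 𝕜 n k (j + 1) * xA 𝕜 n k := by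
  change sgl 𝕜 n k 1 _ * _ = _ * sgl 𝕜 n k 1 _
  simp only [eA, Finset.mul_sum, Finset.sum_mul, sgl_mul, one_smul, one_mul, mul_one]
  refine Finset.sum_congr rfl fun g _ => ?_
  rw [smul_mk, rescaleXY_X0, map_mul (Ideal.Quotient.mk _)]
  change _ = sgl 𝕜 n k g (_ * (algebraMap 𝕜 (R 𝕜 n k) _ * _))
  rw [← mul_assoc, ← map_mul, mul_comm]
  congr 3
  rw [pow_succ, ← mul_assoc, mul_assoc _ _ ((G.toUnits 𝕜 n g : 𝕜ˣ) : 𝕜), Units.inv_mul, mul_one]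

theorem eA_mul_yA [NeZero n] (j : ℕ) : eA 𝕜 n k j * yA 𝕜 n k = yA 𝕜 n k * eA 𝕜 n k (j + 1) := by
  change _ * sgl 𝕜 n k 1 _ = sgl 𝕜 n k 1 _ * _
  simp only [eA, Finset.mul_sum, Finset.sum_mul, sgl_mul, one_smul, one_mul, mul_one]
  refine Finset.sum_congr rfl fun g _ => ?_
  rw [smul_mk, rescaleXY_X1, map_mul (Ideal.Quotient.mk _)]
  change sgl 𝕜 n k g (_ * (algebraMap 𝕜 (R 𝕜 n k) _ * _)) = _
  rw [← mul_assoc, ← map_mul, mul_comm]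
  congr 3
  rw [pow_succ, ← mul_assoc]

theorem xA_pow_mul_eA [NeZero n] (i j : ℕ) :
    xA 𝕜 n k ^ i * eA 𝕜 n k j = eA 𝕜 n k (j + i) * xA 𝕜 n k ^ i := by
  induction i with
  | zero => simp
  | succ i ih => rw [pow_succ', mul_assoc, ih, ← mul_assoc, xA_mul_eA, mul_assoc, add_assoc]

theorem eA_mul_yA_pow [NeZero n] (i j : ℕ) :
    eA 𝕜 n k j * yA 𝕜 n k ^ i = yA 𝕜 n k ^ i * eA 𝕜 n k (j + i) := by
  induction i generalizing j with
  | zero => simp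
  | succ i ih =>
    rw [pow_succ', ← mul_assoc, eA_mul_yA, mul_assoc, ih, ← mul_assoc,
      show j + 1 + i = j + (i + 1) by ring]

theorem eA_zero [NeZero n] : eA 𝕜 n k 0 = eA 𝕜 n k n := by
  rw [eA, eA]
  refine Finset.sum_congr rfl fun g _ => ?_
  rw [pow_zero, ← map_inv, G.toUnits_pow]

theorem xA_comm_yA : xA 𝕜 n k * yA 𝕜 n k = yA 𝕜 n k * xA 𝕜 n k := by
  rw [xA, yA, ← map_mul, ← map_mul, ← map_mul, ← map_mul, mul_comm]

theorem xA_pow_eq : xA 𝕜 n k ^ k = yA 𝕜 n k ^ (n - k) := by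
  rw [xA, yA, ← map_pow, ← map_pow, ← map_pow, ← map_pow]
  congr 1
  rw [Ideal.Quotient.eq]
  exact Ideal.subset_span rfl

theorem eA_mem [NeZero n] : eA 𝕜 n k n ∈ idealEn 𝕜 n k :=
  TwoSidedIdeal.subset_span rfl

theorem eA_mul_mem [NeZero n] (a b : A 𝕜 n k) : a * eA 𝕜 n k n * b ∈ idealEn 𝕜 n k :=
  Ideal.IsTwoSided.mul_mem_of_left _ (Ideal.mul_mem_left _ _ eA_mem)

variable [HasEnoughRootsOfUnity 𝕜 n]

theorem xA_pow_mem [NeZero n] : xA 𝕜 n k ^ k ∈ idealEn 𝕜 n k := by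
  have hkn : k < n := Fact.out
  rw [← mul_one (xA 𝕜 n k ^ k), ← eA_sum, Finset.mul_sum]
  refine Ideal.sum_mem _ fun j hj => ?_
  rw [Finset.mem_Icc] at hj
  by_cases h : n ≤ j + k
  · have : xA 𝕜 n k ^ k * eA 𝕜 n k j =
        xA 𝕜 n k ^ (k - (n - j)) * eA 𝕜 n k n * xA 𝕜 n k ^ (n - j) := by
      rw [mul_assoc, show eA 𝕜 n k n = eA 𝕜 n k (j + (n - j)) by congr 1; omega,
        ← xA_pow_mul_eA, ← mul_assoc, ← pow_add]
      congr 2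
      omega
    rw [this]
    exact eA_mul_mem _ _
  · have : xA 𝕜 n k ^ k * eA 𝕜 n k j =
        yA 𝕜 n k ^ (n - k - j) * eA 𝕜 n k n * yA 𝕜 n k ^ j := by
      rw [xA_pow_eq, mul_assoc, ← eA_zero, eA_mul_yA_pow, ← mul_assoc, ← pow_add, zero_add]
      congr 2
      omega
    rw [this]
    exact eA_mul_mem _ _

end Lemmas

section Comparison

variable [NeZero n]

/-- The images of the generators in `A / (e_n)`. -/
noncomputable def eBar (j : ℕ) : A 𝕜 n k ⧸ idealEn 𝕜 n k :=
  if j ∈ Finset.Icc 1 (n - 1) then Ideal.Quotient.mk _ (eA 𝕜 n k j) else 0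

noncomputable def xBar : A 𝕜 n k ⧸ idealEn 𝕜 n k := Ideal.Quotient.mk _ (xA 𝕜 n k)

noncomputable def yBar : A 𝕜 n k ⧸ idealEn 𝕜 n k := Ideal.Quotient.mk _ (yA 𝕜 n k)

/-- The generator `e_j` goes to the class of `e_j`, the arrow `x_a` to the class of
`e_a x e_{a-1}`, and the arrow `y_a` to the class of `e_{a-1} y e_a`. -/
noncomputable def genBar : Gen → A 𝕜 n k ⧸ idealEn 𝕜 n k
  | .e j => eBar 𝕜 n k j
  | .x a => eBar 𝕜 n k a * xBar 𝕜 n k * eBar 𝕜 n k (a - 1)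
  | .y a => eBar 𝕜 n k (a - 1) * yBar 𝕜 n k * eBar 𝕜 n k a

theorem mk_eA_n : (Ideal.Quotient.mk (idealEn 𝕜 n k)) (eA 𝕜 n k n) = 0 :=
  Ideal.Quotient.eq_zero_iff_mem.2 eA_mem

theorem eBar_of_le {j : ℕ} (hj : j ≤ n) :
    eBar 𝕜 n k j = Ideal.Quotient.mk (idealEn 𝕜 n k) (eA 𝕜 n k j) := by
  rw [eBar]
  split_ifs with h
  · rfl
  · rw [Finset.mem_Icc] at h
    obtain rfl | rfl : j = 0 ∨ j = n := by omega
    · rw [eA_zero, mk_eA_n]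
    · rw [mk_eA_n]

theorem xBar_mul_eBar {j : ℕ} (hj : j + 1 ≤ n) :
    xBar 𝕜 n k * eBar 𝕜 n k j = eBar 𝕜 n k (j + 1) * xBar 𝕜 n k := by
  rw [eBar_of_le 𝕜 n k hj, eBar_of_le 𝕜 n k (by omega), xBar, ← map_mul, xA_mul_eA, map_mul]

theorem eBar_mul_yBar {j : ℕ} (hj : j + 1 ≤ n) :
    eBar 𝕜 n k j * yBar 𝕜 n k = yBar 𝕜 n k * eBar 𝕜 n k (j + 1) := by
  rw [eBar_of_le 𝕜 n k hj, eBar_of_le 𝕜 n k (by omega), yBar, ← map_mul, eA_mul_yA, map_mul]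

theorem eBar_zero : eBar 𝕜 n k 0 = 0 := by simp [eBar]

variable [HasEnoughRootsOfUnity 𝕜 n]

theorem eBar_mul_self (j : ℕ) : eBar 𝕜 n k j * eBar 𝕜 n k j = eBar 𝕜 n k j := by
  rw [eBar]
  split_ifs with h
  · rw [← map_mul, eA_mul_self]
  · simp

theorem eBar_mul_of_ne {i j : ℕ} (hij : i ≠ j) : eBar 𝕜 n k i * eBar 𝕜 n k j = 0 := by
  rw [eBar, eBar]
  split_ifs with h h'
  · rw [← map_mul, eA_mul_of_ne h h' hij, map_zero]
  all_goals simp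

theorem eBar_sum : ∑ j ∈ Finset.Icc 1 (n - 1), eBar 𝕜 n k j = 1 := by
  have h : ∑ j ∈ Finset.Icc 1 n, eBar 𝕜 n k j = 1 := by
    rw [Finset.sum_congr rfl (fun j hj => eBar_of_le 𝕜 n k (Finset.mem_Icc.1 hj).2), ← map_sum,
      eA_sum, map_one]
  have hn : Finset.Icc 1 n = insert n (Finset.Icc 1 (n - 1)) := by
    have := NeZero.ne n
    ext j
    simp only [Finset.mem_Icc, Finset.mem_insert]
    omega
  have hn' : n ∉ Finset.Icc 1 (n - 1) := by
    have := NeZero.ne n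
    simp only [Finset.mem_Icc]
    omega
  rw [hn, Finset.sum_insert hn', eBar_of_le 𝕜 n k le_rfl, mk_eA_n, zero_add] at h
  exact h

theorem sum_genBar_x : ∑ a ∈ Finset.Icc 2 (n - 1), genBar 𝕜 n k (.x a) = xBar 𝕜 n k := by
  have h1 : ∑ a ∈ Finset.Icc 1 (n - 1), genBar 𝕜 n k (.x a) = xBar 𝕜 n k := by
    rw [← one_mul (xBar 𝕜 n k), ← eBar_sum, Finset.sum_mul]
    refine Finset.sum_congr rfl fun a ha => ?_
    obtain ⟨b, rfl⟩ : ∃ b, a = b + 1 := ⟨a - 1, by have := (Finset.mem_Icc.1 ha).1; omega⟩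
    rw [Finset.mem_Icc] at ha
    rw [genBar, Nat.add_sub_cancel, mul_assoc, xBar_mul_eBar 𝕜 n k (by omega), ← mul_assoc,
      eBar_mul_self]
  rw [← h1]
  refine Finset.sum_subset (Finset.Icc_subset_Icc_left (by omega)) fun a ha ha' => ?_
  rw [Finset.mem_Icc] at ha ha'
  obtain rfl : a = 1 := by omega
  simp [genBar, eBar_zero]

theorem sum_genBar_y : ∑ a ∈ Finset.Icc 2 (n - 1), genBar 𝕜 n k (.y a) = yBar 𝕜 n k := by
  have h1 : ∑ a ∈ Finset.Icc 1 (n - 1), genBar 𝕜 n k (.y a) = yBar 𝕜 n k := by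
    rw [← mul_one (yBar 𝕜 n k), ← eBar_sum, Finset.mul_sum]
    refine Finset.sum_congr rfl fun a ha => ?_
    obtain ⟨b, rfl⟩ : ∃ b, a = b + 1 := ⟨a - 1, by have := (Finset.mem_Icc.1 ha).1; omega⟩
    rw [Finset.mem_Icc] at ha
    rw [genBar, Nat.add_sub_cancel, eBar_mul_yBar 𝕜 n k (by omega), mul_assoc, eBar_mul_self]
  rw [← h1]
  refine Finset.sum_subset (Finset.Icc_subset_Icc_left (by omega)) fun a ha ha' => ?_
  rw [Finset.mem_Icc] at ha ha'
  obtain rfl : a = 1 := by omega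
  simp [genBar, eBar_zero]

/-- The algebra homomorphism `Π → A / (e_n)`. -/
noncomputable def PreprojToQuot : Preproj 𝕜 n →ₐ[𝕜] A 𝕜 n k ⧸ idealEn 𝕜 n k :=
  RingQuot.liftAlgHom 𝕜 ⟨FreeAlgebra.lift 𝕜 (genBar 𝕜 n k), by
    intro a b h
    induction h with
    | e_outside j hj => simp [genBar, eBar, hj]
    | e_idem j => simp [genBar, eBar_mul_self]
    | e_orth i j hij => simp [genBar, eBar_mul_of_ne 𝕜 n k hij]
    | e_sum => simpa [genBar] using eBar_sum 𝕜 n k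
    | x_target a => simp [genBar, ← mul_assoc, eBar_mul_self]
    | x_source a => simp [genBar, mul_assoc, eBar_mul_self]
    | y_target a => simp [genBar, ← mul_assoc, eBar_mul_self]
    | y_source a => simp [genBar, mul_assoc, eBar_mul_self]
    | comm =>
      simp only [map_mul, map_sum, FreeAlgebra.lift_ι_apply, sum_genBar_x, sum_genBar_y]
      rw [xBar, yBar, ← map_mul, xA_comm_yA, map_mul]⟩

theorem PreprojToQuot_toPreproj (s : Gen) :
    PreprojToQuot 𝕜 n k (toPreproj 𝕜 n s) = genBar 𝕜 n k s := by
  exact (RingQuot.liftAlgHom_mkAlgHom_apply 𝕜 _ _ _).trans (FreeAlgebra.lift_ι_apply _ _)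

/-- The canonical homomorphism `B → A / (e_n)`, through which an `A`-module annihilated by `e_n`
is viewed as a `B`-module. -/
noncomputable def BToQuot : B 𝕜 n k →ₐ[𝕜] A 𝕜 n k ⧸ idealEn 𝕜 n k :=
  RingQuot.liftAlgHom 𝕜 ⟨PreprojToQuot 𝕜 n k, by
    intro a b h
    induction h with
    | x_pow =>
      simp only [map_pow, map_zero, xP, map_sum,
        PreprojToQuot_toPreproj, sum_genBar_x]
      rw [xBar, ← map_pow]
      exact Ideal.Quotient.eq_zero_iff_mem.2 xA_pow_mem
    | y_pow =>
      simp only [map_pow, map_zero, yP, map_sum,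
        PreprojToQuot_toPreproj, sum_genBar_y]
      rw [yBar, ← map_pow, ← xA_pow_eq]
      exact Ideal.Quotient.eq_zero_iff_mem.2 xA_pow_mem⟩

end Comparison

end Algebras

section Categories

open CategoryTheory

/-- The map `M / I M → N / I N` induced by a linear map `M → N`. -/
def quotMap {S : Type u} [Ring S] (I : Ideal S) {M N : Type u} [AddCommGroup M] [Module S M]
    [AddCommGroup N] [Module S N] (f : M →ₗ[S] N) :
    (M ⧸ I • (⊤ : Submodule S M)) →ₗ[S] (N ⧸ I • (⊤ : Submodule S N)) :=
  Submodule.mapQ _ _ f (Submodule.smul_top_le_comap_smul_top I f)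

theorem quotMap_mk {S : Type u} [Ring S] (I : Ideal S) {M N : Type u} [AddCommGroup M] [Module S M]
    [AddCommGroup N] [Module S N] (f : M →ₗ[S] N) (x : M) :
    quotMap I f (Submodule.Quotient.mk x) = Submodule.Quotient.mk (f x) := rfl

/-- The same map, as an `S / I`-linear map. -/
def quotMapLinear {S : Type u} [Ring S] (I : Ideal S) [I.IsTwoSided] {M N : Type u}
    [AddCommGroup M] [Module S M] [AddCommGroup N] [Module S N] (f : M →ₗ[S] N) :
    (M ⧸ I • (⊤ : Submodule S M)) →ₗ[S ⧸ I] (N ⧸ I • (⊤ : Submodule S N)) where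
  toFun := quotMap I f
  map_add' := map_add (quotMap I f)
  map_smul' r x := by
    obtain ⟨r, rfl⟩ := Ideal.Quotient.mk_surjective r
    exact map_smul (quotMap I f) r x

/-- For a two-sided ideal `I` of `S`, the functor `M ↦ M / I M` from `S`-modules to
`S / I`-modules. -/
def quotFunctor {S : Type u} [Ring S] (I : Ideal S) [I.IsTwoSided] :
    ModuleCat.{u} S ⥤ ModuleCat.{u} (S ⧸ I) where
  obj M := ModuleCat.of (S ⧸ I) (M ⧸ I • (⊤ : Submodule S M))
  map f := ModuleCat.ofHom (quotMapLinear I f.hom)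
  map_id M := by
    apply ModuleCat.hom_ext
    apply LinearMap.ext
    intro x
    obtain ⟨x, rfl⟩ := Submodule.Quotient.mk_surjective _ x
    rfl
  map_comp f g := by
    apply ModuleCat.hom_ext
    apply LinearMap.ext
    intro x
    obtain ⟨x, rfl⟩ := Submodule.Quotient.mk_surjective _ x
    rfl

instance {S : Type u} [Ring S] (I : Ideal S) [I.IsTwoSided] : (quotFunctor I).Additive where
  map_add {M N f g} := by
    apply ModuleCat.hom_ext
    apply LinearMap.ext
    intro x
    obtain ⟨x, rfl⟩ := Submodule.Quotient.mk_surjective _ x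
    rfl

/-- The socle of a module: the sum of its simple submodules. -/
def socle (S : Type*) [Ring S] (M : Type*) [AddCommGroup M] [Module S M] : Submodule S M :=
  sSup {N : Submodule S M | IsSimpleModule S N}

variable (𝕜 : Type u) [Field 𝕜] (n k : ℕ) [Fact (k < n)]

/-- The Cohen–Macaulay `A`-modules: the finitely generated `A`-modules that are
free over `Z = 𝕜[[t]]`. -/
def CM : ObjectProperty (ModuleCat.{u} (A 𝕜 n k)) := fun M =>
  Module.Finite (A 𝕜 n k) M ∧
    Module.Free (PowerSeries 𝕜) ((ModuleCat.restrictScalars (ZtoA 𝕜 n k)).obj M)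

/-- The condition for a `Π`-module to be in `Sub Q_k`: it is finitely generated, and its socle
is concentrated at the vertex `k`. -/
def PreprojSubQ (N : ModuleCat.{u} (Preproj 𝕜 n)) : Prop :=
  Module.Finite (Preproj 𝕜 n) N ∧
    ∀ j : ℕ, j ≠ k → ∀ m ∈ socle (Preproj 𝕜 n) N, toPreproj 𝕜 n (.e j) • m = 0

/-- The category `Sub Q_k`, as a full subcategory of the category of `B`-modules. -/
def SubQ : ObjectProperty (ModuleCat.{u} (B 𝕜 n k)) := fun N =>
  PreprojSubQ 𝕜 n k ((ModuleCat.restrictScalars (PreprojToB 𝕜 n k).toRingHom).obj N)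

variable [NeZero n] [HasEnoughRootsOfUnity 𝕜 n]

/-- The functor `π : M ↦ M / (e_n) M` from `A`-modules to `B`-modules. -/
noncomputable def piFunctor : ModuleCat.{u} (A 𝕜 n k) ⥤ ModuleCat.{u} (B 𝕜 n k) :=
  quotFunctor (idealEn 𝕜 n k) ⋙ ModuleCat.restrictScalars (BToQuot 𝕜 n k).toRingHom

instance : (piFunctor 𝕜 n k).Additive :=
  inferInstanceAs (quotFunctor (idealEn 𝕜 n k) ⋙
    ModuleCat.restrictScalars (BToQuot 𝕜 n k).toRingHom).Additive

/-- The restricted functor `π : CM(A) ⥤ Sub Q_k`. -/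
noncomputable def piCM (h : ∀ M, CM 𝕜 n k M → SubQ 𝕜 n k ((piFunctor 𝕜 n k).obj M)) :
    (CM 𝕜 n k).FullSubcategory ⥤ (SubQ 𝕜 n k).FullSubcategory :=
  (SubQ 𝕜 n k).lift ((CM 𝕜 n k).ι ⋙ piFunctor 𝕜 n k) (fun M => h M.obj M.property)

end Categories

end GrassmannianCM

set_option linter.unusedSectionVars false

/-! The functor `π` presents `Sub Q_k` as a quotient of `CM(A)` by an ideal of morphisms that factor
through projective-injective objects. Once this is known, the theorem is formal.

The formal part. Let `F` be an exact, full and essentially surjective functor from a Frobenius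
category `P` to an extension-closed category `Q`. Suppose that `F` kills only morphisms in the ideal
of projectives, and that a morphism of `P` whose image is a deflation (or inflation) can be
corrected to a deflation (or inflation) of `P` in a way that `F` does not see
(`IsProjectiveQuotient`). Lifting problems in `Q` can then be solved in `P`, so `F` preserves
projectives and injectives. It follows that `Q` is Frobenius, and that `f` is stably zero if and
only if `F f` is (`map_mem_iff`). The induced functor is therefore an equivalence. It respects
triangles in both directions because a cone does not depend, up to isomorphism, on the injective
embedding used to build it (`IsPushoutSquare.exists_iso`). For `0 → K → T → X → 0` with `T` free,
both `Ext¹` groups are cokernels of `Hom(T, Y) → Hom(K, Y)`, taken before and after applying `π`,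
and the same properties of `F` identify them (`exists_extEquiv`).

Injectives in `CM(A)`. The element `t = x y` is central and not a zero divisor, and `A` is finite
over `Z`, so Cohen–Macaulay means finitely generated and `t`-torsion-free. Each `e_{j+i} A e_j`
consists of the `Z`-multiples of one path; for `i = k` the path is `x ^ k = y ^ (n - k)`, and it can
be routed through every vertex. A `Z`-linear map `φ : M → e_j N` can therefore be spread along
shortest paths to an `A`-linear map that equals `x ^ k φ` at the vertex `j + k` (`exists_induced`).
Hence a morphism `h : X → N` extends along an inflation as soon as `e_{j+k} h` takes values in `x ^
k e_j N`: divide by `x ^ k`, extend over `Z`, where the sequence splits, and spread out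
(`exists_extension`). This divisibility holds for maps to `A e_j`, so free modules are injective and
`CM(A)` is Frobenius. With `j = 0` it holds for maps to `(e_n) N`, so all modules `(e_n) N` with `N`
Cohen–Macaulay are injective too.

The reduction. A morphism killed by `π` has image in `(e_n) Y`, so it factors through an injective.
Fullness holds because a pullback extension by `(e_n) Y` splits. Along a surjection `A → B`, the
socle condition becomes: `e_0` acts as zero, and the shortest path from any vertex to `k` acts
injectively (`IsSubQ`). For `M / (e_n) M` this follows from torsion-freeness. Conversely, given `N =
A ^ r / K` in `Sub Q_k`, embed `K` into some `(e_n) T` so that divisibility by `t` is detected at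
the vertex `k`; the socle condition makes the pushout of `A ^ r` torsion-free, and its reduction is
`N` (`IsSubQ.exists_isCM`). Adding such an `(e_n) T` to the target also corrects inflations, and
adding `(e_n) X` to the source corrects deflations. -/

namespace StableCat

/-! ### Cones in a Frobenius category and their independence of the injective embedding. -/

section Squares

open CategoryTheory.Limits

variable {C : Type u} [Category.{v} C] [Abelian C] {P : ObjectProperty C}

namespace IsConflation

variable {X Y Z W : P.FullSubcategory} {f : X ⟶ Y} {g : Y ⟶ Z}

theorem comp_eq_zero (h : IsConflation P f g) : f ≫ g = 0 := by
  ext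
  exact h.zero

theorem exists_desc (h : IsConflation P f g) (b : Y ⟶ W) (hb : f ≫ b = 0) :
    ∃ c : Z ⟶ W, g ≫ c = b :=
  InjectiveEmbeddings.exists_desc h b hb

theorem epi_cancel (h : IsConflation P f g) {a b : Z ⟶ W} (hab : g ≫ a = g ≫ b) : a = b := by
  have : Epi g.hom := h.shortExact.epi_g
  ext
  exact (cancel_epi g.hom).1 (congrArg InducedCategory.Hom.hom hab)

end IsConflation

theorem toStable_map_eq_iff {X Y : P.FullSubcategory} (f g : X ⟶ Y) :
    (toStable P).map f = (toStable P).map g ↔ f - g ∈ projectiveIdeal P X Y :=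
  CategoryTheory.Quotient.functor_map_eq_iff (stableRel P) f g

instance : (toStable P).Additive where
  map_add := rfl

theorem toStable_map_eq_zero_iff {X Y : P.FullSubcategory} (f : X ⟶ Y) :
    (toStable P).map f = 0 ↔ f ∈ projectiveIdeal P X Y := by
  rw [← (toStable P).map_zero, toStable_map_eq_iff, sub_zero]

theorem comp_mem_projectiveIdeal_of_isInjective (hP : IsFrobenius P) {X Y J : P.FullSubcategory}
    (hJ : IsInjective P J) (a : X ⟶ J) (b : J ⟶ Y) : a ≫ b ∈ projectiveIdeal P X Y :=
  AddSubgroup.subset_closure ⟨J, (hP.projective_iff_injective J).2 hJ, a, b, rfl⟩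

/-- Projectives are injective, so a morphism that factors through one extends along any inflation,
through the same object. This lemma turns relations that hold only stably into relations that hold
in `P`. -/
theorem exists_extension_mem (hP : IsFrobenius P) {X Y Z W : P.FullSubcategory} {i : X ⟶ Y}
    {p : Y ⟶ Z} (h : IsConflation P i p) {f : X ⟶ W} (hf : f ∈ projectiveIdeal P X W) :
    ∃ e ∈ projectiveIdeal P Y W, i ≫ e = f := by
  induction hf using AddSubgroup.closure_induction with
  | mem x hx =>
    obtain ⟨Q, hQ, a, b, rfl⟩ := hx
    obtain ⟨a', ha'⟩ := (hP.projective_iff_injective _).1 hQ _ _ h a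
    exact ⟨a' ≫ b, AddSubgroup.subset_closure ⟨Q, hQ, a', b, rfl⟩, by rw [← Category.assoc, ha']⟩
  | zero => exact ⟨0, zero_mem _, by simp⟩
  | add x y _ _ hx hy =>
    obtain ⟨c, hc, h⟩ := hx
    obtain ⟨d, hd, h'⟩ := hy
    exact ⟨c + d, add_mem hc hd, by simp [h, h']⟩
  | neg x _ hx =>
    obtain ⟨c, hc, h⟩ := hx
    exact ⟨-c, neg_mem hc, by simp [h]⟩

/-- `f` and `c` are the outer components of a morphism of complexes `(j, p) ⟶ (j', p')`. -/
def ConflationCovers {X J S X' J' S' : P.FullSubcategory} (j : X ⟶ J) (p : J ⟶ S)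
    (j' : X' ⟶ J') (p' : J' ⟶ S') (f : X ⟶ X') (c : S ⟶ S') : Prop :=
  ∃ b : J ⟶ J', j ≫ b = f ≫ j' ∧ p ≫ c = b ≫ p'

namespace ConflationCovers

variable {X J S X' J' S' X'' J'' S'' : P.FullSubcategory} {j : X ⟶ J} {p : J ⟶ S}
  {j' : X' ⟶ J'} {p' : J' ⟶ S'} {j'' : X'' ⟶ J''} {p'' : J'' ⟶ S''}

theorem id (j : X ⟶ J) (p : J ⟶ S) : ConflationCovers j p j p (𝟙 X) (𝟙 S) :=
  ⟨𝟙 _, by simp, by simp⟩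

theorem comp {f : X ⟶ X'} {g : X' ⟶ X''} {c d} (hf : ConflationCovers j p j' p' f c)
    (hg : ConflationCovers j' p' j'' p'' g d) :
    ConflationCovers j p j'' p'' (f ≫ g) (c ≫ d) := by
  obtain ⟨b, h1, h2⟩ := hf
  obtain ⟨b', h1', h2'⟩ := hg
  refine ⟨b ≫ b', ?_, ?_⟩
  · rw [← Category.assoc, h1, Category.assoc, h1', Category.assoc]
  · rw [← Category.assoc, h2, Category.assoc, h2', Category.assoc]

theorem sub {f g : X ⟶ X'} {c d} (hf : ConflationCovers j p j' p' f c)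
    (hg : ConflationCovers j p j' p' g d) : ConflationCovers j p j' p' (f - g) (c - d) := by
  obtain ⟨b, h1, h2⟩ := hf
  obtain ⟨b', h1', h2'⟩ := hg
  exact ⟨b - b', by simp [h1, h1'], by simp [h2, h2']⟩

theorem exists_of_isInjective (h : IsConflation P j p) (h' : IsConflation P j' p')
    (hJ' : IsInjective P J') (f : X ⟶ X') : ∃ c, ConflationCovers j p j' p' f c := by
  obtain ⟨b, hb⟩ := hJ' _ _ h (f ≫ j')
  obtain ⟨c, hc⟩ := h.exists_desc (b ≫ p')
    (by rw [← Category.assoc, hb, Category.assoc, h'.comp_eq_zero, comp_zero])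
  exact ⟨c, b, hb, hc⟩

/-- Let `e` extend `f` along `j`. Subtracting `e ≫ j'` from the middle component leaves a map that
vanishes on `X` and so descends to `S`. Hence `c` factors through the injective `J'`. -/
theorem map_eq_zero (hP : IsFrobenius P) (h : IsConflation P j p) (h' : IsConflation P j' p')
    (hJ' : IsInjective P J') {f : X ⟶ X'} {c} (hc : ConflationCovers j p j' p' f c)
    (hf : (toStable P).map f = 0) : (toStable P).map c = 0 := by
  rw [toStable_map_eq_zero_iff] at hf ⊢
  obtain ⟨b, h1, h2⟩ := hc
  obtain ⟨e, -, he⟩ := exists_extension_mem hP h hf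
  obtain ⟨r, hr⟩ := h.exists_desc (b - e ≫ j') (by
    rw [Preadditive.comp_sub, h1, ← Category.assoc, he, sub_self])
  have : c = r ≫ p' := by
    apply h.epi_cancel
    rw [h2, ← Category.assoc, hr, Preadditive.sub_comp, Category.assoc, h'.comp_eq_zero,
      comp_zero, sub_zero]
  rw [this]
  exact comp_mem_projectiveIdeal_of_isInjective hP hJ' r p'

theorem map_eq (hP : IsFrobenius P) (h : IsConflation P j p) (h' : IsConflation P j' p')
    (hJ' : IsInjective P J') {f g : X ⟶ X'} {c d} (hc : ConflationCovers j p j' p' f c)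
    (hd : ConflationCovers j p j' p' g d) (hfg : (toStable P).map f = (toStable P).map g) :
    (toStable P).map c = (toStable P).map d := by
  rw [← sub_eq_zero, ← Functor.map_sub] at hfg ⊢
  exact (hc.sub hd).map_eq_zero hP h h' hJ' hfg

end ConflationCovers

/-- A morphism of conflations `(u, q, 𝟙)` from `X ⟶ J ⟶ S` to `Y ⟶ Z ⟶ S`. -/
structure IsPushoutSquare {X Y Z J S : P.FullSubcategory} (j : X ⟶ J) (p : J ⟶ S) (u : X ⟶ Y)
    (v : Y ⟶ Z) (w : Z ⟶ S) (q : J ⟶ Z) : Prop where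
  top : IsConflation P j p
  bottom : IsConflation P v w
  comm : j ≫ q = u ≫ v
  comm' : q ≫ w = p

theorem shortExact_of_isPushout {X Y J S Z : C} {j : X ⟶ J} {p : J ⟶ S} {zero : j ≫ p = 0}
    (h : (ShortComplex.mk j p zero).ShortExact) {u : X ⟶ Y} {q : J ⟶ Z} {v : Y ⟶ Z}
    (hZ : IsPushout j u q v) {w : Z ⟶ S} (hq : q ≫ w = p) (hv : v ≫ w = 0) :
    (ShortComplex.mk v w hv).ShortExact := by
  have hj : Mono j := h.mono_f
  have hp : Epi p := h.epi_g
  have h1 : Mono v := MorphismProperty.of_isPushout (P := .monomorphisms C) hZ.flip hj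
  have h2 : Epi w := epi_of_epi_fac hq
  refine { exact := ?_, mono_f := h1, epi_g := h2 }
  refine ShortComplex.exact_of_g_is_cokernel _ ?_
  refine CokernelCofork.IsColimit.ofπ' _ _ fun {A} k hk => ?_
  have hk0 : v ≫ k = 0 := hk
  have hk' : j ≫ q ≫ k = 0 := by
    rw [← Category.assoc, hZ.w, Category.assoc, hk0, comp_zero]
  refine ⟨h.exact.desc _ hk', hZ.hom_ext ?_ ?_⟩
  · change q ≫ w ≫ _ = _
    rw [← Category.assoc, hq]
    exact h.exact.g_desc _ hk'
  · change v ≫ w ≫ _ = _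
    rw [← Category.assoc, hv, zero_comp, hk0]

theorem exists_isPushoutSquare (hP : IsFrobenius P) {X Y J S : P.FullSubcategory} {j : X ⟶ J}
    {p : J ⟶ S} (h : IsConflation P j p) (u : X ⟶ Y) :
    ∃ (Z : P.FullSubcategory) (v : Y ⟶ Z) (w : Z ⟶ S) (q : J ⟶ Z),
      IsPushoutSquare j p u v w q := by
  have := hP.closedUnderExtensions
  have hZ := IsPushout.of_hasPushout j.hom u.hom
  have e : j.hom ≫ p.hom = u.hom ≫ 0 := by rw [h.zero, comp_zero]
  have hs := shortExact_of_isPushout h.shortExact hZ (hZ.inl_desc _ _ e) (hZ.inr_desc _ _ e)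
  let Z : P.FullSubcategory := ⟨pushout j.hom u.hom, P.prop_X₂_of_shortExact hs Y.2 S.2⟩
  refine ⟨Z, P.homMk (pushout.inr j.hom u.hom), P.homMk (hZ.desc _ _ e),
    P.homMk (pushout.inl j.hom u.hom), h, ⟨_, hs⟩, ?_, ?_⟩
  · ext
    exact hZ.w
  · ext
    exact hZ.inl_desc _ _ e

namespace IsPushoutSquare

variable {X Y Z J S : P.FullSubcategory} {j : X ⟶ J} {p : J ⟶ S} {u : X ⟶ Y}
    {v : Y ⟶ Z} {w : Z ⟶ S} {q : J ⟶ Z}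

/-- A morphism of conflations that is the identity on cokernels is a pushout square: the comparison
from the pushout in the ambient category is an isomorphism by the five lemma. -/
theorem exists_desc (h : IsPushoutSquare j p u v w q) {W : P.FullSubcategory} (a : Y ⟶ W)
    (b : J ⟶ W) (hab : j ≫ b = u ≫ a) : ∃ c : Z ⟶ W, v ≫ c = a ∧ q ≫ c = b := by
  have hc : j.hom ≫ q.hom = u.hom ≫ v.hom := congrArg InducedCategory.Hom.hom h.comm
  have hc' : q.hom ≫ w.hom = p.hom := congrArg InducedCategory.Hom.hom h.comm'
  have hab' : j.hom ≫ b.hom = u.hom ≫ a.hom := congrArg InducedCategory.Hom.hom hab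
  have hZ := IsPushout.of_hasPushout j.hom u.hom
  have e : j.hom ≫ p.hom = u.hom ≫ 0 := by rw [h.top.zero, comp_zero]
  have hs := shortExact_of_isPushout h.top.shortExact hZ (hZ.inl_desc _ _ e) (hZ.inr_desc _ _ e)
  have hiso : IsIso (hZ.desc _ _ hc) := by
    let φ : ShortComplex.mk _ _ (hZ.inr_desc _ _ e) ⟶ ShortComplex.mk v.hom w.hom h.bottom.zero :=
      { τ₁ := 𝟙 Y.obj
        τ₂ := hZ.desc _ _ hc
        τ₃ := 𝟙 S.obj
        comm₁₂ := (Category.id_comp _).trans (hZ.inr_desc _ _ hc).symm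
        comm₂₃ := by
          refine Eq.trans ?_ (Category.comp_id _).symm
          apply hZ.hom_ext
          · exact ((hZ.inl_desc_assoc _ _ hc _).trans hc').trans (hZ.inl_desc _ _ e).symm
          · exact ((hZ.inr_desc_assoc _ _ hc _).trans h.bottom.zero).trans
              (hZ.inr_desc _ _ e).symm }
    have : IsIso φ.τ₁ := inferInstanceAs (IsIso (𝟙 _))
    have : IsIso φ.τ₃ := inferInstanceAs (IsIso (𝟙 _))
    exact ShortComplex.isIso₂_of_shortExact_of_isIso₁₃ φ hs h.bottom.shortExact
  have hv : v.hom ≫ inv (hZ.desc _ _ hc) = pushout.inr j.hom u.hom := by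
    rw [IsIso.comp_inv_eq, hZ.inr_desc]
  have hq : q.hom ≫ inv (hZ.desc _ _ hc) = pushout.inl j.hom u.hom := by
    rw [IsIso.comp_inv_eq, hZ.inl_desc]
  refine ⟨P.homMk (inv (hZ.desc _ _ hc) ≫ hZ.desc _ _ hab'), ?_, ?_⟩
  · ext
    refine (Category.assoc _ _ _).symm.trans ?_
    rw [hv, hZ.inr_desc]
  · ext
    refine (Category.assoc _ _ _).symm.trans ?_
    rw [hq, hZ.inl_desc]

theorem hom_ext (h : IsPushoutSquare j p u v w q) {W : P.FullSubcategory} {a b : Z ⟶ W}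
    (hv : v ≫ a = v ≫ b) (hq : q ≫ a = q ≫ b) : a = b := by
  obtain ⟨s, hs⟩ := h.bottom.exists_desc (a - b) (by rw [Preadditive.comp_sub, hv, sub_self])
  have : s = 0 := by
    apply h.top.epi_cancel
    rw [← h.comm', Category.assoc, hs, Preadditive.comp_sub, hq, sub_self, comp_zero]
  rw [← sub_eq_zero, ← hs, this, comp_zero]

theorem exists_factor (hP : IsFrobenius P) (h : IsPushoutSquare j p u v w q)
    {W : P.FullSubcategory} (g : Z ⟶ W) (hg : (toStable P).map (v ≫ g) = 0) :
    ∃ s : S ⟶ W, (toStable P).map g = (toStable P).map (w ≫ s) := by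
  rw [toStable_map_eq_zero_iff] at hg
  obtain ⟨e, he, hve⟩ := exists_extension_mem hP h.bottom hg
  obtain ⟨s, hs⟩ := h.bottom.exists_desc (g - e) (by rw [Preadditive.comp_sub, hve, sub_self])
  exact ⟨s, by rwa [toStable_map_eq_iff, hs, sub_sub_cancel]⟩

variable {X' Y' Z' J' S' : P.FullSubcategory} {j' : X' ⟶ J'} {p' : J' ⟶ S'} {u' : X' ⟶ Y'}
    {v' : Y' ⟶ Z'} {w' : Z' ⟶ S'} {q' : J' ⟶ Z'}

theorem exists_map (hP : IsFrobenius P) (h : IsPushoutSquare j p u v w q)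
    (h' : IsPushoutSquare j' p' u' v' w' q') {a : X ⟶ X'} {b : Y ⟶ Y'} {c : S ⟶ S'}
    (hab : (toStable P).map (u ≫ b) = (toStable P).map (a ≫ u'))
    (hc : ConflationCovers j p j' p' a c) : ∃ d : Z ⟶ Z', v ≫ d = b ≫ v' ∧ d ≫ w' = w ≫ c := by
  rw [toStable_map_eq_iff] at hab
  obtain ⟨e, -, he⟩ := exists_extension_mem hP h.top hab
  obtain ⟨β, h1, h2⟩ := hc
  -- The square commutes only stably. Its defect `u ≫ b - a ≫ u'` extends along `j` to `e`, and the
  -- summand `e ≫ v'` absorbs it without changing the composition with `w'`, because `v' ≫ w' = 0`.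
  obtain ⟨d, hd, hd'⟩ := h.exists_desc (b ≫ v') (β ≫ q' + e ≫ v') (by
    rw [Preadditive.comp_add, ← Category.assoc, h1, ← Category.assoc, he, Category.assoc, h'.comm]
    simp)
  refine ⟨d, hd, h.hom_ext ?_ ?_⟩
  · rw [← Category.assoc, hd, Category.assoc, h'.bottom.comp_eq_zero, ← Category.assoc,
      h.bottom.comp_eq_zero, zero_comp, comp_zero]
  · rw [← Category.assoc, hd', ← Category.assoc, h.comm', h2, Preadditive.add_comp, Category.assoc,
      h'.comm', Category.assoc, h'.bottom.comp_eq_zero, comp_zero, add_zero]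

/-- Write `d = 1 + N` stably. From `v ≫ N = 0` it follows that `N` factors through `w`, and `N ≫ w =
0` then gives `N ≫ N = 0`. The inverse is `1 - N`. -/
theorem isIso_of_endomorphism (hP : IsFrobenius P) (h : IsPushoutSquare j p u v w q) (d : Z ⟶ Z)
    (hv : (toStable P).map (v ≫ d) = (toStable P).map v)
    (hw : (toStable P).map (d ≫ w) = (toStable P).map w) : IsIso ((toStable P).map d) := by
  have hN : (toStable P).map (v ≫ (d - 𝟙 Z)) = 0 := by
    rw [Preadditive.comp_sub, Functor.map_sub, hv, Category.comp_id, sub_self]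
  obtain ⟨s, hs⟩ := h.exists_factor hP _ hN
  have hN' : (toStable P).map (d - 𝟙 Z) ≫ (toStable P).map w = 0 := by
    rw [← Functor.map_comp, Preadditive.sub_comp, Functor.map_sub, hw, Category.id_comp, sub_self]
  set N := (toStable P).map (d - 𝟙 Z) with hNdef
  have hNN : N ≫ N = 0 := by
    nth_rw 2 [hs]
    rw [Functor.map_comp, ← Category.assoc, hN', zero_comp]
  have hd : (toStable P).map d = 𝟙 _ + N := by
    rw [hNdef, Functor.map_sub, CategoryTheory.Functor.map_id, add_sub_cancel]
  refine ⟨𝟙 _ - N, ?_, ?_⟩ <;> rw [hd] <;>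
    simp [Preadditive.add_comp, Preadditive.sub_comp, Preadditive.comp_add, Preadditive.comp_sub,
      hNN]

/-- There are maps between the two cones in both directions. Their composites need not be
identities, but they are stably compatible with `v` and `w`, and `isIso_of_endomorphism` shows that
this makes them invertible. -/
theorem exists_iso (hP : IsFrobenius P) (h : IsPushoutSquare j p u v w q)
    (h' : IsPushoutSquare j' p' u' v' w' q') (hJ : IsInjective P J) (hJ' : IsInjective P J')
    (α : (toStable P).obj X ≅ (toStable P).obj X') (β : (toStable P).obj Y ≅ (toStable P).obj Y')
    (hαβ : (toStable P).map u ≫ β.hom = α.hom ≫ (toStable P).map u')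
    {a : X ⟶ X'} (ha : (toStable P).map a = α.hom) {c : S ⟶ S'}
    (hc : ConflationCovers j p j' p' a c) :
    ∃ δ : (toStable P).obj Z ≅ (toStable P).obj Z',
      (toStable P).map v ≫ δ.hom = β.hom ≫ (toStable P).map v' ∧
      δ.hom ≫ (toStable P).map w' = (toStable P).map w ≫ (toStable P).map c := by
  obtain ⟨a', ha'⟩ := (toStable P).map_surjective α.inv
  obtain ⟨b, hb⟩ := (toStable P).map_surjective β.hom
  obtain ⟨b', hb'⟩ := (toStable P).map_surjective β.inv
  obtain ⟨c', hc'⟩ := ConflationCovers.exists_of_isInjective h'.top h.top hJ a'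
  obtain ⟨d, hd, hd'⟩ := h.exists_map hP h' (b := b) (by simp [ha, hb, hαβ]) hc
  obtain ⟨e, he, he'⟩ := h'.exists_map hP h (b := b') (by
    rw [Functor.map_comp, Functor.map_comp, ha', hb', Iso.comp_inv_eq, Category.assoc, hαβ,
      Iso.inv_hom_id_assoc]) hc'
  have hcc' : (toStable P).map (c ≫ c') = 𝟙 _ := by
    rw [← CategoryTheory.Functor.map_id]
    exact ConflationCovers.map_eq hP h.top h.top hJ (hc.comp hc') (.id j p) (by simp [ha, ha'])
  have hcc : (toStable P).map (c' ≫ c) = 𝟙 _ := by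
    rw [← CategoryTheory.Functor.map_id]
    exact ConflationCovers.map_eq hP h'.top h'.top hJ' (hc'.comp hc) (.id j' p')
      (by simp [ha, ha'])
  have i1 : IsIso ((toStable P).map (d ≫ e)) := by
    apply h.isIso_of_endomorphism hP
    · rw [← Category.assoc, hd, Category.assoc, he, ← Category.assoc, Functor.map_comp,
        Functor.map_comp, hb, hb', Iso.hom_inv_id, Category.id_comp]
    · rw [Category.assoc, he', ← Category.assoc, hd', Category.assoc, Functor.map_comp, hcc',
        Category.comp_id]
  have i2 : IsIso ((toStable P).map (e ≫ d)) := by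
    apply h'.isIso_of_endomorphism hP
    · rw [← Category.assoc, he, Category.assoc, hd, ← Category.assoc, Functor.map_comp,
        Functor.map_comp, hb, hb', Iso.inv_hom_id, Category.id_comp]
    · rw [Category.assoc, hd', ← Category.assoc, he', Category.assoc, Functor.map_comp, hcc,
        Category.comp_id]
  have i3 : IsIso ((toStable P).map d) := by
    rw [Functor.map_comp] at i1 i2
    have : IsSplitMono ((toStable P).map d) :=
      ⟨⟨⟨(toStable P).map e ≫ inv ((toStable P).map d ≫ (toStable P).map e), by
        rw [← Category.assoc, IsIso.hom_inv_id]⟩⟩⟩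
    have : Epi ((toStable P).map d) :=
      epi_of_epi_fac (f := (toStable P).map e) (h := (toStable P).map e ≫ (toStable P).map d) rfl
    exact isIso_of_epi_of_isSplitMono _
  refine ⟨asIso ((toStable P).map d), ?_, ?_⟩
  · rw [asIso_hom, ← Functor.map_comp, hd, Functor.map_comp, hb]
  · rw [asIso_hom, ← Functor.map_comp, hd', Functor.map_comp]

/-- Standard triangles refer to the chosen embedding of `X`. Here any conflation with injective
middle term is allowed, at the cost of composing the last map with the comparison `c`. This is
needed for images under a functor, which does not respect the choices. -/
theorem distinguished (hP : IsFrobenius P) (H : InjectiveEmbeddings P)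
    (h : IsPushoutSquare j p u v w q) (hJ : IsInjective P J) {c : S ⟶ H.S X}
    (hc : ConflationCovers j p (H.i X) (H.p X) (𝟙 X) c) :
    (stableTriangles hP H).distinguished ((toStable P).map u) ((toStable P).map v)
      ((toStable P).map (w ≫ c)) := by
  obtain ⟨Z', v', w', q', h'⟩ := exists_isPushoutSquare hP (H.conflation X) u
  obtain ⟨δ, h1, h2⟩ := h.exists_iso hP h' hJ (H.injective X) (Iso.refl _) (Iso.refl _) (by simp)
    (by simp) hc
  refine ⟨X, Y, Z', u, v', w', q', h'.bottom, h'.comm, h'.comm', Iso.refl _, Iso.refl _, δ, ?_, ?_,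
    ?_⟩
  · simp
  · simpa using h1
  · rw [Iso.refl_hom, CategoryTheory.Functor.map_id, Functor.map_comp, h2]
    exact Category.comp_id _

end IsPushoutSquare

end Squares

end StableCat

namespace StableCat

/-! ### Transfer of the Frobenius structure and of triangles along a projective quotient. -/

section Transfer

open CategoryTheory.Limits

variable {C D : Type u} [Category.{v} C] [Abelian C] [Category.{v} D] [Abelian D]
  {P : ObjectProperty C} {Q : ObjectProperty D}

/-- A functor between exact categories that identifies the second one with the quotient of the
first by an ideal of morphisms factoring through projectives, such that deflations
and inflations lift up to morphisms in this ideal. -/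
structure IsProjectiveQuotient (F : P.FullSubcategory ⥤ Q.FullSubcategory) : Prop where
  additive : F.Additive
  full : F.Full
  essSurj : F.EssSurj
  map_conflation : ∀ ⦃X Y Z : P.FullSubcategory⦄ (f : X ⟶ Y) (g : Y ⟶ Z), IsConflation P f g →
    IsConflation Q (F.map f) (F.map g)
  mem_of_map_eq_zero : ∀ ⦃X Y : P.FullSubcategory⦄ (f : X ⟶ Y), F.map f = 0 →
    f ∈ projectiveIdeal P X Y
  exists_deflation : ∀ ⦃E X : P.FullSubcategory⦄ (f : E ⟶ X) (K : Q.FullSubcategory)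
    (i : K ⟶ F.obj E), IsConflation Q i (F.map f) →
    ∃ (K' E' : P.FullSubcategory) (i' : K' ⟶ E') (f' : E' ⟶ X) (r : E' ⟶ E),
      IsConflation P i' f' ∧ F.map (r ≫ f) = F.map f'
  exists_inflation : ∀ ⦃X E : P.FullSubcategory⦄ (f : X ⟶ E) (S : Q.FullSubcategory)
    (p : F.obj E ⟶ S), IsConflation Q (F.map f) p →
    ∃ (E' S' : P.FullSubcategory) (f' : X ⟶ E') (p' : E' ⟶ S') (r : E ⟶ E'),
      IsConflation P f' p' ∧ F.map (f ≫ r) = F.map f'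

theorem IsConflation.of_iso {X Y Z X' Y' Z' : P.FullSubcategory} {f : X ⟶ Y} {g : Y ⟶ Z}
    (h : IsConflation P f g) {f' : X' ⟶ Y'} {g' : Y' ⟶ Z'} (a : X ≅ X') (b : Y ≅ Y') (c : Z ≅ Z')
    (h1 : a.hom ≫ f' = f ≫ b.hom) (h2 : b.hom ≫ g' = g ≫ c.hom) : IsConflation P f' g' := by
  have hz : f' ≫ g' = 0 := by
    rw [← cancel_epi a.hom, ← Category.assoc, h1, Category.assoc, h2, ← Category.assoc,
      h.comp_eq_zero, zero_comp, comp_zero]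
  have hz' : f'.hom ≫ g'.hom = 0 := congrArg InducedCategory.Hom.hom hz
  refine ⟨hz', ShortComplex.shortExact_of_iso (ShortComplex.isoMk (P.ι.mapIso a) (P.ι.mapIso b)
    (P.ι.mapIso c) ?_ ?_) h.shortExact⟩
  · exact congrArg InducedCategory.Hom.hom h1
  · exact congrArg InducedCategory.Hom.hom h2

theorem IsProjective.of_retract {X Y : P.FullSubcategory} (hY : IsProjective P Y) (s : X ⟶ Y)
    (r : Y ⟶ X) (h : s ≫ r = 𝟙 X) : IsProjective P X := by
  intro A B C f g hfg a
  obtain ⟨l, hl⟩ := hY f g hfg (r ≫ a)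
  exact ⟨s ≫ l, by rw [Category.assoc, hl, ← Category.assoc, h, Category.id_comp]⟩

theorem IsInjective.of_retract {X Y : P.FullSubcategory} (hY : IsInjective P Y) (s : X ⟶ Y)
    (r : Y ⟶ X) (h : s ≫ r = 𝟙 X) : IsInjective P X := by
  intro A B C f g hfg a
  obtain ⟨l, hl⟩ := hY f g hfg (a ≫ s)
  exact ⟨l ≫ r, by rw [← Category.assoc, hl, Category.assoc, h, Category.comp_id]⟩

theorem stableTriangles_distinguished_of_iso (hP : IsFrobenius P) (H : InjectiveEmbeddings P)
    {X Y Z X' Y' Z' : StableCategory P} {u : X ⟶ Y} {v : Y ⟶ Z}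
    {w : Z ⟶ (H.suspension hP).obj X} (h : (stableTriangles hP H).distinguished u v w)
    {u' : X' ⟶ Y'} {v' : Y' ⟶ Z'} {w' : Z' ⟶ (H.suspension hP).obj X'} (a : X' ≅ X) (b : Y' ≅ Y)
    (c : Z' ≅ Z) (hu : u' ≫ b.hom = a.hom ≫ u) (hv : v' ≫ c.hom = b.hom ≫ v)
    (hw : w' ≫ (H.suspension hP).map a.hom = c.hom ≫ w) :
    (stableTriangles hP H).distinguished u' v' w' := by
  obtain ⟨X₀, Y₀, Z₀, u₀, v₀, w₀, q, hc, h1, h2, a₀, b₀, c₀, hu₀, hv₀, hw₀⟩ := h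
  refine ⟨X₀, Y₀, Z₀, u₀, v₀, w₀, q, hc, h1, h2, a ≪≫ a₀, b ≪≫ b₀, c ≪≫ c₀, ?_, ?_, ?_⟩
  · rw [Iso.trans_hom, Iso.trans_hom, ← Category.assoc, hu, Category.assoc, hu₀, Category.assoc]
  · rw [Iso.trans_hom, Iso.trans_hom, ← Category.assoc, hv, Category.assoc, hv₀, Category.assoc]
  · rw [Iso.trans_hom, Iso.trans_hom, Functor.map_comp, ← Category.assoc]
    refine (congrArg (· ≫ _) hw).trans ?_
    rw [Category.assoc, Category.assoc]
    exact congrArg (c.hom ≫ ·) hw₀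

theorem suspension_map_eq (hP : IsFrobenius P) (H : InjectiveEmbeddings P)
    {X Y : P.FullSubcategory} (f : X ⟶ Y) {c} (hc : H.Covers f c) :
    (H.suspension hP).map ((toStable P).map f) = (toStable P).map c :=
  InjectiveEmbeddings.Covers.map_eq hP (H.exists_covers f).choose_spec hc
    ((stableRel_congruence P).equivalence.refl _)

namespace IsProjectiveQuotient

variable {F : P.FullSubcategory ⥤ Q.FullSubcategory} (hF : IsProjectiveQuotient F)

include hF

/-- A deflation of `Q` is isomorphic to some `F.map f₀`. The lifting problem is solved in `P`
against the corrected deflation `f'`, and the solution is carried back by `r`, since `F` identifies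
`r ≫ f₀` with `f'`. -/
theorem isProjective_map {X : P.FullSubcategory} (hX : IsProjective P X) :
    IsProjective Q (F.obj X) := by
  have := hF.full
  have := hF.essSurj
  intro A B C f g hfg a
  obtain ⟨f₀, hf₀⟩ := F.map_surjective ((F.objObjPreimageIso B).hom ≫ g ≫ (F.objObjPreimageIso C).inv)
  have h : IsConflation Q (f ≫ (F.objObjPreimageIso B).inv) (F.map f₀) :=
    hfg.of_iso (Iso.refl _) (F.objObjPreimageIso B).symm (F.objObjPreimageIso C).symm
      (by simp) (by simp [hf₀])
  obtain ⟨K', E', i', f', r, h', hr⟩ := hF.exists_deflation _ _ _ h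
  obtain ⟨a₀, ha₀⟩ := F.map_surjective (a ≫ (F.objObjPreimageIso C).inv)
  obtain ⟨l, hl⟩ := hX _ _ h' a₀
  refine ⟨F.map (l ≫ r) ≫ (F.objObjPreimageIso B).hom, ?_⟩
  have h1 : F.map (l ≫ r) ≫ F.map f₀ = a ≫ (F.objObjPreimageIso C).inv := by
    rw [← F.map_comp, Category.assoc, F.map_comp, hr, ← F.map_comp, hl, ha₀]
  rw [hf₀, ← Category.assoc, ← Category.assoc, cancel_mono] at h1
  exact h1

theorem isInjective_map {X : P.FullSubcategory} (hX : IsInjective P X) :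
    IsInjective Q (F.obj X) := by
  have := hF.full
  have := hF.essSurj
  intro A B C f g hfg a
  obtain ⟨f₀, hf₀⟩ := F.map_surjective ((F.objObjPreimageIso A).hom ≫ f ≫ (F.objObjPreimageIso B).inv)
  have h : IsConflation Q (F.map f₀) ((F.objObjPreimageIso B).hom ≫ g) :=
    hfg.of_iso (F.objObjPreimageIso A).symm (F.objObjPreimageIso B).symm (Iso.refl _)
      (by simp [hf₀]) (by simp)
  obtain ⟨E', S', f', p', r, h', hr⟩ := hF.exists_inflation _ _ _ h
  obtain ⟨a₀, ha₀⟩ := F.map_surjective ((F.objObjPreimageIso A).hom ≫ a)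
  obtain ⟨l, hl⟩ := hX _ _ h' a₀
  refine ⟨(F.objObjPreimageIso B).inv ≫ F.map (r ≫ l), ?_⟩
  have h1 : F.map f₀ ≫ F.map (r ≫ l) = (F.objObjPreimageIso A).hom ≫ a := by
    rw [← F.map_comp, ← Category.assoc, F.map_comp, hr, ← F.map_comp, hl, ha₀]
  rw [hf₀, Category.assoc, Category.assoc, cancel_epi] at h1
  exact h1

theorem exists_projective (hP : IsFrobenius P) (X : Q.FullSubcategory) :
    ∃ (K : Q.FullSubcategory) (T : P.FullSubcategory) (f : K ⟶ F.obj T) (g : F.obj T ⟶ X),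
      IsConflation Q f g ∧ IsProjective P T := by
  have := hF.essSurj
  obtain ⟨K, T, f, g, h, hT⟩ := hP.enoughProjectives (F.objPreimage X)
  exact ⟨F.obj K, T, F.map f, F.map g ≫ (F.objObjPreimageIso X).hom,
    (hF.map_conflation _ _ h).of_iso (Iso.refl _) (Iso.refl _) (F.objObjPreimageIso X)
      (by simp) (by simp), hT⟩

theorem exists_injective (hP : IsFrobenius P) (X : Q.FullSubcategory) :
    ∃ (S : Q.FullSubcategory) (T : P.FullSubcategory) (f : X ⟶ F.obj T) (g : F.obj T ⟶ S),
      IsConflation Q f g ∧ IsInjective P T := by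
  have := hF.essSurj
  obtain ⟨T, S, f, g, h, hT⟩ := hP.enoughInjectives (F.objPreimage X)
  exact ⟨F.obj S, T, (F.objObjPreimageIso X).inv ≫ F.map f, F.map g,
    (hF.map_conflation _ _ h).of_iso (F.objObjPreimageIso X) (Iso.refl _) (Iso.refl _)
      (by simp) (by simp), hT⟩

/-- Every object of `Q` has a deflation from, and an inflation into, the image of a
projective-injective object of `P`. A projective or injective object of `Q` splits off such an
image, which is both. -/
theorem isFrobenius (hP : IsFrobenius P) (h0 : Q.ContainsZero)
    (hext : Q.IsClosedUnderExtensions) : IsFrobenius Q where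
  containsZero := h0
  closedUnderExtensions := hext
  enoughProjectives X := by
    obtain ⟨K, T, f, g, h, hT⟩ := hF.exists_projective hP X
    exact ⟨K, F.obj T, f, g, h, hF.isProjective_map hT⟩
  enoughInjectives X := by
    obtain ⟨S, T, f, g, h, hT⟩ := hF.exists_injective hP X
    exact ⟨F.obj T, S, f, g, h, hF.isInjective_map hT⟩
  projective_iff_injective X := by
    constructor
    · intro hX
      obtain ⟨K, T, f, g, h, hT⟩ := hF.exists_projective hP X
      obtain ⟨s, hs⟩ := hX f g h (𝟙 X)
      exact (hF.isInjective_map ((hP.projective_iff_injective T).1 hT)).of_retract s g hs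
    · intro hX
      obtain ⟨S, T, f, g, h, hT⟩ := hF.exists_injective hP X
      obtain ⟨r, hr⟩ := hX f g h (𝟙 X)
      exact (hF.isProjective_map ((hP.projective_iff_injective T).2 hT)).of_retract f r hr

theorem map_mem {X Y : P.FullSubcategory} {f : X ⟶ Y} (hf : f ∈ projectiveIdeal P X Y) :
    F.map f ∈ projectiveIdeal Q (F.obj X) (F.obj Y) := by
  have := hF.additive
  induction hf using AddSubgroup.closure_induction with
  | mem x hx =>
    obtain ⟨T, hT, a, b, rfl⟩ := hx
    exact AddSubgroup.subset_closure ⟨F.obj T, hF.isProjective_map hT, F.map a, F.map b, by simp⟩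
  | zero => simp
  | add x y _ _ hx hy => rw [F.map_add]; exact add_mem hx hy
  | neg x _ hx => rw [F.map_neg]; exact neg_mem hx

/-- A projective of `Q` is a retract of the image of a projective of `P`, so by fullness every
morphism in the ideal of `Q` is `F.map g` with `g` in the ideal of `P`. The difference `f - g` is
killed by `F`, hence lies in the ideal as well. -/
theorem map_mem_iff (hP : IsFrobenius P) {X Y : P.FullSubcategory} (f : X ⟶ Y) :
    F.map f ∈ projectiveIdeal Q (F.obj X) (F.obj Y) ↔ f ∈ projectiveIdeal P X Y := by
  refine ⟨fun h => ?_, hF.map_mem⟩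
  have := hF.additive
  have := hF.full
  have key : ∀ h ∈ projectiveIdeal Q (F.obj X) (F.obj Y), ∃ g ∈ projectiveIdeal P X Y,
      F.map g = h := by
    intro h hh
    induction hh using AddSubgroup.closure_induction with
    | mem x hx =>
      obtain ⟨T, hT, a, b, rfl⟩ := hx
      obtain ⟨K, T', i, p, hp, hT'⟩ := hF.exists_projective hP T
      obtain ⟨s, hs⟩ := hT i p hp (𝟙 T)
      obtain ⟨a', ha'⟩ := F.map_surjective (a ≫ s)
      obtain ⟨b', hb'⟩ := F.map_surjective (p ≫ b)
      refine ⟨a' ≫ b', AddSubgroup.subset_closure ⟨T', hT', a', b', rfl⟩, ?_⟩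
      rw [F.map_comp, ha', hb', Category.assoc, ← Category.assoc s, hs, Category.id_comp]
    | zero => exact ⟨0, zero_mem _, F.map_zero _ _⟩
    | add x y _ _ hx hy =>
      obtain ⟨c, hc, rfl⟩ := hx
      obtain ⟨d, hd, rfl⟩ := hy
      exact ⟨c + d, add_mem hc hd, F.map_add⟩
    | neg x _ hx =>
      obtain ⟨c, hc, rfl⟩ := hx
      exact ⟨-c, neg_mem hc, F.map_neg⟩
  obtain ⟨g, hg, hgf⟩ := key _ h
  have := add_mem (hF.mem_of_map_eq_zero (f - g) (by rw [F.map_sub, hgf, sub_self])) hg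
  rwa [sub_add_cancel] at this

theorem toStable_map_eq {X Y : P.FullSubcategory} (f g : X ⟶ Y) (h : stableRel P f g) :
    (F ⋙ toStable Q).map f = (F ⋙ toStable Q).map g := by
  have := hF.additive
  rw [Functor.comp_map, Functor.comp_map, toStable_map_eq_iff, ← F.map_sub]
  exact hF.map_mem h

theorem toStable_map_eq_iff (hP : IsFrobenius P) {X Y : P.FullSubcategory} (f g : X ⟶ Y) :
    (toStable Q).map (F.map f) = (toStable Q).map (F.map g) ↔
      (toStable P).map f = (toStable P).map g := by
  have := hF.additive
  rw [StableCat.toStable_map_eq_iff, StableCat.toStable_map_eq_iff, ← F.map_sub,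
    hF.map_mem_iff hP]

/-- The functor between the stable categories induced by `F`. -/
abbrev stableFunctor (F : P.FullSubcategory ⥤ Q.FullSubcategory)
    (hst : ∀ (X Y : P.FullSubcategory) (f g : X ⟶ Y), stableRel P f g →
      (F ⋙ toStable Q).map f = (F ⋙ toStable Q).map g) :
    StableCategory P ⥤ StableCategory Q :=
  CategoryTheory.Quotient.lift (stableRel P) (F ⋙ toStable Q) hst

variable (hst : ∀ (X Y : P.FullSubcategory) (f g : X ⟶ Y), stableRel P f g →
      (F ⋙ toStable Q).map f = (F ⋙ toStable Q).map g)

theorem stableFunctor_additive : (stableFunctor F hst).Additive where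
  map_add {X Y f g} := by
    have := hF.additive
    obtain ⟨f, rfl⟩ := (toStable P).map_surjective (X := X.as) (Y := Y.as) f
    obtain ⟨g, rfl⟩ := (toStable P).map_surjective (X := X.as) (Y := Y.as) g
    rw [← Functor.map_add]
    exact (congrArg (toStable Q).map F.map_add).trans (Functor.map_add _)

theorem stableFunctor_isEquivalence (hP : IsFrobenius P) :
    (stableFunctor F hst).IsEquivalence where
  full := ⟨fun {X Y} f => by
    have := hF.full
    obtain ⟨f, rfl⟩ := (toStable Q).map_surjective (X := F.obj X.as) (Y := F.obj Y.as) f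
    obtain ⟨f, rfl⟩ := F.map_surjective f
    exact ⟨(toStable P).map f, rfl⟩⟩
  faithful := ⟨fun {X Y} f g h => by
    obtain ⟨f, rfl⟩ := (toStable P).map_surjective (X := X.as) (Y := Y.as) f
    obtain ⟨g, rfl⟩ := (toStable P).map_surjective (X := X.as) (Y := Y.as) g
    exact (hF.toStable_map_eq_iff hP f g).1 h⟩
  essSurj := ⟨fun Y => by
    have := hF.essSurj
    exact ⟨(toStable P).obj (F.objPreimage Y.as),
      ⟨(toStable Q).mapIso (F.objObjPreimageIso Y.as)⟩⟩⟩

omit hF in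
theorem map_covers {X J S X' J' S' : P.FullSubcategory} {j : X ⟶ J} {p : J ⟶ S}
    {j' : X' ⟶ J'} {p' : J' ⟶ S'} {f : X ⟶ X'} {c : S ⟶ S'}
    (h : ConflationCovers j p j' p' f c) :
    ConflationCovers (F.map j) (F.map p) (F.map j') (F.map p') (F.map f) (F.map c) := by
  obtain ⟨b, h1, h2⟩ := h
  exact ⟨F.map b, by rw [← F.map_comp, h1, F.map_comp], by rw [← F.map_comp, h2, F.map_comp]⟩

theorem map_isPushoutSquare {X Y Z J S : P.FullSubcategory} {j : X ⟶ J} {p : J ⟶ S} {u : X ⟶ Y}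
    {v : Y ⟶ Z} {w : Z ⟶ S} {q : J ⟶ Z} (h : IsPushoutSquare j p u v w q) :
    IsPushoutSquare (F.map j) (F.map p) (F.map u) (F.map v) (F.map w) (F.map q) where
  top := hF.map_conflation _ _ h.top
  bottom := hF.map_conflation _ _ h.bottom
  comm := by rw [← F.map_comp, h.comm, F.map_comp]
  comm' := by rw [← F.map_comp, h.comm']

variable (hP : IsFrobenius P) (hQ : IsFrobenius Q) (HP : InjectiveEmbeddings P)
  (HQ : InjectiveEmbeddings Q)

theorem exists_suspension_comparison (X : P.FullSubcategory) :
    ∃ c, ConflationCovers (F.map (HP.i X)) (F.map (HP.p X)) (HQ.i (F.obj X)) (HQ.p (F.obj X))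
      (𝟙 (F.obj X)) c :=
  ConflationCovers.exists_of_isInjective (hF.map_conflation _ _ (HP.conflation X))
    (HQ.conflation _) (HQ.injective _) _

/-- The comparison of the image of the suspension of `X` with the suspension of the image. -/
noncomputable def suspensionComparison (X : P.FullSubcategory) :
    F.obj (HP.S X) ⟶ HQ.S (F.obj X) :=
  (hF.exists_suspension_comparison HP HQ X).choose

theorem suspensionComparison_covers (X : P.FullSubcategory) :
    ConflationCovers (F.map (HP.i X)) (F.map (HP.p X)) (HQ.i (F.obj X)) (HQ.p (F.obj X))
      (𝟙 (F.obj X)) (hF.suspensionComparison HP HQ X) :=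
  (hF.exists_suspension_comparison HP HQ X).choose_spec

-- Comparison maps exist in both directions because both middle terms are injective. Their
-- composites cover the identity of `F.obj X`, and what covers a given stable morphism is stably
-- unique.
include hQ in
theorem isIso_suspensionComparison (X : P.FullSubcategory) :
    IsIso ((toStable Q).map (hF.suspensionComparison HP HQ X)) := by
  have h1 := hF.map_conflation _ _ (HP.conflation X)
  have h2 := HQ.conflation (F.obj X)
  have hc := hF.suspensionComparison_covers HP HQ X
  obtain ⟨d, hd⟩ := ConflationCovers.exists_of_isInjective h2 h1
    (hF.isInjective_map (HP.injective X)) (𝟙 _)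
  refine ⟨(toStable Q).map d, ?_, ?_⟩
  · rw [← Functor.map_comp, ← CategoryTheory.Functor.map_id]
    exact ConflationCovers.map_eq hQ h1 h1 (hF.isInjective_map (HP.injective X)) (hc.comp hd)
      (.id _ _) (by simp)
  · rw [← Functor.map_comp, ← CategoryTheory.Functor.map_id]
    exact ConflationCovers.map_eq hQ h2 h2 (HQ.injective _) (hd.comp hc) (.id _ _) (by simp)

include hQ in
theorem suspensionComparison_naturality {X Y : P.FullSubcategory} {f : X ⟶ Y}
    {c : HP.S X ⟶ HP.S Y} (hc : HP.Covers f c) {d : HQ.S (F.obj X) ⟶ HQ.S (F.obj Y)}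
    {g : F.obj X ⟶ F.obj Y} (hg : (toStable Q).map g = (toStable Q).map (F.map f))
    (hd : HQ.Covers g d) :
    (toStable Q).map (F.map c) ≫ (toStable Q).map (hF.suspensionComparison HP HQ Y) =
      (toStable Q).map (hF.suspensionComparison HP HQ X) ≫ (toStable Q).map d := by
  rw [← Functor.map_comp, ← Functor.map_comp]
  have h1 := (map_covers (F := F) (j := HP.i X) (p := HP.p X) (j' := HP.i Y) (p' := HP.p Y) hc).comp
    (hF.suspensionComparison_covers HP HQ Y)
  have h2 := (hF.suspensionComparison_covers HP HQ X).comp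
    (show ConflationCovers (HQ.i _) (HQ.p _) (HQ.i _) (HQ.p _) g d from hd)
  exact ConflationCovers.map_eq hQ (hF.map_conflation _ _ (HP.conflation X)) (HQ.conflation _)
    (HQ.injective _) h1 h2 (by simp [hg])

/-- The suspension commutes with the functor induced on stable categories. -/
noncomputable def suspensionIso :
    HP.suspension hP ⋙ stableFunctor F hst ≅ stableFunctor F hst ⋙ HQ.suspension hQ :=
  NatIso.ofComponents
    (fun X => @asIso _ _ _ _ ((toStable Q).map (hF.suspensionComparison HP HQ X.as))
      (hF.isIso_suspensionComparison hQ HP HQ X.as))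
    (fun {X Y} f => by
      obtain ⟨f, rfl⟩ := (toStable P).map_surjective (X := X.as) (Y := Y.as) f
      exact hF.suspensionComparison_naturality hQ HP HQ (HP.exists_covers f).choose_spec rfl
        (HQ.exists_covers (F.map f)).choose_spec)

theorem distinguished_map {X Y Z : StableCategory P} {u : X ⟶ Y} {v : Y ⟶ Z}
    {w : Z ⟶ (HP.suspension hP).obj X} (h : (stableTriangles hP HP).distinguished u v w) :
    (stableTriangles hQ HQ).distinguished ((stableFunctor F hst).map u)
      ((stableFunctor F hst).map v)
      ((stableFunctor F hst).map w ≫ (hF.suspensionIso hst hP hQ HP HQ).hom.app X) := by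
  obtain ⟨X', Y', Z', u', v', w', q, hc, h1, h2, a, b, c, hu, hv, hw⟩ := h
  have sq : IsPushoutSquare (HP.i X') (HP.p X') u' v' w' q := ⟨HP.conflation X', hc, h1, h2⟩
  -- The image of the standard square lies over the image of the embedding chosen in `P`, not over
  -- the embedding chosen in `Q`; the suspension comparison accounts for the difference.
  have hd := (hF.map_isPushoutSquare sq).distinguished hQ HQ (hF.isInjective_map (HP.injective X'))
    (hF.suspensionComparison_covers HP HQ X')
  refine stableTriangles_distinguished_of_iso hQ HQ hd ((stableFunctor F hst).mapIso a)
    ((stableFunctor F hst).mapIso b) ((stableFunctor F hst).mapIso c) ?_ ?_ ?_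
  · exact ((stableFunctor F hst).map_comp _ _).symm.trans
      ((congrArg (stableFunctor F hst).map hu).trans ((stableFunctor F hst).map_comp _ _))
  · exact ((stableFunctor F hst).map_comp _ _).symm.trans
      ((congrArg (stableFunctor F hst).map hv).trans ((stableFunctor F hst).map_comp _ _))
  · have hn := (hF.suspensionIso hst hP hQ HP HQ).hom.naturality a.hom
    have hw' := congrArg (stableFunctor F hst).map hw
    replace hw' := (((stableFunctor F hst).map_comp _ _).symm.trans hw').trans
      ((stableFunctor F hst).map_comp _ _)
    refine (Category.assoc _ _ _).trans ((congrArg (_ ≫ ·) hn.symm).trans ?_)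
    refine (Category.assoc _ _ _).symm.trans ((congrArg (· ≫ _) hw').trans ?_)
    refine (Category.assoc _ _ _).trans (congrArg ((stableFunctor F hst).map c.hom ≫ ·) ?_)
    exact ((toStable Q).map_comp _ _).symm

/-- A cone of `u` is built in `P`. Its image is isomorphic to the third object of the given triangle
by uniqueness of cones, and the equivalence lifts this isomorphism to the stable category of `P`. -/
theorem distinguished_of_map {X Y Z : StableCategory P} {u : X ⟶ Y} {v : Y ⟶ Z}
    {w : Z ⟶ (HP.suspension hP).obj X} (h : (stableTriangles hQ HQ).distinguished
      ((stableFunctor F hst).map u) ((stableFunctor F hst).map v)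
      ((stableFunctor F hst).map w ≫ (hF.suspensionIso hst hP hQ HP HQ).hom.app X)) :
    (stableTriangles hP HP).distinguished u v w := by
  have heq := hF.stableFunctor_isEquivalence hst hP
  obtain ⟨X', Y', Z', u', v', w', q, hc, h1, h2, a, b, c, hu, hv, hw⟩ := h
  have sq' : IsPushoutSquare (HQ.i X') (HQ.p X') u' v' w' q := ⟨HQ.conflation X', hc, h1, h2⟩
  obtain ⟨u₀, rfl⟩ := (toStable P).map_surjective (X := X.as) (Y := Y.as) u
  obtain ⟨Z₀, v₀, w₀, q₀, sq⟩ := exists_isPushoutSquare hP (HP.conflation X.as) u₀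
  obtain ⟨a₀, ha₀⟩ := (toStable Q).map_surjective (X := F.obj X.as) (Y := X') a.hom
  obtain ⟨d, hd⟩ := HQ.exists_covers a₀
  have hcov := (hF.suspensionComparison_covers HP HQ X.as).comp
    (show ConflationCovers (HQ.i _) (HQ.p _) (HQ.i _) (HQ.p _) a₀ d from hd)
  rw [Category.id_comp] at hcov
  obtain ⟨δ, hδ, hδ'⟩ := (hF.map_isPushoutSquare sq).exists_iso hQ sq'
    (hF.isInjective_map (HP.injective _)) (HQ.injective _) a b hu ha₀ hcov
  have hsa : (HQ.suspension hQ).map a.hom = (toStable Q).map d := by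
    rw [← ha₀]
    exact suspension_map_eq hQ HQ a₀ hd
  let θ : (toStable P).obj Z₀ ≅ Z := (stableFunctor F hst).preimageIso (δ ≪≫ c.symm)
  have hθ : (stableFunctor F hst).map θ.inv = c.hom ≫ δ.inv := by
    change (stableFunctor F hst).map ((stableFunctor F hst).preimage _) = _
    rw [Functor.map_preimage]
    rfl
  refine ⟨X.as, Y.as, Z₀, u₀, v₀, w₀, q₀, sq.bottom, sq.comm, sq.comm', Iso.refl _, Iso.refl _,
    θ.symm, (Category.comp_id _).trans (Category.id_comp _).symm, ?_, ?_⟩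
  · refine Eq.trans ?_ (Category.id_comp _).symm
    apply (stableFunctor F hst).map_injective
    refine ((stableFunctor F hst).map_comp _ _).trans ((congrArg (_ ≫ ·) hθ).trans ?_)
    rw [← Category.assoc, Iso.comp_inv_eq]
    exact hv.trans hδ.symm
  · refine (congrArg (w ≫ ·) (CategoryTheory.Functor.map_id _ _)).trans
      ((Category.comp_id _).trans ?_)
    apply (stableFunctor F hst).map_injective
    refine Eq.trans ?_ ((stableFunctor F hst).map_comp _ _).symm
    refine Eq.trans ?_ (congrArg (· ≫ (stableFunctor F hst).map ((toStable P).map w₀)) hθ.symm)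
    have := hF.isIso_suspensionComparison hQ HP HQ X.as
    have h3 : (stableFunctor F hst).map w ≫ ((toStable Q).map (hF.suspensionComparison HP HQ X.as) ≫
        (HQ.suspension hQ).map a.hom) = c.hom ≫ (toStable Q).map w' :=
      (Category.assoc _ _ _).symm.trans hw
    have h4 : (toStable Q).map (F.map w₀) ≫ ((toStable Q).map
        (hF.suspensionComparison HP HQ X.as) ≫ (HQ.suspension hQ).map a.hom) =
          δ.hom ≫ (toStable Q).map w' := by
      rw [hsa, hδ', Functor.map_comp]
      rfl
    -- The identity for the third map of the triangle is known only after passing to the suspension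
    -- of `X'`, by an invertible map that can be cancelled.
    have hm : Mono ((toStable Q).map (hF.suspensionComparison HP HQ X.as) ≫
        (HQ.suspension hQ).map a.hom) := by
      have h5 := ((HQ.suspension hQ).mapIso a).isIso_hom
      exact mono_comp' (IsIso.mono_of_iso _) (@IsIso.mono_of_iso _ _ _ _ _ h5)
    refine (cancel_mono ((toStable Q).map (hF.suspensionComparison HP HQ X.as) ≫
        (HQ.suspension hQ).map a.hom)).1 ?_
    refine h3.trans ?_
    refine Eq.trans ?_ (Category.assoc _ _ _).symm
    refine Eq.trans ?_ (congrArg ((c.hom ≫ δ.inv) ≫ ·) h4.symm)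
    refine Eq.trans ?_ (Category.assoc _ _ _).symm
    exact congrArg (c.hom ≫ ·) (Iso.inv_hom_id_assoc δ _).symm

theorem isTriangleEquivalence :
    IsTriangleEquivalence (stableTriangles hP HP) (stableTriangles hQ HQ)
      (stableFunctor F hst) :=
  ⟨hF.stableFunctor_additive hst, hF.stableFunctor_isEquivalence hst hP,
    hF.suspensionIso hst hP hQ HP HQ, fun _ _ _ =>
    ⟨hF.distinguished_map hst hP hQ HP HQ, hF.distinguished_of_map hst hP hQ HP HQ⟩⟩

end IsProjectiveQuotient

end Transfer

end StableCat

namespace StableCat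

/-! ### Comparison of `Ext¹` through connecting homomorphisms. -/

section ExtComparison

open CategoryTheory.Limits CategoryTheory.Abelian

variable {C D : Type u} [Category.{v} C] [Abelian C] [Category.{v} D] [Abelian D]

/-- The connecting homomorphism `Hom(K, Y) → Ext¹(X, Y)` of a short exact sequence
`0 ⟶ K ⟶ T ⟶ X ⟶ 0`. -/
noncomputable def extConnecting [HasExt.{v} C] {S : ShortComplex C} (hS : S.ShortExact) (Y : C) :
    (S.X₁ ⟶ Y) →+ Ext S.X₃ Y 1 where
  toFun h := hS.extClass.comp (Ext.mk₀ h) (add_zero 1)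
  map_zero' := by simp
  map_add' a b := by simp [Ext.mk₀_add]

theorem extConnecting_eq_zero_iff [HasExt.{v} C] {S : ShortComplex C} (hS : S.ShortExact) {Y : C}
    (h : S.X₁ ⟶ Y) : extConnecting hS Y h = 0 ↔ ∃ l : S.X₂ ⟶ Y, S.f ≫ l = h := by
  constructor
  · intro hh
    obtain ⟨x, hx⟩ := Ext.contravariant_sequence_exact₁ hS Y (Ext.mk₀ h) (add_zero 1) hh
    obtain ⟨l, rfl⟩ := (Ext.mk₀_bijective _ _).2 x
    exact ⟨l, (Ext.mk₀_bijective _ _).1 (by rw [← hx, Ext.mk₀_comp_mk₀])⟩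
  · rintro ⟨l, rfl⟩
    change hS.extClass.comp (Ext.mk₀ (S.f ≫ l)) (add_zero 1) = 0
    rw [← Ext.mk₀_comp_mk₀]
    exact hS.extClass_comp_assoc _

theorem extConnecting_surjective [HasExt.{v} C] {S : ShortComplex C} (hS : S.ShortExact) (Y : C)
    (h0 : ∀ e : Ext S.X₂ Y 1, e = 0) : Function.Surjective (extConnecting hS Y) := by
  intro e
  obtain ⟨x, hx⟩ := Ext.contravariant_sequence_exact₃ hS Y e (h0 _) (add_zero 1)
  obtain ⟨l, rfl⟩ := (Ext.mk₀_bijective _ _).2 x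
  exact ⟨l, hx⟩

/-- The detour through `eqToHom` allows for images under a functor `G`, where the third component is
`G.map (𝟙 X)` and becomes an identity only after rewriting. -/
theorem extConnecting_eq_extClass [HasExt.{v} C] {S T : ShortComplex C} (hS : S.ShortExact)
    (hT : T.ShortExact) (φ : S ⟶ T) (e : S.X₃ = T.X₃) (hφ : φ.τ₃ = eqToHom e) :
    extConnecting hS T.X₁ φ.τ₁ = (Ext.mk₀ (eqToHom e)).comp hT.extClass (zero_add 1) := by
  rw [← hφ]
  exact ShortComplex.ShortExact.extClass_naturality hS hT φ

/-- A class is the connecting image of some `h` defined on the kernel of a projective cover; the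
pushout of the cover along `h` is an extension with that class. -/
theorem exists_extClass_eq [HasExt.{v} C] [EnoughProjectives C] {X Y : C} (e : Ext X Y 1) :
    ∃ (E : C) (f : Y ⟶ E) (g : E ⟶ X) (w : f ≫ g = 0) (hS : (ShortComplex.mk f g w).ShortExact),
      hS.extClass = e := by
  let S := ShortComplex.mk (kernel.ι (Projective.π X)) (Projective.π X) (by simp)
  have hS : S.ShortExact :=
    { exact := ShortComplex.exact_kernel _
      mono_f := inferInstanceAs (Mono (kernel.ι _))
      epi_g := inferInstanceAs (Epi (Projective.π X)) }
  have : Projective S.X₂ := inferInstanceAs (Projective (Projective.over X))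
  obtain ⟨h, rfl⟩ := extConnecting_surjective hS Y (fun e => e.eq_zero_of_projective) e
  have hZ := IsPushout.of_hasPushout S.f h
  have e : S.f ≫ S.g = h ≫ 0 := by rw [S.zero, comp_zero]
  have hs := shortExact_of_isPushout hS hZ (hZ.inl_desc _ _ e) (hZ.inr_desc _ _ e)
  refine ⟨_, _, _, _, hs, ?_⟩
  have := extConnecting_eq_extClass hS hs
    { τ₁ := h, τ₂ := pushout.inl _ _, τ₃ := 𝟙 _, comm₁₂ := hZ.w.symm,
      comm₂₃ := (hZ.inl_desc _ _ e).trans (Category.comp_id _).symm } rfl rfl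
  exact ((Ext.mk₀_id_comp _).symm.trans this.symm)

variable {P : ObjectProperty C} {Q : ObjectProperty D} [HasExt.{v} C] [HasExt.{v} D]
  [EnoughProjectives D]

-- The object is projective only relative to `Q`. As `Q` is closed under extensions, any extension
-- representing the class has its middle term in `Q`, so its deflation splits.
omit [HasExt.{v} C] [Category.{v} C] [Abelian C] in
theorem ext_eq_zero_of_isProjective [Q.IsClosedUnderExtensions] {X Y : D} (hX : Q X) (hY : Q Y)
    (h : IsProjective Q ⟨X, hX⟩) (e : Ext X Y 1) : e = 0 := by
  obtain ⟨E, f, g, w, hS, rfl⟩ := exists_extClass_eq e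
  have hE : Q E := Q.prop_X₂_of_shortExact hS hY hX
  have hc : IsConflation Q (X := ⟨Y, hY⟩) (Y := ⟨E, hE⟩) (Z := ⟨X, hX⟩) (Q.homMk f) (Q.homMk g) :=
    ⟨w, hS⟩
  obtain ⟨s, hs⟩ := h _ _ hc (𝟙 _)
  have hs' : s.hom ≫ g = 𝟙 X := congrArg InducedCategory.Hom.hom hs
  have h1 := hS.comp_extClass
  have h2 : (Ext.mk₀ s.hom).comp ((Ext.mk₀ g).comp hS.extClass (zero_add 1)) (zero_add 1) = 0 := by
    rw [h1, Ext.comp_zero]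
  rw [Ext.mk₀_comp_mk₀_assoc, hs'] at h2
  exact (Ext.mk₀_id_comp _).symm.trans h2

/-- A projective quotient functor induced by a functor of the ambient abelian categories
induces isomorphisms on the groups of extensions. -/
theorem IsProjectiveQuotient.exists_extEquiv (G : C ⥤ D) [G.Additive]
    (hG : ∀ M, P M → Q (G.obj M))
    (hF : IsProjectiveQuotient (Q.lift (P.ι ⋙ G) fun M => hG M.obj M.property))
    (hP : IsFrobenius P) (hQ : IsFrobenius Q) {X Y : C} (hX : P X) (hY : P Y)
    (hpres : ∃ (K T : C) (f : K ⟶ T) (g : T ⟶ X) (w : f ≫ g = 0), P K ∧ P T ∧ Projective T ∧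
      (ShortComplex.mk f g w).ShortExact) :
    ∃ Φ : Ext X Y 1 ≃+ Ext (G.obj X) (G.obj Y) 1,
      ∀ (E : C) (f : Y ⟶ E) (g : E ⟶ X) (w : f ≫ g = 0)
        (hS : (ShortComplex.mk f g w).ShortExact),
        ∃ hS' : ((ShortComplex.mk f g w).map G).ShortExact, Φ hS.extClass = hS'.extClass := by
  obtain ⟨K, T, i, p, hip, hK, hT, hTP, hS⟩ := hpres
  have := hP.closedUnderExtensions
  have := hQ.closedUnderExtensions
  have := hF.full
  have hGfull : ∀ {A B : C} (_ : P A) (_ : P B) (h : G.obj A ⟶ G.obj B), ∃ h', G.map h' = h := by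
    intro A B hA hB h
    obtain ⟨h', hh⟩ := Functor.Full.map_surjective
      (F := Q.lift (P.ι ⋙ G) fun M => hG M.obj M.property) (X := ⟨A, hA⟩) (Y := ⟨B, hB⟩)
      (ObjectProperty.homMk (X := ⟨G.obj A, hG A hA⟩) (Y := ⟨G.obj B, hG B hB⟩) h)
    exact ⟨h'.hom, congrArg Q.ι.map hh⟩
  have hmap : ∀ {A B E : C} (f : A ⟶ B) (g : B ⟶ E) (w : f ≫ g = 0), P A → P E →
      (ShortComplex.mk f g w).ShortExact → ((ShortComplex.mk f g w).map G).ShortExact := by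
    intro A B E f g w hA hE h
    have hB : P B := P.prop_X₂_of_shortExact h hA hE
    exact (hF.map_conflation (X := ⟨A, hA⟩) (Y := ⟨B, hB⟩) (Z := ⟨E, hE⟩) (P.homMk f) (P.homMk g)
      ⟨w, h⟩).shortExact
  have hTproj : IsProjective P ⟨T, hT⟩ := by
    intro A B E f g hc h
    have := hc.shortExact.epi_g
    refine ⟨P.homMk (Projective.factorThru h.hom g.hom), ?_⟩
    ext
    exact Projective.factorThru_comp _ _
  have hS' := hmap i p hip hK hX hS
  have hsurj := extConnecting_surjective hS Y (fun e => e.eq_zero_of_projective)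
  -- `G.obj T` need not be projective in `D`, but it is projective in `Q`, which makes the relevant
  -- `Ext¹` vanish.
  have hsurj' := extConnecting_surjective hS' (G.obj Y)
    (ext_eq_zero_of_isProjective (hG _ hT) (hG _ hY) (hF.isProjective_map hTproj))
  let ψ : (K ⟶ Y) →+ Ext (G.obj X) (G.obj Y) 1 :=
    (extConnecting hS' (G.obj Y)).comp (G.mapAddHom (X := K) (Y := Y))
  -- Both groups are `Hom(K, Y)` modulo maps that extend to the middle term, so `G` must be shown to
  -- reflect extendability.
  have hψ : ∀ h, ψ h = 0 ↔ extConnecting hS Y h = 0 := by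
    intro h
    refine (extConnecting_eq_zero_iff hS' (G.map h)).trans
      (Iff.trans ?_ (extConnecting_eq_zero_iff hS h).symm)
    constructor
    · rintro ⟨l, hl⟩
      obtain ⟨l, rfl⟩ := hGfull hT hY l
      have h0 : (Q.lift (P.ι ⋙ G) fun M => hG M.obj M.property).map
          (X := ⟨K, hK⟩) (Y := ⟨Y, hY⟩) (P.homMk (h - i ≫ l)) = 0 := by
        ext
        change G.map (h - i ≫ l) = 0
        rw [G.map_sub, G.map_comp]
        exact sub_eq_zero.2 hl.symm
      -- The defect `h - i ≫ l` is killed by `G`, so it lies in the ideal of projectives and extends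
      -- along the inflation `i`.
      obtain ⟨e, -, he⟩ := exists_extension_mem hP (X := ⟨K, hK⟩) (Y := ⟨T, hT⟩) (Z := ⟨X, hX⟩)
        (i := P.homMk i) (p := P.homMk p) ⟨hip, hS⟩ (hF.mem_of_map_eq_zero _ h0)
      have he' : i ≫ e.hom = h - i ≫ l := congrArg InducedCategory.Hom.hom he
      exact ⟨e.hom + l, by rw [Preadditive.comp_add]; exact eq_sub_iff_add_eq.1 he'⟩
    · rintro ⟨l, rfl⟩
      exact ⟨G.map l, (G.map_comp _ _).symm⟩
  let Φ := (extConnecting hS Y).liftOfSurjective hsurj ⟨ψ, fun h hh => (hψ h).2 hh⟩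
  have hΦ : ∀ h, Φ (extConnecting hS Y h) = ψ h := fun h =>
    AddMonoidHom.liftOfRightInverse_comp_apply _ _ _ _ h
  have hbij : Function.Bijective Φ := by
    constructor
    · rw [injective_iff_map_eq_zero]
      intro e he
      obtain ⟨h, rfl⟩ := hsurj e
      rw [hΦ] at he
      exact (hψ h).1 he
    · intro e
      obtain ⟨h, rfl⟩ := hsurj' e
      obtain ⟨h, rfl⟩ := hGfull hK hY h
      exact ⟨extConnecting hS Y h, hΦ h⟩
  refine ⟨AddEquiv.ofBijective Φ hbij, fun E f g w hE => ⟨hmap f g w hY hX hE, ?_⟩⟩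
  have := hE.epi_g
  have := hE.mono_f
  have hl : Projective.factorThru p g ≫ g = p := Projective.factorThru_comp _ _
  have hlz : (i ≫ Projective.factorThru p g) ≫ g = 0 := by rw [Category.assoc, hl, hip]
  -- A map from the presentation to the extension over `𝟙 X` exhibits the class as the connecting
  -- image of its first component. The image of this map under `G` does the same in `D`.
  let φ : ShortComplex.mk i p hip ⟶ ShortComplex.mk f g w :=
    { τ₁ := hE.exact.lift _ hlz
      τ₂ := Projective.factorThru p g
      τ₃ := 𝟙 X
      comm₁₂ := hE.exact.lift_f _ hlz
      comm₂₃ := hl.trans (Category.comp_id _).symm }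
  have h1 := extConnecting_eq_extClass hS hE φ rfl rfl
  have h2 := extConnecting_eq_extClass hS' (hmap f g w hY hX hE) (G.mapShortComplex.map φ) rfl
    (G.map_id X)
  have h1' : extConnecting hS Y φ.τ₁ = hE.extClass := h1.trans (Ext.mk₀_id_comp _)
  have h2' : extConnecting hS' (G.obj Y) (G.map φ.τ₁) = (hmap f g w hY hX hE).extClass :=
    h2.trans (Ext.mk₀_id_comp _)
  change Φ hE.extClass = _
  rw [← h1', hΦ, ← h2']
  rfl

end ExtComparison

end StableCat

namespace GrassmannianCM

/-! ### Arithmetic of `𝕜[[x, y]]` modulo `x ^ k - y ^ (n - k)` over `𝕜[[x y]]`. -/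

section PowerSeriesRing

open MvPowerSeries

variable {𝕜 : Type u} [Field 𝕜]

theorem eq_C_add_X_mul (f : MvPowerSeries (Fin 2) 𝕜) (s s' : Fin 2) (hs : s ≠ s') :
    ∃ c f₁ f₂, f = C c + X s * f₁ + X s' * f₂ := by
  classical
  let g : MvPowerSeries (Fin 2) 𝕜 := fun m => if m s = 0 then coeff m f else 0
  have hg : ∀ m, coeff m g = if m s = 0 then coeff m f else 0 := fun m => rfl
  obtain ⟨f₁, h₁⟩ : X s ∣ f - g := by
    rw [X_dvd_iff]
    intro m hm
    rw [map_sub, hg, if_pos hm, sub_self]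
  obtain ⟨f₂, h₂⟩ : X s' ∣ g - C (constantCoeff f) := by
    rw [X_dvd_iff]
    intro m hm
    rw [map_sub, hg, coeff_C]
    by_cases h0 : m s = 0
    · have : m = 0 := by
        ext i
        fin_cases s <;> fin_cases s' <;> fin_cases i <;> simp_all
      subst this
      simp
    · have : m ≠ 0 := fun h => h0 (by simp [h])
      simp [h0, this]
  exact ⟨constantCoeff f, f₁, f₂, by rw [add_assoc, ← h₂, ← h₁]; ring⟩

theorem eq_sum_C_mul_X_pow (s s' : Fin 2) (hs : s ≠ s') (N : ℕ) (f : MvPowerSeries (Fin 2) 𝕜) :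
    ∃ (c : ℕ → 𝕜) (f₁ f₂ : MvPowerSeries (Fin 2) 𝕜),
      f = ∑ r ∈ Finset.range N, C (c r) * X s ^ r + X s ^ N * f₁ + X s' * f₂ := by
  induction N with
  | zero => exact ⟨0, f, 0, by simp⟩
  | succ N ih =>
    obtain ⟨c, f₁, f₂, h⟩ := ih
    obtain ⟨a, g₁, g₂, hg⟩ := eq_C_add_X_mul f₁ s s' hs
    refine ⟨Function.update c N a, g₁, f₂ + X s ^ N * g₂, ?_⟩
    rw [Finset.sum_range_succ, Function.update_self, Finset.sum_congr rfl (g := fun r => C (c r) * X s ^ r), h, hg]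
    · ring
    · intro r hr
      rw [Function.update_of_ne (Finset.mem_range.1 hr).ne]

theorem X_dvd_of_dvd_X_pow_mul {s s' : Fin 2} (hs : s ≠ s') (N : ℕ) (f : MvPowerSeries (Fin 2) 𝕜)
    (h : X s ∣ X s' ^ N * f) : X s ∣ f := by
  rw [X_dvd_iff] at h ⊢
  intro m hm
  have := h (Finsupp.single s' N + m) (by simp [hm, hs.symm])
  rwa [X_pow_eq, coeff_add_monomial_mul, one_mul] at this

theorem X_ne_zero (s : Fin 2) : (X s : MvPowerSeries (Fin 2) 𝕜) ≠ 0 := by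
  intro h
  have := congrArg (coeff (Finsupp.single s 1)) h
  simp [coeff_X] at this

/-- If `x y f = (x ^ k - y ^ (n - k)) g`, then `x` divides `y ^ (n - k) g` and hence `g`; similarly
for `y`. So `t` is not a zero divisor on `R`. -/
theorem mem_curveIdeal_of_XX_mul_mem {n k : ℕ} {f : MvPowerSeries (Fin 2) 𝕜}
    (h : X 0 * X 1 * f ∈ curveIdeal 𝕜 n k) (hk : 1 ≤ k) (hkn : k < n) : f ∈ curveIdeal 𝕜 n k := by
  rw [curveIdeal, Ideal.mem_span_singleton] at h ⊢
  obtain ⟨g, hg⟩ := h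
  obtain ⟨k', rfl⟩ : ∃ k', k = k' + 1 := ⟨k - 1, by omega⟩
  obtain ⟨l, hl⟩ : ∃ l, n - (k' + 1) = l + 1 := ⟨n - (k' + 1) - 1, by omega⟩
  rw [hl] at hg ⊢
  obtain ⟨g₁, rfl⟩ : X 0 ∣ g := by
    apply X_dvd_of_dvd_X_pow_mul (by decide : (0 : Fin 2) ≠ 1) (l + 1)
    refine ⟨X 0 ^ k' * g - X 1 * f, ?_⟩
    linear_combination hg
  have hg' : X 1 * f = (X 0 ^ (k' + 1) - X 1 ^ (l + 1)) * g₁ := by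
    apply mul_left_cancel₀ (X_ne_zero (𝕜 := 𝕜) 0)
    linear_combination hg
  obtain ⟨g₂, rfl⟩ : X 1 ∣ g₁ := by
    apply X_dvd_of_dvd_X_pow_mul (by decide : (1 : Fin 2) ≠ 0) (k' + 1)
    refine ⟨X 1 ^ l * g₁ + f, ?_⟩
    linear_combination -hg'
  refine ⟨g₂, mul_left_cancel₀ (X_ne_zero (𝕜 := 𝕜) 1) ?_⟩
  linear_combination hg'

theorem eq_zero_of_forall_XX_pow_dvd (f : MvPowerSeries (Fin 2) 𝕜)
    (h : ∀ N : ℕ, (X 0 * X 1) ^ N ∣ f) : f = 0 := by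
  ext m
  have : X 0 ^ (m 0 + 1) ∣ f := (Dvd.intro _ (mul_pow _ _ _).symm).trans (h (m 0 + 1))
  rw [X_pow_dvd_iff] at this
  rw [this m (Nat.lt_succ_self _), map_zero]

/-- The solution is `G i = ∑ (x y) ^ d g (i + d)`. Only the terms with `d ≤ m 0` contribute to the
coefficient at `m`, so finite sums suffice and no topology enters. -/
theorem exists_XX_series (g : ℕ → MvPowerSeries (Fin 2) 𝕜) :
    ∃ G : ℕ → MvPowerSeries (Fin 2) 𝕜, ∀ i, G i = g i + X 0 * X 1 * G (i + 1) := by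
  classical
  have h0 : ∀ (m : Fin 2 →₀ ℕ) (d : ℕ) (f : MvPowerSeries (Fin 2) 𝕜), m 0 < d →
      coeff m ((X 0 * X 1) ^ d * f) = 0 := by
    intro m d f hd
    have : X 0 ^ d ∣ (X 0 * X 1) ^ d * f := by
      rw [mul_pow, mul_assoc]
      exact Dvd.intro _ rfl
    exact X_pow_dvd_iff.1 this m hd
  let G : ℕ → MvPowerSeries (Fin 2) 𝕜 := fun i m =>
    ∑ d ∈ Finset.range (m 0 + 1), coeff m ((X 0 * X 1) ^ d * g (i + d))
  have hG : ∀ i m N, m 0 < N →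
      coeff m (G i) = ∑ d ∈ Finset.range N, coeff m ((X 0 * X 1) ^ d * g (i + d)) := by
    intro i m N hN
    change ∑ d ∈ Finset.range (m 0 + 1), _ = _
    refine Finset.sum_subset (Finset.range_mono hN) fun d _ hd => h0 _ _ _ ?_
    rw [Finset.mem_range] at hd
    omega
  refine ⟨G, fun i => ?_⟩
  have hX : (X 0 * X 1 : MvPowerSeries (Fin 2) 𝕜) =
      monomial (Finsupp.single 0 1 + Finsupp.single 1 1) 1 := by
    rw [X, X, monomial_mul_monomial, one_mul]
  have hs : ∀ (m : Fin 2 →₀ ℕ) (f : MvPowerSeries (Fin 2) 𝕜), coeff m (X 0 * X 1 * f) = if Finsupp.single 0 1 + Finsupp.single 1 1 ≤ m then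
      coeff (m - (Finsupp.single 0 1 + Finsupp.single 1 1)) f else (0 : 𝕜) := by
    intro m f
    rw [hX, coeff_monomial_mul, one_mul]
  ext m
  rw [hG i m (m 0 + 2) (by omega), Finset.sum_range_succ', map_add, add_comm]
  congr 1
  · simp
  · rw [hs m]
    have : ∀ d, coeff m ((X 0 * X 1) ^ (d + 1) * g (i + (d + 1))) =
        if Finsupp.single 0 1 + Finsupp.single 1 1 ≤ m then
          coeff (m - (Finsupp.single 0 1 + Finsupp.single 1 1)) ((X 0 * X 1) ^ d * g (i + 1 + d))
        else (0 : 𝕜) := by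
      intro d
      rw [← hs m, pow_succ', mul_assoc, show i + (d + 1) = i + 1 + d by ring]
    rw [Finset.sum_congr rfl fun d _ => this d]
    split_ifs with hm
    · rw [hG (i + 1) _ (m 0 + 1)]
      simp
    · simp

variable (𝕜) in
/-- The homomorphism `𝕜[[t]] → 𝕜[[x, y]]` with `t ↦ x y`. -/
noncomputable def substXY : PowerSeries 𝕜 →ₐ[𝕜] MvPowerSeries (Fin 2) 𝕜 :=
  PowerSeries.substAlgHom (R := 𝕜) (S := 𝕜) (a := (X 0 * X 1 : MvPowerSeries (Fin 2) 𝕜))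
    (PowerSeries.HasSubst.of_constantCoeff_zero (by simp))

theorem substXY_X : substXY 𝕜 PowerSeries.X = X 0 * X 1 :=
  PowerSeries.substAlgHom_X _

theorem substXY_C (c : 𝕜) : substXY 𝕜 (PowerSeries.C c) = C c :=
  (substXY 𝕜).commutes c

theorem substXY_mk (c : ℕ → 𝕜) : substXY 𝕜 (PowerSeries.mk c) =
    C (c 0) + X 0 * X 1 * substXY 𝕜 (PowerSeries.mk fun i => c (i + 1)) := by
  conv_lhs => rw [PowerSeries.eq_X_mul_shift_add_const (PowerSeries.mk c)]
  rw [map_add, map_mul, substXY_X, substXY_C, add_comm]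
  simp [← PowerSeries.coeff_zero_eq_constantCoeff_apply]

theorem coeff_substXY_eq_zero (c : PowerSeries 𝕜) {m : Fin 2 →₀ ℕ} (hm : m 0 ≠ m 1) :
    coeff m (substXY 𝕜 c) = 0 := by
  rw [substXY, PowerSeries.coe_substAlgHom, PowerSeries.coeff_subst (PowerSeries.HasSubst.of_constantCoeff_zero (by simp))]
  apply finsum_eq_zero_of_forall_eq_zero
  intro d
  classical
  rw [mul_pow, X_pow_eq, X_pow_eq, monomial_mul_monomial, coeff_monomial, if_neg, smul_zero]
  rintro rfl
  simp at hm

/-- Only monomials with equal exponents of `x` and `y` occur, and on these the factors `u` and `u⁻¹`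
cancel. This is why `Z` is central in `A`. -/
theorem rescaleXY_substXY (u : 𝕜ˣ) (c : PowerSeries 𝕜) :
    rescaleXY 𝕜 u (substXY 𝕜 c) = substXY 𝕜 c := by
  ext m
  rw [rescaleXY, coeff_rescale]
  by_cases hm : m 0 = m 1
  · suffices m.prod (fun s i => (![(u : 𝕜), ((u⁻¹ : 𝕜ˣ) : 𝕜)] s) ^ i) = 1 by rw [this, one_mul]
    rw [Finsupp.prod_fintype _ _ (by simp)]
    simp [Fin.prod_univ_two, hm]
  · rw [coeff_substXY_eq_zero c hm, mul_zero]

/-- Mixed monomials are divisible by `x y`, and high pure powers are reduced by `x ^ n = (x y) ^ (n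
- k) + x ^ (n - k) (x ^ k - y ^ (n - k))` and `y ^ n = (x y) ^ k - y ^ k (x ^ k - y ^ (n - k))`. -/
theorem exists_step {n k : ℕ} (hk : 1 ≤ k) (hkn : k < n) (f : MvPowerSeries (Fin 2) 𝕜) :
    ∃ (c d : ℕ → 𝕜) (f' g : MvPowerSeries (Fin 2) 𝕜),
      f = ∑ r ∈ Finset.range n, C (c r) * X 0 ^ r + ∑ r ∈ Finset.range n, C (d r) * X 1 ^ r +
        X 0 * X 1 * f' + (X 0 ^ k - X 1 ^ (n - k)) * g := by
  obtain ⟨c, f₁, f₂, h⟩ := eq_sum_C_mul_X_pow (0 : Fin 2) 1 (by decide) n f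
  obtain ⟨d, f₃, f₄, h'⟩ := eq_sum_C_mul_X_pow (1 : Fin 2) 0 (by decide) (n - 1) f₂
  obtain ⟨k', rfl⟩ : ∃ k', k = k' + 1 := ⟨k - 1, by omega⟩
  obtain ⟨l, rfl⟩ : ∃ l, n = k' + 1 + (l + 1) := ⟨n - (k' + 1) - 1, by omega⟩
  -- The constant term already belongs to the sum in `x`, so the sum in `y` starts at exponent `1`,
  -- with shifted coefficients.
  refine ⟨c, fun r => if r = 0 then 0 else d (r - 1), f₄ + (X 0 * X 1) ^ l * f₁ + (X 0 * X 1) ^ k' * f₃,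
    X 0 ^ (l + 1) * f₁ - X 1 ^ (k' + 1) * f₃, ?_⟩
  have e : ∑ r ∈ Finset.range (k' + 1 + (l + 1)),
      C (if r = 0 then 0 else d (r - 1)) * (X 1 : MvPowerSeries (Fin 2) 𝕜) ^ r =
      X 1 * ∑ r ∈ Finset.range (k' + 1 + l), C (d r) * X 1 ^ r := by
    rw [show k' + 1 + (l + 1) = k' + 1 + l + 1 by ring, Finset.sum_range_succ', Finset.mul_sum]
    rw [if_pos rfl, map_zero, zero_mul, add_zero]
    refine Finset.sum_congr rfl fun r _ => ?_
    rw [if_neg (Nat.succ_ne_zero r), Nat.add_sub_cancel]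
    ring
  rw [e, h, h']
  simp only [Nat.add_sub_cancel_left, show k' + 1 + (l + 1) - 1 = k' + 1 + l by omega]
  ring

/-- Iterating the division step on the cofactor of `x y` produces the coefficients of power series
in `t`. The error terms satisfy `D i = x y D (i + 1)`, so `D 0` is divisible by every power of `x y`
and vanishes. -/
theorem exists_expansion {n k : ℕ} (hk : 1 ≤ k) (hkn : k < n) (f : MvPowerSeries (Fin 2) 𝕜) :
    ∃ (c d : ℕ → PowerSeries 𝕜) (g : MvPowerSeries (Fin 2) 𝕜),
      f = ∑ r ∈ Finset.range n, substXY 𝕜 (c r) * X 0 ^ r +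
        ∑ r ∈ Finset.range n, substXY 𝕜 (d r) * X 1 ^ r + (X 0 ^ k - X 1 ^ (n - k)) * g := by
  choose c d f' g h using exists_step (𝕜 := 𝕜) hk hkn
  let F : ℕ → MvPowerSeries (Fin 2) 𝕜 := fun i => f'^[i] f
  have hF : ∀ i, F (i + 1) = f' (F i) := fun i => Function.iterate_succ_apply' f' i f
  obtain ⟨G, hG⟩ := exists_XX_series fun i => g (F i)
  let D : ℕ → MvPowerSeries (Fin 2) 𝕜 := fun i => F i -
    (∑ r ∈ Finset.range n, substXY 𝕜 (PowerSeries.mk fun j => c (F (i + j)) r) * X 0 ^ r +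
      ∑ r ∈ Finset.range n, substXY 𝕜 (PowerSeries.mk fun j => d (F (i + j)) r) * X 1 ^ r +
        (X 0 ^ k - X 1 ^ (n - k)) * G i)
  have hsum : ∀ (i : ℕ) (s : Fin 2) (c : MvPowerSeries (Fin 2) 𝕜 → ℕ → 𝕜),
      ∑ r ∈ Finset.range n, substXY 𝕜 (PowerSeries.mk fun j => c (F (i + j)) r) * X s ^ r =
      ∑ r ∈ Finset.range n, C (c (F i) r) * X s ^ r + X 0 * X 1 *
      ∑ r ∈ Finset.range n, substXY 𝕜 (PowerSeries.mk fun j => c (F (i + 1 + j)) r) * X s ^ r := by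
    intro i s c
    rw [Finset.mul_sum, ← Finset.sum_add_distrib]
    refine Finset.sum_congr rfl fun r _ => ?_
    have : ∀ j, i + (j + 1) = i + 1 + j := fun j => by ring
    rw [substXY_mk, funext fun j => congrArg (fun a => c (F a) r) (this j),
      add_mul, mul_assoc (X 0 * X 1), Nat.add_zero]
  have hD : ∀ i, D i = X 0 * X 1 * D (i + 1) := by
    intro i
    simp only [D]
    rw [hsum i 0 c, hsum i 1 d, hG i, hF i]
    conv_lhs => enter [1]; rw [h (F i)]
    ring
  have hD0 : D 0 = 0 := by
    apply eq_zero_of_forall_XX_pow_dvd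
    intro N
    refine ⟨D N, ?_⟩
    induction N with
    | zero => simp
    | succ N ih => rw [ih, hD N]; ring
  exact ⟨_, _, _, sub_eq_zero.1 hD0⟩

end PowerSeriesRing

end GrassmannianCM

namespace GrassmannianCM

/-! ### The twisted group ring as a `Z`-algebra with vertices in `ℤ / n`. -/

section TwistedGroupRing

variable (𝕜 : Type u) [Field 𝕜] (n k : ℕ) [Fact (k < n)]

/-- The central element `t = x y` of `A`. -/
noncomputable def tA : A 𝕜 n k := xA 𝕜 n k * yA 𝕜 n k

/-- The idempotents of `A`, indexed by `ℤ / n`. -/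
noncomputable def E [NeZero n] (i : ZMod n) : A 𝕜 n k := eA 𝕜 n k i.val

variable {𝕜 n k}

theorem ZtoA_apply (c : PowerSeries 𝕜) :
    ZtoA 𝕜 n k c = RtoA 𝕜 n k (Ideal.Quotient.mk (curveIdeal 𝕜 n k) (substXY 𝕜 c)) := rfl

theorem RtoA_apply (r : R 𝕜 n k) : RtoA 𝕜 n k r = sgl 𝕜 n k 1 r := rfl

theorem ZtoA_X : ZtoA 𝕜 n k PowerSeries.X = tA 𝕜 n k := by
  rw [ZtoA_apply, substXY_X, map_mul, map_mul]
  rfl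

theorem sgl_eq (g : G 𝕜 n) (r : R 𝕜 n k) : sgl 𝕜 n k g r = RtoA 𝕜 n k r * sgl 𝕜 n k g 1 := by
  rw [RtoA_apply, sgl_mul, one_mul, one_smul, mul_one]

theorem A_addSubgroup_eq_top {S : AddSubgroup (A 𝕜 n k)}
    (h : ∀ g r, sgl 𝕜 n k g r ∈ S) (a : A 𝕜 n k) : a ∈ S :=
  SkewMonoidAlgebra.induction (p := fun a => a ∈ S) a (zero_mem S)
    (fun g r _ _ _ hf => add_mem (h g r) hf)

theorem ZtoA_mul_comm (c : PowerSeries 𝕜) (a : A 𝕜 n k) : ZtoA 𝕜 n k c * a = a * ZtoA 𝕜 n k c := by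
  let S : AddSubgroup (A 𝕜 n k) :=
    { carrier := {a | ZtoA 𝕜 n k c * a = a * ZtoA 𝕜 n k c}
      zero_mem' := by simp
      add_mem' := fun {a b} (ha : _ = _) (hb : _ = _) => show _ = _ by rw [mul_add, add_mul, ha, hb]
      neg_mem' := fun {a} (ha : _ = _) => show _ = _ by rw [mul_neg, neg_mul, ha] }
  refine A_addSubgroup_eq_top (S := S) (fun g r => ?_) a
  change ZtoA 𝕜 n k c * sgl 𝕜 n k g r = sgl 𝕜 n k g r * ZtoA 𝕜 n k c
  rw [ZtoA_apply, RtoA_apply, sgl_mul, sgl_mul, smul_mk, rescaleXY_substXY, one_mul, mul_one,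
    one_smul, mul_comm]

theorem tA_mul_comm (a : A 𝕜 n k) : tA 𝕜 n k * a = a * tA 𝕜 n k := by
  rw [← ZtoA_X, ZtoA_mul_comm]

theorem smul_eq_ZtoA_mul (c : 𝕜) (a : A 𝕜 n k) : c • a = ZtoA 𝕜 n k (PowerSeries.C c) * a := by
  have h := sgl_smul (k := k) c 1 (1 : G 𝕜 n)
  rw [map_one, sgl_one_one, mul_one] at h
  rw [← one_mul a, ← smul_mul_assoc, h, one_mul, ZtoA_apply, substXY_C]
  rfl

variable [hk : Fact (1 ≤ k)]

theorem tA_mul_eq_zero {a : A 𝕜 n k} (h : tA 𝕜 n k * a = 0) : a = 0 := by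
  have ht : tA 𝕜 n k = sgl 𝕜 n k 1 (Ideal.Quotient.mk _ (MvPowerSeries.X 0 * MvPowerSeries.X 1)) := by
    rw [tA, xA, yA, ← map_mul, ← map_mul]
    rfl
  refine SkewMonoidAlgebra.ext fun g => ?_
  have h1 : SkewMonoidAlgebra.coeff (tA 𝕜 n k * a) g = 0 := by rw [h]; rfl
  rw [ht] at h1
  replace h1 := (SkewMonoidAlgebra.coeff_single_one_mul a _ g).symm.trans h1
  obtain ⟨f, hf⟩ := Ideal.Quotient.mk_surjective (SkewMonoidAlgebra.coeff a g)
  rw [← hf, ← map_mul, Ideal.Quotient.eq_zero_iff_mem] at h1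
  have h2 := mem_curveIdeal_of_XX_mul_mem h1 hk.out Fact.out
  rw [← Ideal.Quotient.eq_zero_iff_mem, hf] at h2
  exact h2

instance : Nontrivial (R 𝕜 n k) := by
  rw [Ideal.Quotient.nontrivial_iff, Ne, Ideal.eq_top_iff_one, curveIdeal,
    Ideal.mem_span_singleton]
  rintro ⟨g, hg⟩
  have hkn : k < n := Fact.out
  have := congrArg MvPowerSeries.constantCoeff hg
  have h1 : k ≠ 0 := by have := hk.out; omega
  have h2 : n - k ≠ 0 := by omega
  simp [h1, h2] at this

instance : Nontrivial (A 𝕜 n k) :=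
  inferInstanceAs (Nontrivial (SkewMonoidAlgebra (R 𝕜 n k) (G 𝕜 n)))

theorem exists_R_expansion (r : R 𝕜 n k) : ∃ c d : ℕ → PowerSeries 𝕜,
    RtoA 𝕜 n k r = ∑ i ∈ Finset.range n, ZtoA 𝕜 n k (c i) * xA 𝕜 n k ^ i +
      ∑ i ∈ Finset.range n, ZtoA 𝕜 n k (d i) * yA 𝕜 n k ^ i := by
  obtain ⟨f, rfl⟩ := Ideal.Quotient.mk_surjective r
  obtain ⟨c, d, g, h⟩ := exists_expansion hk.out (Fact.out : k < n) f
  refine ⟨c, d, ?_⟩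
  have hg : (Ideal.Quotient.mk (curveIdeal 𝕜 n k))
      ((MvPowerSeries.X 0 ^ k - MvPowerSeries.X 1 ^ (n - k)) * g) = 0 :=
    Ideal.Quotient.eq_zero_iff_mem.2 (Ideal.mul_mem_right _ _ (Ideal.subset_span rfl))
  rw [h, map_add, hg, add_zero]
  simp only [map_add, map_sum, map_mul, map_pow]
  rfl

variable [NeZero n]

theorem eA_add_n (j : ℕ) : eA 𝕜 n k (j + n) = eA 𝕜 n k j := by
  rw [eA, eA]
  refine Finset.sum_congr rfl fun g _ => ?_
  rw [pow_add, ← map_inv, G.toUnits_pow, mul_one]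

theorem eA_eq_E (j : ℕ) : eA 𝕜 n k j = E 𝕜 n k j := by
  rw [E, ZMod.val_natCast]
  conv_lhs => rw [← Nat.mod_add_div j n]
  generalize j / n = q
  induction q with
  | zero => simp
  | succ q ih => rw [mul_add, mul_one, ← add_assoc, eA_add_n, ih]

theorem xA_mul_E (i : ZMod n) : xA 𝕜 n k * E 𝕜 n k i = E 𝕜 n k (i + 1) * xA 𝕜 n k := by
  rw [E, xA_mul_eA, eA_eq_E]
  simp

theorem yA_mul_E (i : ZMod n) : yA 𝕜 n k * E 𝕜 n k i = E 𝕜 n k (i - 1) * yA 𝕜 n k := by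
  have := eA_mul_yA (𝕜 := 𝕜) (n := n) (k := k) (i - 1).val
  rw [eA_eq_E, eA_eq_E] at this
  simpa using this.symm

theorem xA_pow_mul_E (r : ℕ) (i : ZMod n) :
    xA 𝕜 n k ^ r * E 𝕜 n k i = E 𝕜 n k (i + r) * xA 𝕜 n k ^ r := by
  induction r generalizing i with
  | zero => simp
  | succ r ih =>
    rw [pow_succ, mul_assoc, xA_mul_E, ← mul_assoc, ih, mul_assoc]
    congr 2
    push_cast
    ring

theorem yA_pow_mul_E (r : ℕ) (i : ZMod n) :
    yA 𝕜 n k ^ r * E 𝕜 n k i = E 𝕜 n k (i - r) * yA 𝕜 n k ^ r := by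
  induction r generalizing i with
  | zero => simp
  | succ r ih =>
    rw [pow_succ, mul_assoc, yA_mul_E, ← mul_assoc, ih, mul_assoc]
    congr 2
    push_cast
    ring

variable [HasEnoughRootsOfUnity 𝕜 n]

theorem E_mul_self (i : ZMod n) : E 𝕜 n k i * E 𝕜 n k i = E 𝕜 n k i := eA_mul_self _

theorem E_sum : ∑ i : ZMod n, E 𝕜 n k i = 1 := by
  rw [← eA_sum]
  -- The sum in `eA_sum` runs over `1, …, n`, whereas `ZMod.val` takes the values `0, …, n - 1`; the
  -- vertex `n` stands for the residue `0`.
  refine Finset.sum_bij' (fun i _ => if i.val = 0 then n else i.val) (fun j _ => (j : ZMod n))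
    ?_ ?_ ?_ ?_ ?_
  · intro i _
    have := ZMod.val_lt i
    rw [Finset.mem_Icc]
    split_ifs <;> omega
  · simp
  · intro i _
    split_ifs with h
    · rw [ZMod.val_eq_zero] at h
      simp [h]
    · simp
  · intro j hj
    rw [Finset.mem_Icc] at hj
    rw [ZMod.val_natCast]
    rcases hj.2.lt_or_eq with h | rfl
    · rw [Nat.mod_eq_of_lt h, if_neg (by omega)]
    · simp
  · intro i _
    split_ifs with h
    · rw [E, h, eA_zero]
    · rfl

theorem E_mul_of_ne {i j : ZMod n} (hij : i ≠ j) : E 𝕜 n k i * E 𝕜 n k j = 0 := by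
  -- The known orthogonality leaves out the vertex `0`. Orthogonality with `e_0` follows by
  -- multiplying `∑ e_i = 1` by the other idempotent.
  have key : ∀ i j : ZMod n, i ≠ 0 → j ≠ 0 → i ≠ j → E 𝕜 n k i * E 𝕜 n k j = 0 := by
    intro i j hi hj hij
    have h1 := ZMod.val_lt i
    have h2 := ZMod.val_lt j
    rw [Ne, ← ZMod.val_eq_zero] at hi hj
    exact eA_mul_of_ne (Finset.mem_Icc.2 ⟨by omega, by omega⟩)
      (Finset.mem_Icc.2 ⟨by omega, by omega⟩) (fun h => hij (ZMod.val_injective n h))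
  by_cases hi : i = 0
  · subst hi
    have h := congrArg (· * E 𝕜 n k j) (E_sum (𝕜 := 𝕜) (n := n) (k := k))
    simp only [Finset.sum_mul, one_mul] at h
    rw [← Finset.add_sum_erase _ _ (Finset.mem_univ (0 : ZMod n)),
      Finset.sum_eq_single_of_mem j (by simp [hij.symm]), E_mul_self] at h
    · simpa using h
    · intro b hb hbj
      exact key b j (Finset.ne_of_mem_erase hb) hij.symm hbj
  · by_cases hj : j = 0
    · subst hj
      have h := congrArg (E 𝕜 n k i * ·) (E_sum (𝕜 := 𝕜) (n := n) (k := k))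
      simp only [Finset.mul_sum, mul_one] at h
      rw [← Finset.add_sum_erase _ _ (Finset.mem_univ (0 : ZMod n)),
        Finset.sum_eq_single_of_mem i (by simp [hij]), E_mul_self] at h
      · simpa using h
      · intro b hb hbi
        exact key i b hij (Finset.ne_of_mem_erase hb) hbi.symm
    · exact key i j hi hj hij

theorem sgl_one_eq_sum (g : G 𝕜 n) : sgl 𝕜 n k g 1 =
    ∑ i : ZMod n, ZtoA 𝕜 n k (PowerSeries.C ((G.toUnits 𝕜 n g : 𝕜) ^ i.val)) * E 𝕜 n k i := by
  conv_lhs => rw [← mul_one (sgl 𝕜 n k g 1), ← E_sum, Finset.mul_sum]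
  refine Finset.sum_congr rfl fun i _ => ?_
  have := sgl_mul_eA (k := k) g 1 i.val
  rw [map_one, one_mul, smul_eq_ZtoA_mul] at this
  exact this

/-- `A` is spanned over `Z` by the elements `x ^ r e_i` and `y ^ r e_i`. -/
theorem A_induction {p : A 𝕜 n k → Prop} (add : ∀ a b, p a → p b → p (a + b))
    (x : ∀ c, ∀ r < n, ∀ i, p (ZtoA 𝕜 n k c * (xA 𝕜 n k ^ r * E 𝕜 n k i)))
    (y : ∀ c, ∀ r < n, ∀ i, p (ZtoA 𝕜 n k c * (yA 𝕜 n k ^ r * E 𝕜 n k i))) (a : A 𝕜 n k) : p a := by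
  have zero : p 0 := by simpa using x 0 0 (NeZero.pos n) 0
  have sum : ∀ {ι : Type} (s : Finset ι) (f : ι → A 𝕜 n k), (∀ i ∈ s, p (f i)) → p (∑ i ∈ s, f i) :=
    fun s f h => Finset.sum_induction f p add zero h
  have hs : ∀ g r, p (sgl 𝕜 n k g r) := by
    intro g r
    obtain ⟨c, d, h⟩ := exists_R_expansion r
    rw [sgl_eq, sgl_one_eq_sum, h, Finset.mul_sum]
    refine sum _ _ fun i _ => ?_
    rw [← mul_assoc, ← ZtoA_mul_comm, mul_assoc, add_mul, mul_add, Finset.sum_mul, Finset.sum_mul,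
      Finset.mul_sum, Finset.mul_sum]
    refine add _ _ (sum _ _ fun j hj => ?_) (sum _ _ fun j hj => ?_)
    · rw [mul_assoc, ← mul_assoc, ← map_mul]
      exact x _ _ (Finset.mem_range.1 hj) _
    · rw [mul_assoc, ← mul_assoc, ← map_mul]
      exact y _ _ (Finset.mem_range.1 hj) _
  exact SkewMonoidAlgebra.induction a zero fun g r f _ _ hf => add _ _ (hs g r) hf

end TwistedGroupRing

end GrassmannianCM

namespace GrassmannianCM

/-! ### Cohen–Macaulay modules as finitely generated `t`-torsion-free modules. -/

section Modules

variable {𝕜 : Type u} [Field 𝕜] {n k : ℕ} [Fact (k < n)]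

local notation "𝐱" => xA 𝕜 n k
local notation "𝐲" => yA 𝕜 n k
local notation "𝐭" => tA 𝕜 n k
local notation "𝐞" => E 𝕜 n k
local notation "𝐳" => ZtoA 𝕜 n k

noncomputable instance : Algebra (PowerSeries 𝕜) (A 𝕜 n k) :=
  (ZtoA 𝕜 n k).toAlgebra' ZtoA_mul_comm

theorem algebraMap_A (c : PowerSeries 𝕜) : algebraMap (PowerSeries 𝕜) (A 𝕜 n k) c = 𝐳 c := rfl

section Algebra

variable [hk : Fact (1 ≤ k)] [NeZero n] [HasEnoughRootsOfUnity 𝕜 n]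

instance : Module.Finite (PowerSeries 𝕜) (A 𝕜 n k) := by
  refine ⟨Submodule.fg_def.2 ⟨Set.range (fun p : Fin n × ZMod n => 𝐱 ^ (p.1 : ℕ) * 𝐞 p.2) ∪
    Set.range (fun p : Fin n × ZMod n => 𝐲 ^ (p.1 : ℕ) * 𝐞 p.2),
    (Set.finite_range _).union (Set.finite_range _), ?_⟩⟩
  rw [eq_top_iff]
  intro a _
  induction a using A_induction with
  | add a b ha hb => exact add_mem (ha trivial) (hb trivial)
  | x c r hr i =>
    rw [← algebraMap_A, ← Algebra.smul_def]
    exact Submodule.smul_mem _ _ (Submodule.subset_span (Or.inl ⟨⟨⟨r, hr⟩, i⟩, rfl⟩))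
  | y c r hr i =>
    rw [← algebraMap_A, ← Algebra.smul_def]
    exact Submodule.smul_mem _ _ (Submodule.subset_span (Or.inr ⟨⟨⟨r, hr⟩, i⟩, rfl⟩))

instance : IsNoetherianRing (A 𝕜 n k) := isNoetherian_of_tower (PowerSeries 𝕜) inferInstance

end Algebra

variable (𝕜 n k) in
/-- Cohen–Macaulay `A`-modules, described by the action of `t` only. -/
structure IsCM (M : Type u) [AddCommGroup M] [Module (A 𝕜 n k) M] : Prop where
  finite : Module.Finite (A 𝕜 n k) M
  eq_zero : ∀ m : M, 𝐭 • m = 0 → m = 0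

section Structure

variable {M : Type u} [AddCommGroup M] [Module (A 𝕜 n k) M]
variable {N : Type u} [AddCommGroup N] [Module (A 𝕜 n k) N]

theorem IsCM.cancel (hM : IsCM 𝕜 n k M) {m m' : M} (h : 𝐭 • m = 𝐭 • m') : m = m' := by
  rw [← sub_eq_zero]
  exact hM.eq_zero _ (by rw [smul_sub, h, sub_self])

theorem smul_tA (a : A 𝕜 n k) (m : M) : 𝐭 • a • m = a • 𝐭 • m := by
  rw [smul_smul, tA_mul_comm, mul_smul]

theorem smul_ZtoA (c : PowerSeries 𝕜) (a : A 𝕜 n k) (m : M) : 𝐳 c • a • m = a • 𝐳 c • m := by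
  rw [smul_smul, ZtoA_mul_comm, mul_smul]

theorem IsCM.pow_smul_eq_zero (hM : IsCM 𝕜 n k M) (r : ℕ) {m : M} (h : 𝐭 ^ r • m = 0) :
    m = 0 := by
  induction r with
  | zero => simpa using h
  | succ r ih => exact ih (hM.eq_zero _ (by rwa [smul_smul, ← pow_succ']))

/-- Since `t ^ r = y ^ r x ^ r`, powers of `x` act injectively wherever those of `t` do; the same
holds for `y`. -/
theorem IsCM.x_smul_eq_zero (hM : IsCM 𝕜 n k M) (r : ℕ) {m : M} (h : 𝐱 ^ r • m = 0) : m = 0 := by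
  refine hM.pow_smul_eq_zero r ?_
  rw [tA, xA_comm_yA, (show Commute 𝐲 𝐱 from xA_comm_yA.symm).mul_pow, mul_smul, h, smul_zero]

theorem IsCM.y_smul_eq_zero (hM : IsCM 𝕜 n k M) (r : ℕ) {m : M} (h : 𝐲 ^ r • m = 0) : m = 0 := by
  refine hM.pow_smul_eq_zero r ?_
  rw [tA, (show Commute 𝐱 𝐲 from xA_comm_yA).mul_pow, mul_smul, h, smul_zero]

theorem IsCM.smul_eq_zero (hM : IsCM 𝕜 n k M) {c : PowerSeries 𝕜} (hc : c ≠ 0) {m : M}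
    (h : 𝐳 c • m = 0) : m = 0 := by
  obtain ⟨r, u, rfl⟩ := IsDiscreteValuationRing.eq_unit_mul_pow_irreducible hc
    (PowerSeries.X_irreducible (R := 𝕜))
  have h1 : 𝐳 ((u⁻¹ : (PowerSeries 𝕜)ˣ) : PowerSeries 𝕜) • 𝐳 (u * (PowerSeries.X : PowerSeries 𝕜) ^ r) • m = 0 := by
    rw [h, smul_zero]
  rw [smul_smul, ← map_mul, ← mul_assoc, Units.inv_mul, one_mul, map_pow, ZtoA_X] at h1
  exact hM.pow_smul_eq_zero r h1

theorem IsCM.of_injective (hN : IsCM 𝕜 n k N) [Module.Finite (A 𝕜 n k) M]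
    (f : M →ₗ[A 𝕜 n k] N) (hf : Function.Injective f) : IsCM 𝕜 n k M :=
  ⟨inferInstance, fun m hm => hf (by
    rw [map_zero]
    exact hN.eq_zero _ (by rw [← map_smul, hm, map_zero]))⟩

theorem IsCM.prod (hM : IsCM 𝕜 n k M) (hN : IsCM 𝕜 n k N) : IsCM 𝕜 n k (M × N) := by
  have := hM.finite
  have := hN.finite
  exact ⟨inferInstance, fun m hm => Prod.ext (hM.eq_zero _ (congrArg Prod.fst hm))
    (hN.eq_zero _ (congrArg Prod.snd hm))⟩

theorem IsCM.pi {ι : Type} [Finite ι] (hM : IsCM 𝕜 n k M) : IsCM 𝕜 n k (ι → M) := by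
  have := hM.finite
  exact ⟨inferInstance, fun m hm => funext fun i => hM.eq_zero _ (congrFun hm i)⟩

theorem IsCM.of_exact {L : Type u} [AddCommGroup L] [Module (A 𝕜 n k) L]
    (hM : IsCM 𝕜 n k M) (hN : IsCM 𝕜 n k N) (f : M →ₗ[A 𝕜 n k] L) (g : L →ₗ[A 𝕜 n k] N)
    (hf : Function.Injective f) (hfg : Function.Exact f g) (hg : Function.Surjective g) :
    IsCM 𝕜 n k L := by
  have := hM.finite
  have := hN.finite
  refine ⟨Module.Finite.of_exact hfg hg, fun m hm => ?_⟩
  obtain ⟨x, rfl⟩ := (hfg m).1 (hN.eq_zero _ (by rw [← map_smul, hm, map_zero]))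
  rw [hM.eq_zero x (hf (by rw [map_smul, hm, map_zero])), map_zero]

theorem isCM_A [Fact (1 ≤ k)] : IsCM 𝕜 n k (A 𝕜 n k) :=
  ⟨inferInstance, fun _ h => tA_mul_eq_zero h⟩

variable [hk : Fact (1 ≤ k)] [NeZero n] [HasEnoughRootsOfUnity 𝕜 n]

theorem IsCM.submodule (hM : IsCM 𝕜 n k M) (S : Submodule (A 𝕜 n k) M) : IsCM 𝕜 n k S := by
  have := hM.finite
  exact hM.of_injective S.subtype S.injective_subtype

/-- `A` is finite over `Z`, so `M` is too, and finite torsion-free modules over the principal ideal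
domain `Z` are free. Torsion-freeness need only be tested on the uniformizer `t`. -/
theorem isCM_iff [Module (PowerSeries 𝕜) M] [IsScalarTower (PowerSeries 𝕜) (A 𝕜 n k) M] :
    IsCM 𝕜 n k M ↔ Module.Finite (A 𝕜 n k) M ∧ Module.Free (PowerSeries 𝕜) M := by
  have hz : ∀ (c : PowerSeries 𝕜) (m : M), c • m = 𝐳 c • m := fun c m => by
    rw [← algebraMap_A, algebraMap_smul]
  constructor
  · intro h
    have := h.finite
    have : Module.Finite (PowerSeries 𝕜) M := Module.Finite.trans (A 𝕜 n k) M
    have : Module.IsTorsionFree (PowerSeries 𝕜) M := .of_smul_eq_zero fun c m hm => by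
      by_cases hc : c = 0
      · exact Or.inl hc
      · exact Or.inr (h.smul_eq_zero hc (by rwa [← hz]))
    exact ⟨inferInstance, Module.free_of_finite_type_torsion_free'⟩
  · rintro ⟨h1, h2⟩
    refine ⟨h1, fun m hm => ?_⟩
    rw [← ZtoA_X, ← hz] at hm
    exact (smul_eq_zero.1 hm).resolve_left PowerSeries.X_ne_zero

theorem isScalarTower_compHom :
    letI := Module.compHom M (ZtoA 𝕜 n k)
    IsScalarTower (PowerSeries 𝕜) (A 𝕜 n k) M :=
  letI := Module.compHom M (ZtoA 𝕜 n k)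
  ⟨fun c a m => by
    rw [Algebra.smul_def, mul_smul]
    rfl⟩

theorem CM_iff (X : ModuleCat.{u} (A 𝕜 n k)) : CM 𝕜 n k X ↔ IsCM 𝕜 n k X :=
  (@isCM_iff 𝕜 _ n k _ X _ _ _ _ _ (Module.compHom X (ZtoA 𝕜 n k)) isScalarTower_compHom).symm

/-- Coordinates of a Cohen–Macaulay module over `Z`. -/
theorem IsCM.exists_coordinates (hM : IsCM 𝕜 n k M) : ∃ (r : ℕ) (φ : Fin r → M →+ PowerSeries 𝕜),
    (∀ s c m, φ s (𝐳 c • m) = c * φ s m) ∧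
    (∀ m, (∀ s, PowerSeries.X ∣ φ s m) → ∃ m', m = 𝐭 • m') ∧
    ∀ m, (∀ s, φ s m = 0) → m = 0 := by
  let _ := Module.compHom M (ZtoA 𝕜 n k)
  have : IsScalarTower (PowerSeries 𝕜) (A 𝕜 n k) M := isScalarTower_compHom
  have h := isCM_iff.1 hM
  have := h.1
  have := h.2
  have : Module.Finite (PowerSeries 𝕜) M := Module.Finite.trans (A 𝕜 n k) M
  let b := Module.finBasis (PowerSeries 𝕜) M
  refine ⟨_, fun s => (b.coord s).toAddMonoidHom, fun s c m => (b.coord s).map_smul c m,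
    fun m hm => ?_, fun m hm => ?_⟩
  · choose q hq using hm
    refine ⟨∑ s, q s • b s, ?_⟩
    rw [← ZtoA_X]
    change m = (PowerSeries.X : PowerSeries 𝕜) • ∑ s, q s • b s
    rw [← b.sum_repr m, Finset.smul_sum]
    refine Finset.sum_congr rfl fun s _ => ?_
    rw [smul_smul, ← hq s]
    rfl
  · exact b.ext_elem fun s => by
      rw [map_zero]
      exact hm s

/-- Short exact sequences of Cohen–Macaulay modules split over `Z`. -/
theorem IsCM.exists_retraction {W : Type u} [AddCommGroup W] [Module (A 𝕜 n k) W]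
    (hW : IsCM 𝕜 n k W) (f : M →ₗ[A 𝕜 n k] N) (g : N →ₗ[A 𝕜 n k] W)
    (hf : Function.Injective f) (hfg : Function.Exact f g) (hg : Function.Surjective g) :
    ∃ ρ : N →+ M, (∀ c y, ρ (𝐳 c • y) = 𝐳 c • ρ y) ∧ ∀ x, ρ (f x) = x := by
  let _ := Module.compHom M (ZtoA 𝕜 n k)
  let _ := Module.compHom N (ZtoA 𝕜 n k)
  let _ := Module.compHom W (ZtoA 𝕜 n k)
  have : IsScalarTower (PowerSeries 𝕜) (A 𝕜 n k) M := isScalarTower_compHom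
  have : IsScalarTower (PowerSeries 𝕜) (A 𝕜 n k) N := isScalarTower_compHom
  have : IsScalarTower (PowerSeries 𝕜) (A 𝕜 n k) W := isScalarTower_compHom
  have := (isCM_iff.1 hW).2
  obtain ⟨s, hs⟩ := Module.projective_lifting_property (g.restrictScalars (PowerSeries 𝕜))
    LinearMap.id hg
  have hs' : ∀ w, g (s w) = w := fun w => LinearMap.congr_fun hs w
  -- As the cokernel is free over `Z`, `g` has a `Z`-linear section `s`, and the retraction reads
  -- off the preimage of `y - s (g y)`.
  have hex : ∀ y, ∃ x, f x = y - s (g y) := fun y =>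
    (hfg _).1 (by rw [map_sub, hs', sub_self])
  choose ρ hρ using hex
  refine ⟨AddMonoidHom.mk' ρ fun a b => hf ?_, fun c y => hf ?_, fun x => hf ?_⟩
  · simp only [map_add, hρ]
    abel
  · change f (ρ _) = f (_ • ρ _)
    rw [map_smul, hρ, hρ, map_smul, smul_sub]
    exact congrArg _ (s.map_smul c (g y))
  · change f (ρ _) = _
    rw [hρ, hfg.apply_apply_eq_zero, map_zero, sub_zero]

end Structure

end Modules

end GrassmannianCM

namespace GrassmannianCM

/-! ### From `Z`-linear maps to `A`-linear maps. -/

section Linear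

variable {𝕜 : Type u} [Field 𝕜] {n k : ℕ} [Fact (k < n)] [hk : Fact (1 ≤ k)] [NeZero n]
  [HasEnoughRootsOfUnity 𝕜 n]

local notation "𝐱" => xA 𝕜 n k
local notation "𝐲" => yA 𝕜 n k
local notation "𝐭" => tA 𝕜 n k
local notation "𝐞" => E 𝕜 n k
local notation "𝐳" => ZtoA 𝕜 n k

variable {M : Type u} [AddCommGroup M] [Module (A 𝕜 n k) M]
variable {N : Type u} [AddCommGroup N] [Module (A 𝕜 n k) N]

theorem sum_E_smul (m : M) : ∑ i : ZMod n, 𝐞 i • m = m := by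
  rw [← Finset.sum_smul, E_sum, one_smul]

theorem E_smul_E_smul (i : ZMod n) (m : M) : 𝐞 i • 𝐞 i • m = 𝐞 i • m := by
  rw [smul_smul, E_mul_self]

theorem E_smul_of_ne {i j : ZMod n} (h : i ≠ j) {m : M} (hm : 𝐞 j • m = m) : 𝐞 i • m = 0 := by
  rw [← hm, smul_smul, E_mul_of_ne h, zero_smul]

theorem x_smul_E_smul (i : ZMod n) (m : M) : 𝐱 • 𝐞 i • m = 𝐞 (i + 1) • 𝐱 • m := by
  rw [smul_smul, xA_mul_E, mul_smul]

theorem y_smul_E_smul (i : ZMod n) (m : M) : 𝐲 • 𝐞 i • m = 𝐞 (i - 1) • 𝐲 • m := by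
  rw [smul_smul, yA_mul_E, mul_smul]

theorem x_pow_smul_E_smul (r : ℕ) (i : ZMod n) (m : M) :
    𝐱 ^ r • 𝐞 i • m = 𝐞 (i + r) • 𝐱 ^ r • m := by
  rw [smul_smul, xA_pow_mul_E, mul_smul]

theorem y_pow_smul_E_smul (r : ℕ) (i : ZMod n) (m : M) :
    𝐲 ^ r • 𝐞 i • m = 𝐞 (i - r) • 𝐲 ^ r • m := by
  rw [smul_smul, yA_pow_mul_E, mul_smul]

theorem x_smul_y_smul (m : M) : 𝐱 • 𝐲 • m = 𝐭 • m := by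
  rw [smul_smul, tA]

theorem y_smul_x_smul (m : M) : 𝐲 • 𝐱 • m = 𝐭 • m := by
  rw [smul_smul, tA, xA_comm_yA]

theorem ext_E {m m' : M} (h : ∀ i, 𝐞 i • m = 𝐞 i • m') : m = m' := by
  rw [← sum_E_smul (𝕜 := 𝕜) (n := n) (k := k) m, ← sum_E_smul (𝕜 := 𝕜) (n := n) (k := k) m']
  exact Finset.sum_congr rfl fun i _ => h i

/-- An additive map that commutes with the action of the generators of `A` is linear. -/
theorem exists_linearMap (f : M →+ N) (hz : ∀ c m, f (𝐳 c • m) = 𝐳 c • f m)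
    (hx : ∀ m, f (𝐱 • m) = 𝐱 • f m) (hy : ∀ m, f (𝐲 • m) = 𝐲 • f m)
    (he : ∀ i m, f (𝐞 i • m) = 𝐞 i • f m) : ∃ g : M →ₗ[A 𝕜 n k] N, ∀ m, g m = f m := by
  have hxr : ∀ (r : ℕ) m, f (𝐱 ^ r • m) = 𝐱 ^ r • f m := by
    intro r
    induction r with
    | zero => simp
    | succ r ih => intro m; rw [pow_succ, mul_smul, ih, hx, mul_smul]
  have hyr : ∀ (r : ℕ) m, f (𝐲 ^ r • m) = 𝐲 ^ r • f m := by
    intro r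
    induction r with
    | zero => simp
    | succ r ih => intro m; rw [pow_succ, mul_smul, ih, hy, mul_smul]
  refine ⟨{ toFun := f, map_add' := map_add f, map_smul' := fun a m => ?_ }, fun _ => rfl⟩
  change f (a • m) = a • f m
  induction a using A_induction with
  | add a b ha hb => rw [add_smul, map_add, ha, hb, add_smul]
  | x c r hr i => rw [mul_smul, mul_smul, hz, hxr, he, mul_smul, mul_smul]
  | y c r hr i => rw [mul_smul, mul_smul, hz, hyr, he, mul_smul, mul_smul]

theorem natCast_eq_zero_of_lt {r : ℕ} (hr : r < n) (h : (r : ZMod n) = 0) : r = 0 := by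
  rw [ZMod.natCast_eq_zero_iff] at h
  exact Nat.eq_zero_of_dvd_of_lt h hr

theorem natCast_inj_of_lt {r s : ℕ} (hr : r < n) (hs : s < n) (h : (r : ZMod n) = s) : r = s := by
  have := congrArg ZMod.val h
  rwa [ZMod.val_natCast_of_lt hr, ZMod.val_natCast_of_lt hs] at this

theorem natCast_sub_eq : ((n - k : ℕ) : ZMod n) = -k := by
  rw [Nat.cast_sub (Fact.out : k < n).le, ZMod.natCast_self, zero_sub]

/-- Every `Z`-linear map `M → e_j N` yields an `A`-linear map `M → N`. -/
theorem exists_induced (j : ZMod n) (φ : M →+ N) (hz : ∀ c m, φ (𝐳 c • m) = 𝐳 c • φ m)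
    (he : ∀ m, 𝐞 j • φ m = φ m) :
    ∃ Ψ : M →ₗ[A 𝕜 n k] N,
      (∀ m, ∃ (s : Finset ℕ) (a b : ℕ → A 𝕜 n k), Ψ m = ∑ i ∈ s, a i • φ (b i • m)) ∧
      ∀ m, 𝐞 (j + k) • m = m → Ψ m = 𝐱 ^ k • φ m := by
  have hkn : k < n := Fact.out
  -- `u i` takes the component at `j + i` by powers of `x` to the vertex `j + k`, applies `φ`, and
  -- goes from `j` back to `j + i`; `v i` treats the vertex `j - i` in the same way with `y`. Each
  -- vertex occurs exactly once among `j + 1, …, j + k` and `j, j - 1, …, j - (n - k - 1)`.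
  let u : ℕ → M →+ N := fun i => (DistribSMul.toAddMonoidHom N (𝐱 ^ i)).comp
    (φ.comp (DistribSMul.toAddMonoidHom M (𝐱 ^ (k - i) * 𝐞 (j + i))))
  let v : ℕ → M →+ N := fun i => (DistribSMul.toAddMonoidHom N (𝐲 ^ i)).comp
    (φ.comp (DistribSMul.toAddMonoidHom M (𝐲 ^ (n - k - i) * 𝐞 (j - i))))
  have hu : ∀ i m, u i m = 𝐱 ^ i • φ ((𝐱 ^ (k - i) * 𝐞 (j + i)) • m) := fun _ _ => rfl
  have hv : ∀ i m, v i m = 𝐲 ^ i • φ ((𝐲 ^ (n - k - i) * 𝐞 (j - i)) • m) := fun _ _ => rfl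
  have ht : ∀ m, φ (𝐭 • m) = 𝐭 • φ m := fun m => by rw [← ZtoA_X, hz]
  have hend : u k = v (n - k) := by
    ext m
    rw [hu, hv, Nat.sub_self, Nat.sub_self, xA_pow_eq, natCast_sub_eq, sub_neg_eq_add, pow_zero,
      pow_zero]
  have hstart : u 0 = v 0 := by
    ext m
    rw [hu, hv, Nat.sub_zero, Nat.sub_zero, xA_pow_eq, Nat.cast_zero, sub_zero, add_zero, pow_zero,
      pow_zero]
  -- The vertices `j` and `j + k` can be served from both sides, and the terms agree there because
  -- `x ^ k = y ^ (n - k)`. Hence `Ψ = Ψ'`. Moving `x` or `y` across shifts the indices of `u` and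
  -- `v` in opposite directions and interchanges the two forms.
  let Ψ : M →+ N := ∑ i ∈ Finset.range k, u (i + 1) + ∑ i ∈ Finset.range (n - k), v i
  let Ψ' : M →+ N := ∑ i ∈ Finset.range k, u i + ∑ i ∈ Finset.range (n - k), v (i + 1)
  have hΨ : Ψ = Ψ' := by
    have h1 := (Finset.sum_range_succ u k).symm.trans (Finset.sum_range_succ' u k)
    have h2 := (Finset.sum_range_succ v (n - k)).symm.trans (Finset.sum_range_succ' v (n - k))
    rw [hend, hstart, ← sub_eq_iff_eq_add] at h1
    rw [← sub_eq_iff_eq_add] at h2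
    change _ + _ = _ + _
    rw [← h1, ← h2]
    abel
  have hΨm : ∀ m, Ψ m = ∑ i ∈ Finset.range k, u (i + 1) m + ∑ i ∈ Finset.range (n - k), v i m :=
    fun m => by simp only [Ψ, AddMonoidHom.add_apply, AddMonoidHom.finsetSum_apply]
  have hΨm' : ∀ m, Ψ m = ∑ i ∈ Finset.range k, u i m + ∑ i ∈ Finset.range (n - k), v (i + 1) m :=
    fun m => by simp only [hΨ, Ψ', AddMonoidHom.add_apply, AddMonoidHom.finsetSum_apply]
  obtain ⟨g, hg⟩ : ∃ g : M →ₗ[A 𝕜 n k] N, ∀ m, g m = Ψ m := by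
    refine exists_linearMap (𝕜 := 𝕜) (n := n) (k := k) Ψ ?_ ?_ ?_ ?_
    · intro c m
      rw [hΨm, hΨm, smul_add, Finset.smul_sum, Finset.smul_sum]
      congr 1
      · refine Finset.sum_congr rfl fun i _ => ?_
        rw [hu, hu, ← smul_ZtoA, hz, smul_ZtoA]
      · refine Finset.sum_congr rfl fun i _ => ?_
        rw [hv, hv, ← smul_ZtoA, hz, smul_ZtoA]
    · intro m
      rw [hΨm, hΨm', smul_add, Finset.smul_sum, Finset.smul_sum]
      congr 1
      · refine Finset.sum_congr rfl fun i hi => ?_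
        rw [Finset.mem_range] at hi
        rw [hu, hu, pow_succ' _ i, mul_smul 𝐱]
        congr 2
        rw [smul_smul, mul_assoc, show (j + (i + 1 : ℕ) : ZMod n) = j + i + 1 by push_cast; ring,
          ← xA_mul_E, ← mul_assoc, ← pow_succ, show k - (i + 1) + 1 = k - i by omega]
      · refine Finset.sum_congr rfl fun i hi => ?_
        rw [Finset.mem_range] at hi
        -- Here `x` runs against the `y`-path: it combines with one factor `y` to the central
        -- element `t`, which passes through the `Z`-linear map `φ`.
        have h1 : 𝐲 ^ (n - k - i) * 𝐞 (j - i) * 𝐱 =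
            𝐭 * (𝐲 ^ (n - k - (i + 1)) * 𝐞 (j - (i + 1 : ℕ))) := by
          have h2 : 𝐞 (j - i) = 𝐞 (j - (i + 1 : ℕ) + 1) := by congr 1; push_cast; ring
          rw [mul_assoc, h2, ← xA_mul_E, show n - k - i = n - k - (i + 1) + 1 by omega, pow_succ,
            ← mul_assoc, mul_assoc _ 𝐲, ← xA_comm_yA, ← tA, ← tA_mul_comm, mul_assoc]
        rw [hv, hv, smul_smul, h1, mul_smul 𝐭, ht, smul_smul _ 𝐭, ← tA_mul_comm, tA, mul_assoc,
          ← pow_succ', mul_smul]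
    · intro m
      rw [hΨm', hΨm, smul_add, Finset.smul_sum, Finset.smul_sum]
      congr 1
      · refine Finset.sum_congr rfl fun i hi => ?_
        rw [Finset.mem_range] at hi
        have h1 : 𝐱 ^ (k - i) * 𝐞 (j + i) * 𝐲 =
            𝐭 * (𝐱 ^ (k - (i + 1)) * 𝐞 (j + (i + 1 : ℕ))) := by
          have h2 : 𝐞 (j + i) = 𝐞 (j + (i + 1 : ℕ) - 1) := by congr 1; push_cast; ring
          rw [mul_assoc, h2, ← yA_mul_E, show k - i = k - (i + 1) + 1 by omega, pow_succ,
            ← mul_assoc, mul_assoc _ 𝐱, ← tA, ← tA_mul_comm, mul_assoc]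
        rw [hu, hu, smul_smul, h1, mul_smul 𝐭, ht, smul_smul _ 𝐭, ← tA_mul_comm, tA, xA_comm_yA,
          mul_assoc, ← pow_succ', mul_smul]
      · refine Finset.sum_congr rfl fun i hi => ?_
        rw [Finset.mem_range] at hi
        rw [hv, hv, pow_succ' _ i, mul_smul 𝐲]
        congr 2
        rw [smul_smul, mul_assoc, show (j - (i + 1 : ℕ) : ZMod n) = j - i - 1 by push_cast; ring,
          ← yA_mul_E, ← mul_assoc, ← pow_succ, show n - k - (i + 1) + 1 = n - k - i by omega]
    · intro a m
      rw [hΨm, hΨm, smul_add, Finset.smul_sum, Finset.smul_sum]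
      congr 1
      · refine Finset.sum_congr rfl fun i _ => ?_
        rw [hu, hu, ← he, x_pow_smul_E_smul, ← he ((_ : A 𝕜 n k) • m), x_pow_smul_E_smul]
        by_cases h : j + ((i + 1 : ℕ) : ZMod n) = a
        · rw [h, mul_smul, E_smul_E_smul, mul_smul, E_smul_E_smul]
        · rw [mul_smul, E_smul_of_ne h (E_smul_E_smul a m), smul_zero, map_zero, smul_zero, smul_zero,
            E_smul_of_ne (Ne.symm h) (E_smul_E_smul _ _)]
      · refine Finset.sum_congr rfl fun i _ => ?_
        rw [hv, hv, ← he, y_pow_smul_E_smul, ← he ((_ : A 𝕜 n k) • m), y_pow_smul_E_smul]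
        by_cases h : j - (i : ZMod n) = a
        · rw [h, mul_smul, E_smul_E_smul, mul_smul, E_smul_E_smul]
        · rw [mul_smul, E_smul_of_ne h (E_smul_E_smul a m), smul_zero, map_zero, smul_zero, smul_zero,
            E_smul_of_ne (Ne.symm h) (E_smul_E_smul _ _)]
  refine ⟨g, fun m => ?_, fun m hm => ?_⟩
  · refine ⟨Finset.range (k + (n - k)),
      fun i => if i < k then 𝐱 ^ (i + 1) else 𝐲 ^ (i - k),
      fun i => if i < k then 𝐱 ^ (k - (i + 1)) * 𝐞 (j + (i + 1 : ℕ)) else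
        𝐲 ^ (n - k - (i - k)) * 𝐞 (j - (i - k : ℕ)), ?_⟩
    rw [hg, hΨm, Finset.sum_range_add]
    congr 1
    · refine Finset.sum_congr rfl fun i hi => ?_
      rw [Finset.mem_range] at hi
      simp only [if_pos hi, hu]
    · refine Finset.sum_congr rfl fun i hi => ?_
      have hi' : ¬ k + i < k := by omega
      simp only [if_neg hi', Nat.add_sub_cancel_left, hv]
  · rw [hg, hΨm]
    have hk1 := hk.out
    -- At the vertex `j + k` only the term `u k = x ^ k φ` survives, since the other terms belong to
    -- different residues modulo `n`.
    rw [Finset.sum_eq_single_of_mem (k - 1) (Finset.mem_range.2 (by omega)), Nat.sub_add_cancel hk1,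
      Finset.sum_eq_zero, add_zero, hu, Nat.sub_self, pow_zero, one_mul, hm]
    · intro i hi
      rw [Finset.mem_range] at hi
      rw [hv, mul_smul, E_smul_of_ne _ hm, smul_zero, map_zero, smul_zero]
      intro h
      have h1 : ((i + k : ℕ) : ZMod n) = 0 := by
        push_cast
        linear_combination -h
      have := natCast_eq_zero_of_lt (by omega) h1
      omega
    · intro i hi hik
      rw [Finset.mem_range] at hi
      rw [hu, mul_smul, E_smul_of_ne _ hm, smul_zero, map_zero, smul_zero]
      intro h
      have h1 := natCast_inj_of_lt (n := n) (r := i + 1) (s := k) (by omega) hkn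
        (by linear_combination h)
      omega

end Linear

end GrassmannianCM

namespace GrassmannianCM

/-! ### Paths in `A`, extension of morphisms, and injective objects of `CM(A)`. -/

section Injectives

variable {𝕜 : Type u} [Field 𝕜] {n k : ℕ} [Fact (k < n)] [hk : Fact (1 ≤ k)] [NeZero n]
  [HasEnoughRootsOfUnity 𝕜 n]

local notation "𝐱" => xA 𝕜 n k
local notation "𝐲" => yA 𝕜 n k
local notation "𝐭" => tA 𝕜 n k
local notation "𝐞" => E 𝕜 n k
local notation "𝐳" => ZtoA 𝕜 n k

theorem xA_pow_eq_tA_pow_mul {r : ℕ} (h : k ≤ r) (hr : r ≤ n) :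
    𝐱 ^ r = 𝐭 ^ (r - k) * 𝐲 ^ (n - r) := by
  rw [tA, (show Commute 𝐱 𝐲 from xA_comm_yA).mul_pow, mul_assoc, ← pow_add,
    show r - k + (n - r) = n - k by omega, ← xA_pow_eq, ← pow_add, Nat.sub_add_cancel h]

theorem yA_pow_eq_tA_pow_mul {r : ℕ} (h : n - k ≤ r) (hr : r ≤ n) :
    𝐲 ^ r = 𝐭 ^ (r - (n - k)) * 𝐱 ^ (n - r) := by
  have hkn : k < n := Fact.out
  rw [tA, xA_comm_yA, (show Commute 𝐲 𝐱 from xA_comm_yA.symm).mul_pow, mul_assoc, ← pow_add,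
    show r - (n - k) + (n - r) = k by omega, xA_pow_eq, ← pow_add, Nat.sub_add_cancel h]

variable (𝕜 n k) in
/-- The shortest path from the vertex `a` to the vertex `k`, up to the idempotent `e_a`. -/
noncomputable def toK (a : ZMod n) : A 𝕜 n k :=
  if a.val ≤ k then 𝐱 ^ (k - a.val) else 𝐲 ^ (a.val - k)

variable (𝕜 n k) in
/-- The path from the vertex `j` to the vertex `j + i` that generates `e_{j + i} A e_j`
over `Z`, up to the idempotent `e_j`. -/
noncomputable def path (i : ZMod n) : A 𝕜 n k :=
  if i.val ≤ k then 𝐱 ^ i.val else 𝐲 ^ (n - i.val)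

theorem toK_mul_E (a : ZMod n) : toK 𝕜 n k a * 𝐞 a = 𝐞 k * toK 𝕜 n k a := by
  have ha : ((a.val : ℕ) : ZMod n) = a := ZMod.natCast_zmod_val a
  rw [toK]
  split_ifs with h
  · rw [xA_pow_mul_E, Nat.cast_sub h, ha, add_sub_cancel]
  · rw [yA_pow_mul_E, Nat.cast_sub (by omega), ha, sub_sub_cancel]

/-- Whichever side of `k` the vertex `a` lies on, the route from `0` to `k` through `a` has the same
value, by `x ^ k = y ^ (n - k)`. Elements of `(e_n) M` at the vertex `k` can therefore be divided by
the path from any `a`. -/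
theorem toK_mul_path (a : ZMod n) : toK 𝕜 n k a * path 𝕜 n k a = 𝐱 ^ k := by
  have ha := ZMod.val_lt a
  rw [toK, path]
  split_ifs with h
  · rw [← pow_add, Nat.sub_add_cancel h]
  · rw [← pow_add, show a.val - k + (n - a.val) = n - k by omega, xA_pow_eq]

theorem path_natCast : path 𝕜 n k k = 𝐱 ^ k := by
  rw [path, ZMod.val_natCast_of_lt Fact.out, if_pos le_rfl]

/-- The idempotents select the powers `x ^ r` with `r ≡ i` and `y ^ r` with `r ≡ -i`. One that is
not the shortest path differs from it by a power of the central element `t`. -/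
theorem exists_E_mul_mul_E (i j : ZMod n) (a : A 𝕜 n k) :
    ∃ z, 𝐞 (j + i) * a * 𝐞 j = 𝐳 z * (path 𝕜 n k i * 𝐞 j) := by
  have hi := ZMod.val_lt i
  induction a using A_induction with
  | add a b ha hb =>
    obtain ⟨z, hz⟩ := ha
    obtain ⟨w, hw⟩ := hb
    exact ⟨z + w, by rw [mul_add, add_mul, hz, hw, map_add, add_mul]⟩
  | x c r hr l =>
    rw [← mul_assoc, ← ZtoA_mul_comm, mul_assoc, mul_assoc, mul_assoc]
    by_cases hl : l = j
    swap
    · exact ⟨0, by rw [E_mul_of_ne hl, mul_zero, mul_zero, mul_zero, map_zero, zero_mul]⟩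
    subst hl
    rw [E_mul_self]
    by_cases hri : i = r
    swap
    · refine ⟨0, ?_⟩
      rw [xA_pow_mul_E, ← mul_assoc (𝐞 _), E_mul_of_ne (by simpa using hri), zero_mul, mul_zero,
        map_zero, zero_mul]
    subst hri
    rw [ZMod.val_natCast_of_lt hr] at hi
    rw [xA_pow_mul_E, ← mul_assoc (𝐞 _), E_mul_self, ← xA_pow_mul_E, path,
      ZMod.val_natCast_of_lt hr]
    split_ifs with h
    · exact ⟨c, rfl⟩
    · refine ⟨c * PowerSeries.X ^ (r - k), ?_⟩
      rw [xA_pow_eq_tA_pow_mul (not_le.1 h).le hr.le, map_mul, map_pow, ZtoA_X]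
      simp only [mul_assoc]
  | y c r hr l =>
    rw [← mul_assoc, ← ZtoA_mul_comm, mul_assoc, mul_assoc, mul_assoc]
    by_cases hl : l = j
    swap
    · exact ⟨0, by rw [E_mul_of_ne hl, mul_zero, mul_zero, mul_zero, map_zero, zero_mul]⟩
    subst hl
    rw [E_mul_self]
    by_cases hri : i = -r
    swap
    · refine ⟨0, ?_⟩
      rw [yA_pow_mul_E, ← mul_assoc (𝐞 _), E_mul_of_ne, zero_mul, mul_zero,
        map_zero, zero_mul]
      intro h
      exact hri (by linear_combination h)
    subst hri
    rw [yA_pow_mul_E, ← mul_assoc (𝐞 _), ← sub_eq_add_neg, E_mul_self, ← yA_pow_mul_E, path]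
    -- The case `r = 0` is separate because `(-r).val` is then `0` and not `n - r`.
    obtain rfl | hr0 := Nat.eq_zero_or_pos r
    · exact ⟨c, by simp⟩
    have hval : (-(r : ZMod n)).val = n - r := by
      rw [show -(r : ZMod n) = ((n - r : ℕ) : ZMod n) by
        rw [Nat.cast_sub hr.le, ZMod.natCast_self, zero_sub], ZMod.val_natCast_of_lt (by omega)]
    rw [hval]
    split_ifs with h
    · refine ⟨c * PowerSeries.X ^ (r - (n - k)), ?_⟩
      rw [yA_pow_eq_tA_pow_mul (by omega) hr.le, map_mul, map_pow, ZtoA_X]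
      simp only [mul_assoc]
    · exact ⟨c, by rw [Nat.sub_sub_self hr.le]⟩

/-- A power of `t` times any `e_i` factors through `e_j`. If `e_j` were zero, torsion-freeness would
make every `e_i`, and hence `1`, vanish. -/
theorem E_ne_zero (j : ZMod n) : 𝐞 j ≠ 0 := by
  intro h
  refine one_ne_zero (α := A 𝕜 n k) ?_
  rw [← E_sum]
  refine Finset.sum_eq_zero fun i _ => ?_
  have h1 : 𝐞 i * 𝐱 ^ (i - j).val = 0 := by
    have := xA_pow_mul_E (𝕜 := 𝕜) (k := k) (i - j).val j
    rwa [h, mul_zero, ZMod.natCast_zmod_val, add_sub_cancel, eq_comm] at this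
  have h2 : 𝐭 ^ (i - j).val • 𝐞 i = 0 := by
    rw [smul_eq_mul, ← ZtoA_X, ← map_pow, ZtoA_mul_comm, map_pow, ZtoA_X, tA,
      (show Commute 𝐱 𝐲 from xA_comm_yA).mul_pow, ← mul_assoc, h1, zero_mul]
  exact isCM_A.pow_smul_eq_zero _ h2

theorem eq_zero_of_ZtoA_mul {z : PowerSeries 𝕜} {j : ZMod n} (h : 𝐳 z * (𝐱 ^ k * 𝐞 j) = 0) :
    z = 0 := by
  by_contra hz
  exact E_ne_zero j (isCM_A.x_smul_eq_zero k (isCM_A.smul_eq_zero hz h))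

variable {M : Type u} [AddCommGroup M] [Module (A 𝕜 n k) M]
variable {N : Type u} [AddCommGroup N] [Module (A 𝕜 n k) N]

theorem IsCM.toK_smul_eq_zero (hM : IsCM 𝕜 n k M) {a : ZMod n} {m : M}
    (h : toK 𝕜 n k a • m = 0) : m = 0 := by
  rw [toK] at h
  split_ifs at h
  · exact hM.x_smul_eq_zero _ h
  · exact hM.y_smul_eq_zero _ h

/-- A linear map to a Cohen–Macaulay module is determined by its values at one vertex. -/
theorem IsCM.linearMap_ext (hN : IsCM 𝕜 n k N) (i : ZMod n) {f g : M →ₗ[A 𝕜 n k] N}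
    (h : ∀ m, 𝐞 i • m = m → f m = g m) (m : M) : f m = g m := by
  refine ext_E (𝕜 := 𝕜) (n := n) (k := k) fun a => ?_
  rw [← sub_eq_zero, ← map_smul, ← map_smul]
  -- This power of `x` moves the vertex `a` to `i` and acts injectively on `N`.
  refine hN.x_smul_eq_zero (i - a).val ?_
  rw [smul_sub, ← map_smul, ← map_smul, sub_eq_zero]
  apply h
  rw [x_pow_smul_E_smul, ZMod.natCast_zmod_val, add_sub_cancel, E_smul_E_smul]

/-- A sufficient condition for a morphism to extend along an inflation. -/
theorem exists_extension {X Y W : Type u} [AddCommGroup X] [Module (A 𝕜 n k) X] [AddCommGroup Y]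
    [Module (A 𝕜 n k) Y] [AddCommGroup W] [Module (A 𝕜 n k) W] (hN : IsCM 𝕜 n k N)
    (hW : IsCM 𝕜 n k W) {f : X →ₗ[A 𝕜 n k] Y} {g : Y →ₗ[A 𝕜 n k] W}
    (hf : Function.Injective f) (hfg : Function.Exact f g) (hg : Function.Surjective g)
    (h : X →ₗ[A 𝕜 n k] N) (j : ZMod n)
    (hh : ∀ m, ∃ w, 𝐞 (j + k) • h m = 𝐱 ^ k • 𝐞 j • w) :
    ∃ l : Y →ₗ[A 𝕜 n k] N, ∀ x, l (f x) = h x := by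
  obtain ⟨ρ, hρz, hρ⟩ := hW.exists_retraction f g hf hfg hg
  choose w hw using hh
  have hcancel : ∀ {a b : N}, 𝐱 ^ k • a = 𝐱 ^ k • b → a = b := fun {a b} hab => by
    rw [← sub_eq_zero]
    exact hN.x_smul_eq_zero k (by rw [smul_sub, hab, sub_self])
  -- This is `e_{j+k} h` divided by `x ^ k`; torsion-freeness makes the quotient additive and
  -- `Z`-linear. Composed with the `Z`-linear retraction, it induces an `A`-linear map that agrees
  -- with `h` at the vertex `j + k`, hence everywhere.
  let φ₀ : X →+ N := AddMonoidHom.mk' (fun m => 𝐞 j • w m) fun a b => hcancel (by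
    rw [smul_add, ← hw, ← hw, ← hw, map_add, smul_add])
  have hφ₀ : ∀ m, 𝐞 (j + k) • h m = 𝐱 ^ k • φ₀ m := hw
  have hz : ∀ c y, φ₀.comp ρ (𝐳 c • y) = 𝐳 c • φ₀.comp ρ y := fun c m => by
    rw [AddMonoidHom.comp_apply, hρz, AddMonoidHom.comp_apply]
    apply hcancel
    rw [← hφ₀, map_smul, ← smul_ZtoA, hφ₀, smul_ZtoA]
  obtain ⟨l, -, hl⟩ := exists_induced j (φ₀.comp ρ) hz fun m => E_smul_E_smul _ _
  refine ⟨l, fun x => hN.linearMap_ext (j + k) (f := l ∘ₗ f) (fun m hm => ?_) x⟩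
  rw [LinearMap.comp_apply, hl _ (by rw [← map_smul, hm]), AddMonoidHom.comp_apply, hρ, ← hφ₀,
    ← map_smul, hm]

theorem exists_extension_A {X Y W : Type u} [AddCommGroup X] [Module (A 𝕜 n k) X] [AddCommGroup Y]
    [Module (A 𝕜 n k) Y] [AddCommGroup W] [Module (A 𝕜 n k) W]
    (hW : IsCM 𝕜 n k W) {f : X →ₗ[A 𝕜 n k] Y} {g : Y →ₗ[A 𝕜 n k] W}
    (hf : Function.Injective f) (hfg : Function.Exact f g) (hg : Function.Surjective g)
    (h : X →ₗ[A 𝕜 n k] A 𝕜 n k) : ∃ l : Y →ₗ[A 𝕜 n k] A 𝕜 n k, ∀ x, l (f x) = h x := by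
  -- Right multiplication by `e_j` brings the values into `A e_j`, where the divisibility by `x ^ k`
  -- is automatic because `e_{j+k} A e_j = Z x ^ k e_j`. Summing over `j` recovers `h`.
  have key : ∀ j : ZMod n, ∃ l : Y →ₗ[A 𝕜 n k] A 𝕜 n k, ∀ x, l (f x) = h x * 𝐞 j := by
    intro j
    refine exists_extension isCM_A hW hf hfg hg
      ((LinearMap.toSpanSingleton (A 𝕜 n k) (A 𝕜 n k) (𝐞 j)) ∘ₗ h) j fun m => ?_
    obtain ⟨z, hz⟩ := exists_E_mul_mul_E (k : ZMod n) j (h m)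
    rw [path_natCast] at hz
    refine ⟨𝐳 z * 𝐞 j, ?_⟩
    rw [LinearMap.comp_apply, LinearMap.toSpanSingleton_apply]
    simp only [smul_eq_mul]
    rw [← mul_assoc, hz, ZtoA_mul_comm, ZtoA_mul_comm, ← mul_assoc (𝐞 j), E_mul_self, mul_assoc]
  choose l hl using key
  refine ⟨∑ j, l j, fun x => ?_⟩
  rw [LinearMap.sum_apply]
  simp only [hl]
  rw [← Finset.mul_sum, E_sum, mul_one]

theorem exists_extension_pi {ι : Type} {X Y W : Type u} [AddCommGroup X] [Module (A 𝕜 n k) X]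
    [AddCommGroup Y] [Module (A 𝕜 n k) Y] [AddCommGroup W] [Module (A 𝕜 n k) W]
    (hW : IsCM 𝕜 n k W) {f : X →ₗ[A 𝕜 n k] Y} {g : Y →ₗ[A 𝕜 n k] W}
    (hf : Function.Injective f) (hfg : Function.Exact f g) (hg : Function.Surjective g)
    (h : X →ₗ[A 𝕜 n k] ι → A 𝕜 n k) : ∃ l : Y →ₗ[A 𝕜 n k] ι → A 𝕜 n k, ∀ x, l (f x) = h x := by
  choose l hl using fun i => exists_extension_A hW hf hfg hg (LinearMap.proj i ∘ₗ h)
  exact ⟨LinearMap.pi l, fun x => funext fun i => hl i x⟩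

theorem E_zero_mem : 𝐞 0 ∈ idealEn 𝕜 n k := by
  have := eA_eq_E (𝕜 := 𝕜) (n := n) (k := k) n
  rw [ZMod.natCast_self] at this
  rw [← this]
  exact eA_mem

/-- `e_a A e_0` is spanned over the central `Z` by a single path, so the component of the two-sided
ideal at `a` is generated by that path as a right ideal. -/
theorem exists_of_mem_idealEn {r : A 𝕜 n k} (hr : r ∈ idealEn 𝕜 n k) (a : ZMod n) :
    ∃ s, 𝐞 a * r = path 𝕜 n k a * 𝐞 0 * s := by
  replace hr : r ∈ TwoSidedIdeal.span {eA 𝕜 n k n} := hr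
  rw [TwoSidedIdeal.mem_span_iff_mem_addSubgroup_closure] at hr
  induction hr using AddSubgroup.closure_induction with
  | mem r h =>
    obtain ⟨_, ⟨b, -, _, rfl, rfl⟩, d, -, rfl⟩ := h
    obtain ⟨z, hz⟩ := exists_E_mul_mul_E a 0 b
    rw [zero_add] at hz
    refine ⟨𝐳 z * d, ?_⟩
    change 𝐞 a * (b * eA 𝕜 n k n * d) = _
    rw [eA_eq_E, ZMod.natCast_self, ← mul_assoc, ← mul_assoc, hz, ZtoA_mul_comm, mul_assoc]
  | zero => exact ⟨0, by simp⟩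
  | add x y _ _ hx hy =>
    obtain ⟨s, hs⟩ := hx
    obtain ⟨s', hs'⟩ := hy
    exact ⟨s + s', by rw [mul_add, hs, hs', mul_add]⟩
  | neg x _ hx =>
    obtain ⟨s, hs⟩ := hx
    exact ⟨-s, by rw [mul_neg, hs, mul_neg]⟩

theorem path_E_zero_smul_mem (a : ZMod n) (w : M) :
    path 𝕜 n k a • 𝐞 0 • w ∈ idealEn 𝕜 n k • (⊤ : Submodule (A 𝕜 n k) M) :=
  Submodule.smul_mem _ _ (Submodule.smul_mem_smul E_zero_mem trivial)

theorem mem_idealEn_smul_top {m : M} : m ∈ idealEn 𝕜 n k • (⊤ : Submodule (A 𝕜 n k) M) ↔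
    ∀ a, ∃ w, 𝐞 a • m = path 𝕜 n k a • 𝐞 0 • w := by
  constructor
  · intro hm a
    induction hm using Submodule.smul_induction_on' with
    | smul r hr m hm =>
      obtain ⟨s, hs⟩ := exists_of_mem_idealEn hr a
      exact ⟨s • m, by rw [smul_smul, hs, mul_smul, mul_smul]⟩
    | add x hx y hy h1 h2 =>
      obtain ⟨w, hw⟩ := h1
      obtain ⟨w', hw'⟩ := h2
      exact ⟨w + w', by rw [smul_add, hw, hw', smul_add, smul_add]⟩
  · intro h
    rw [← sum_E_smul (𝕜 := 𝕜) (n := n) (k := k) m]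
    refine Submodule.sum_mem _ fun a _ => ?_
    obtain ⟨w, hw⟩ := h a
    rw [hw]
    exact path_E_zero_smul_mem a w

/-- The modules `(e_n) N` are injective in the category of Cohen–Macaulay modules. -/
theorem exists_extension_idealEn {X Y W : Type u} [AddCommGroup X] [Module (A 𝕜 n k) X]
    [AddCommGroup Y] [Module (A 𝕜 n k) Y] [AddCommGroup W] [Module (A 𝕜 n k) W]
    (hN : IsCM 𝕜 n k N) (hW : IsCM 𝕜 n k W) {f : X →ₗ[A 𝕜 n k] Y} {g : Y →ₗ[A 𝕜 n k] W}
    (hf : Function.Injective f) (hfg : Function.Exact f g) (hg : Function.Surjective g)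
    (h : X →ₗ[A 𝕜 n k] ↥(idealEn 𝕜 n k • (⊤ : Submodule (A 𝕜 n k) N))) :
    ∃ l : Y →ₗ[A 𝕜 n k] ↥(idealEn 𝕜 n k • (⊤ : Submodule (A 𝕜 n k) N)), ∀ x, l (f x) = h x := by
  refine exists_extension (hN.submodule _) hW hf hfg hg h 0 fun m => ?_
  -- The component of `(e_n) N` at the vertex `k` is `x ^ k e_0 N`, which is the divisibility
  -- required with `j = 0`.
  obtain ⟨w, hw⟩ := mem_idealEn_smul_top.1 (h m).2 k
  rw [path_natCast] at hw
  refine ⟨⟨𝐞 0 • w, Submodule.smul_mem_smul E_zero_mem trivial⟩, Subtype.ext ?_⟩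
  rw [zero_add]
  change 𝐞 k • (h m : N) = 𝐱 ^ k • 𝐞 0 • 𝐞 0 • w
  rw [hw, E_smul_E_smul]

/-- Every Cohen–Macaulay module has a map to a free module, with values in any given
left ideal that contains `e_j`, which is well-behaved at the vertex `j + k`. -/
theorem IsCM.exists_map_pi (hM : IsCM 𝕜 n k M) (j : ZMod n) :
    ∃ (r : ℕ) (ι : M →ₗ[A 𝕜 n k] Fin r → A 𝕜 n k),
      (∀ I : Ideal (A 𝕜 n k), 𝐞 j ∈ I → ∀ m s, ι m s ∈ I) ∧
      (∀ m v, 𝐞 (j + k) • m = m → ι m = 𝐭 • v → ∃ m', m = 𝐭 • m') ∧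
      ∀ m, 𝐞 (j + k) • m = m → ι m = 0 → m = 0 := by
  obtain ⟨r, φ, hφ, hφX, hφ0⟩ := hM.exists_coordinates
  -- Each `Z`-coordinate of `M`, placed in `Z e_j`, induces an `A`-linear map to `A`. At the vertex
  -- `j + k` this map is the coordinate times `x ^ k e_j`, so vanishing and divisibility by `t` can
  -- be read off there.
  let φ' : Fin r → M →+ A 𝕜 n k := fun s =>
    ((AddMonoidHom.mulRight (𝐞 j)).comp (𝐳 : PowerSeries 𝕜 →+ A 𝕜 n k)).comp (φ s)
  have hφ' : ∀ s m, φ' s m = 𝐳 (φ s m) * 𝐞 j := fun _ _ => rfl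
  have key : ∀ s, ∃ Ψ : M →ₗ[A 𝕜 n k] A 𝕜 n k,
      (∀ m, ∃ (t : Finset ℕ) (a b : ℕ → A 𝕜 n k), Ψ m = ∑ i ∈ t, a i • φ' s (b i • m)) ∧
      ∀ m, 𝐞 (j + k) • m = m → Ψ m = 𝐱 ^ k • φ' s m := fun s => by
    refine exists_induced j (φ' s) (fun c m => ?_) fun m => ?_
    · rw [hφ', hφ, hφ', map_mul, mul_assoc, smul_eq_mul]
    · rw [hφ', ZtoA_mul_comm, smul_eq_mul, ← mul_assoc, E_mul_self]
  choose Ψ hΨ hΨk using key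
  have hval : ∀ m, 𝐞 (j + k) • m = m → ∀ s, Ψ s m = 𝐳 (φ s m) * (𝐱 ^ k * 𝐞 j) := fun m hm s => by
    rw [hΨk s m hm, hφ', smul_eq_mul, ← mul_assoc, ← mul_assoc, ZtoA_mul_comm]
  refine ⟨r, LinearMap.pi Ψ, fun I hI m s => ?_, fun m v hm hv => hφX m fun s => ?_,
    fun m hm h0 => hφ0 m fun s => ?_⟩
  · obtain ⟨t, a, b, h⟩ := hΨ s m
    rw [LinearMap.pi_apply, h]
    refine Submodule.sum_mem _ fun i _ => ?_
    rw [hφ']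
    exact Submodule.smul_mem _ _ (Ideal.mul_mem_left _ _ hI)
  · have h1 : Ψ s m = 𝐭 * v s := congrFun hv s
    rw [hval m hm] at h1
    -- Only the part of `v s` in `e_{j+k} A e_j = Z x ^ k e_j` matters; comparing coefficients gives
    -- `φ s m = X * z`.
    obtain ⟨z, hz⟩ := exists_E_mul_mul_E (k : ZMod n) j (v s)
    rw [path_natCast] at hz
    have h2 : 𝐞 (j + k) * (𝐳 (φ s m) * (𝐱 ^ k * 𝐞 j)) * 𝐞 j = 𝐳 (φ s m) * (𝐱 ^ k * 𝐞 j) := by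
      have h3 : 𝐞 (j + k) * (𝐱 ^ k * 𝐞 j) = 𝐱 ^ k * 𝐞 j := by
        rw [xA_pow_mul_E, ← mul_assoc, E_mul_self]
      rw [← mul_assoc, ← ZtoA_mul_comm, mul_assoc (𝐳 _), h3, mul_assoc, mul_assoc, E_mul_self]
    rw [h1, ← mul_assoc, ← tA_mul_comm, mul_assoc, mul_assoc, ← mul_assoc (𝐞 _), hz, ← h1,
      ← ZtoA_X, ← mul_assoc, ← map_mul, eq_comm, ← sub_eq_zero, ← sub_mul, ← map_sub] at h2
    exact ⟨z, sub_eq_zero.1 (eq_zero_of_ZtoA_mul h2)⟩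
  · have h1 : Ψ s m = 0 := congrFun h0 s
    rw [hval m hm] at h1
    exact eq_zero_of_ZtoA_mul h1

theorem isCM_quotient_range (hN : IsCM 𝕜 n k N) (f : M →ₗ[A 𝕜 n k] N)
    (h : ∀ m v, f m = 𝐭 • v → ∃ m', m = 𝐭 • m') : IsCM 𝕜 n k (N ⧸ LinearMap.range f) := by
  have := hN.finite
  refine ⟨inferInstance, fun q hq => ?_⟩
  obtain ⟨v, rfl⟩ := Submodule.Quotient.mk_surjective _ q
  rw [← Submodule.Quotient.mk_smul, Submodule.Quotient.mk_eq_zero] at hq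
  obtain ⟨m, hm⟩ := hq
  obtain ⟨m', rfl⟩ := h m v hm
  rw [Submodule.Quotient.mk_eq_zero]
  exact ⟨m', hN.cancel (by rw [← map_smul, hm])⟩

/-- The maps for one `j` control `M` only at the vertex `j + k`. All `j` together control every
vertex, and the cokernel is torsion-free because divisibility by `t` is then reflected. -/
theorem IsCM.exists_embedding (hM : IsCM 𝕜 n k M) :
    ∃ (ι : Type) (_ : Finite ι) (f : M →ₗ[A 𝕜 n k] ι → A 𝕜 n k),
      Function.Injective f ∧ IsCM 𝕜 n k ((ι → A 𝕜 n k) ⧸ LinearMap.range f) := by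
  choose r ι _ hX h0 using fun j => hM.exists_map_pi j
  let f : M →ₗ[A 𝕜 n k] (Σ j, Fin (r j)) → A 𝕜 n k := LinearMap.pi fun p =>
    LinearMap.proj p.2 ∘ₗ ι p.1
  have hf : ∀ m j s, f m ⟨j, s⟩ = ι j m s := fun _ _ _ => rfl
  refine ⟨_, inferInstance, f, ?_, isCM_quotient_range isCM_A.pi f fun m v hm => ?_⟩
  · rw [injective_iff_map_eq_zero]
    intro m hm
    refine ext_E (𝕜 := 𝕜) (n := n) (k := k) fun a => ?_
    rw [smul_zero]
    refine h0 (a - k) _ (by rw [sub_add_cancel, E_smul_E_smul]) (funext fun s => ?_)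
    rw [map_smul, Pi.smul_apply, ← hf, hm]
    exact smul_zero _
  · have : ∀ a, ∃ w, 𝐞 a • m = 𝐭 • w := fun a => by
      refine hX (a - k) (𝐞 a • m) (fun s => 𝐞 a • v ⟨_, s⟩)
        (by rw [sub_add_cancel, E_smul_E_smul]) (funext fun s => ?_)
      rw [map_smul, Pi.smul_apply, ← hf, hm, Pi.smul_apply, Pi.smul_apply, smul_tA]
    choose w hw using this
    refine ⟨∑ a, w a, ?_⟩
    rw [Finset.smul_sum, ← sum_E_smul (𝕜 := 𝕜) (n := n) (k := k) m]
    exact Finset.sum_congr rfl fun a _ => hw a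

/-- Every Cohen–Macaulay module embeds into one of the form `(e_n) T`, well-behaved at `k`. -/
theorem IsCM.exists_map_idealEn (hM : IsCM 𝕜 n k M) : ∃ (r : ℕ) (ι : M →ₗ[A 𝕜 n k]
      ↥(idealEn 𝕜 n k • (⊤ : Submodule (A 𝕜 n k) (Fin r → A 𝕜 n k)))),
    Function.Injective ι ∧ ∀ m v, 𝐞 k • m = m → ι m = 𝐭 • v → ∃ m', m = 𝐭 • m' := by
  obtain ⟨r, ι, hI, hX, h0⟩ := hM.exists_map_pi 0
  rw [zero_add] at hX h0
  have hmem : ∀ m, ι m ∈ idealEn 𝕜 n k • (⊤ : Submodule (A 𝕜 n k) (Fin r → A 𝕜 n k)) := by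
    intro m
    rw [pi_eq_sum_univ' (ι m)]
    refine Submodule.sum_mem _ fun s _ => ?_
    exact Submodule.smul_mem_smul (hI _ E_zero_mem m s) trivial
  refine ⟨r, LinearMap.codRestrict _ ι hmem, ?_, fun m v hm hv => ?_⟩
  · intro m m' h
    have h' : ι m = ι m' := congrArg Subtype.val h
    refine sub_eq_zero.1 ?_
    -- Injectivity at the vertex `k` is enough: the map `a ↦ a • (m - m')` on `A` vanishes at that
    -- vertex, hence everywhere, in particular at `1`.
    refine hM.linearMap_ext (M := A 𝕜 n k) k (f := LinearMap.toSpanSingleton _ _ (m - m')) (g := 0)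
      (fun a ha => ?_) 1 |> fun h => by simpa using h
    refine h0 _ ?_ ?_
    · rw [LinearMap.toSpanSingleton_apply, smul_smul]
      exact congrArg (· • _) ha
    · rw [LinearMap.toSpanSingleton_apply, map_smul, map_sub, h', sub_self, smul_zero]
  · exact hX m v hm (congrArg Subtype.val hv)

/-- A criterion for the map `(f, ι)` to have a Cohen–Macaulay cokernel. -/
theorem exists_eq_tA_smul {X T : Type u} [AddCommGroup X] [Module (A 𝕜 n k) X] [AddCommGroup T]
    [Module (A 𝕜 n k) T] (hX : IsCM 𝕜 n k X) (hN : IsCM 𝕜 n k N)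
    {f : X →ₗ[A 𝕜 n k] N} {ι : X →ₗ[A 𝕜 n k] T}
    (hι : ∀ m v, 𝐞 k • m = m → ι m = 𝐭 • v → ∃ m', m = 𝐭 • m')
    (H : ∀ a e v, 𝐞 a • e = e → 𝐞 k • v = v → toK 𝕜 n k a • e = f v → ∃ w, toK 𝕜 n k a • w = v)
    {x : X} {e : N} {τ : T} (h1 : f x = 𝐭 • e) (h2 : ι x = 𝐭 • τ) : ∃ x', x = 𝐭 • x' := by
  have key : ∀ a, ∃ w, 𝐞 a • x = 𝐭 • w := by
    intro a
    have hE : ∀ {Q : Type u} [AddCommGroup Q] [Module (A 𝕜 n k) Q] (q : Q),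
        toK 𝕜 n k a • 𝐞 a • q = 𝐞 k • toK 𝕜 n k a • q := fun q => by
      rw [smul_smul, toK_mul_E, mul_smul]
    have hx : 𝐞 k • toK 𝕜 n k a • 𝐞 a • x = toK 𝕜 n k a • 𝐞 a • x := by
      rw [hE, E_smul_E_smul]
    -- The component at `a` is pushed to `k`, where `ι` detects divisibility by `t`. The hypothesis
    -- `H` brings the quotient `v` back to `a`, and the injective action of `toK` finishes.
    obtain ⟨v, hv⟩ := hι (toK 𝕜 n k a • 𝐞 a • x) (toK 𝕜 n k a • 𝐞 a • τ) hx (by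
      rw [map_smul, map_smul, h2, smul_tA, smul_tA])
    have hkv : 𝐞 k • v = v := hX.cancel (by rw [smul_tA, ← hv, hx])
    have hfv : toK 𝕜 n k a • 𝐞 a • e = f v := hN.cancel (by
      rw [← map_smul, ← hv, map_smul, map_smul, h1, smul_tA, smul_tA])
    obtain ⟨w, hw⟩ := H a _ v (E_smul_E_smul a e) hkv hfv
    refine ⟨w, ?_⟩
    rw [← sub_eq_zero]
    refine hX.toK_smul_eq_zero (a := a) ?_
    rw [smul_sub, hv, ← hw, smul_tA, sub_self]
  choose w hw using key
  refine ⟨∑ a, w a, ?_⟩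
  rw [Finset.smul_sum, ← sum_E_smul (𝕜 := 𝕜) (n := n) (k := k) x]
  exact Finset.sum_congr rfl fun a _ => hw a

end Injectives

end GrassmannianCM

namespace GrassmannianCM

/-! ### Evaluation of power series at commuting nilpotent elements. -/

section Truncation

open MvPowerSeries

variable {𝕜 : Type u} [Field 𝕜]

/-- Induction for power series in two variables modulo `x ^ k` and `y ^ m`. -/
theorem truncated_induction (k m : ℕ) {p : MvPowerSeries (Fin 2) 𝕜 → Prop}
    (add : ∀ f g, p f → p g → p (f + g)) (monomial : ∀ c a b, p (C c * (X 0 ^ a * X 1 ^ b)))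
    (x : ∀ f, p (X 0 ^ k * f)) (y : ∀ f, p (X 1 ^ m * f)) (f : MvPowerSeries (Fin 2) 𝕜) : p f := by
  -- Splitting off the constant term of `f` leaves multiples of monomials with one exponent raised;
  -- the process stops when `a ≥ k` or `b ≥ m`.
  have key : ∀ N a b f, k - a + (m - b) ≤ N → p (X 0 ^ a * X 1 ^ b * f) := by
    intro N
    induction N with
    | zero =>
      intro a b f h
      obtain ⟨c, rfl⟩ : ∃ c, a = k + c := ⟨a - k, by omega⟩
      have := x (X 0 ^ c * X 1 ^ b * f)
      rwa [← mul_assoc, ← mul_assoc, ← pow_add] at this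
    | succ N ih =>
      intro a b f h
      by_cases ha : k ≤ a
      · obtain ⟨c, rfl⟩ : ∃ c, a = k + c := ⟨a - k, by omega⟩
        have := x (X 0 ^ c * X 1 ^ b * f)
        rwa [← mul_assoc, ← mul_assoc, ← pow_add] at this
      by_cases hb : m ≤ b
      · obtain ⟨c, rfl⟩ : ∃ c, b = m + c := ⟨b - m, by omega⟩
        have := y (X 1 ^ c * X 0 ^ a * f)
        rwa [← mul_assoc, ← mul_assoc, ← pow_add, mul_comm (X 1 ^ _)] at this
      obtain ⟨c, f₁, f₂, rfl⟩ := eq_C_add_X_mul f 0 1 (by decide)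
      have h1 := ih (a + 1) b f₁ (by omega)
      have h2 := ih a (b + 1) f₂ (by omega)
      have := add _ _ (add _ _ (monomial c a b) h1) h2
      convert this using 1
      ring
  simpa using key _ 0 0 f le_rfl

variable {S : Type*} [Ring S] [Algebra 𝕜 S]

/-- Evaluation of a power series at two commuting nilpotent elements, as a linear map. -/
noncomputable def truncLinear (k m : ℕ) (x y : S) : MvPowerSeries (Fin 2) 𝕜 →ₗ[𝕜] S :=
  ∑ a ∈ Finset.range k, ∑ b ∈ Finset.range m,
    (LinearMap.toSpanSingleton 𝕜 S (x ^ a * y ^ b)) ∘ₗ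
      (coeff (Finsupp.single 0 a + Finsupp.single 1 b))

theorem truncLinear_apply (k m : ℕ) (x y : S) (f : MvPowerSeries (Fin 2) 𝕜) :
    truncLinear k m x y f = ∑ a ∈ Finset.range k, ∑ b ∈ Finset.range m,
      coeff (Finsupp.single 0 a + Finsupp.single 1 b) f • (x ^ a * y ^ b) := by
  simp [truncLinear]

/-- An index shift in the sum over `a`. One boundary term vanishes because `x f` has no monomials
without `x`, the other because `x ^ k = 0`. -/
theorem truncLinear_X0_mul {k m : ℕ} {x y : S} (hx : x ^ k = 0) (f : MvPowerSeries (Fin 2) 𝕜) :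
    truncLinear k m x y (X 0 * f) = x * truncLinear k m x y f := by
  let g : ℕ → S := fun a => ∑ b ∈ Finset.range m,
    coeff (Finsupp.single 0 a + Finsupp.single 1 b) (X 0 * f) • (x ^ a * y ^ b)
  have h0 : g 0 = 0 := by
    refine Finset.sum_eq_zero fun b _ => ?_
    have : coeff (Finsupp.single 0 0 + Finsupp.single 1 b) (X 0 * f) = 0 :=
      X_dvd_iff.1 (Dvd.intro _ rfl) _ (by simp)
    rw [this, zero_smul]
  have hk : g k = 0 := by
    refine Finset.sum_eq_zero fun b _ => ?_
    rw [hx, zero_mul, smul_zero]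
  have hsucc : ∀ a, g (a + 1) = x * ∑ b ∈ Finset.range m,
      coeff (Finsupp.single 0 a + Finsupp.single 1 b) f • (x ^ a * y ^ b) := by
    intro a
    rw [Finset.mul_sum]
    refine Finset.sum_congr rfl fun b _ => ?_
    rw [add_comm a, Finsupp.single_add, add_assoc, X_def, coeff_add_monomial_mul, one_mul,
      mul_smul_comm, ← mul_assoc x, ← pow_succ', add_comm a]
  have h := (Finset.sum_range_succ g k).symm.trans (Finset.sum_range_succ' g k)
  rw [h0, hk, add_zero, add_zero] at h
  rw [truncLinear_apply, truncLinear_apply, Finset.mul_sum]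
  exact h.trans (Finset.sum_congr rfl fun a _ => hsucc a)

theorem truncLinear_X1_mul {k m : ℕ} {x y : S} (hxy : Commute x y) (hy : y ^ m = 0)
    (f : MvPowerSeries (Fin 2) 𝕜) :
    truncLinear k m x y (X 1 * f) = y * truncLinear k m x y f := by
  rw [truncLinear_apply, truncLinear_apply, Finset.mul_sum]
  refine Finset.sum_congr rfl fun a _ => ?_
  let g : ℕ → S := fun b =>
    coeff (Finsupp.single 0 a + Finsupp.single 1 b) (X 1 * f) • (x ^ a * y ^ b)
  have h0 : g 0 = 0 := by
    have : coeff (Finsupp.single 0 a + Finsupp.single 1 0) (X 1 * f) = 0 :=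
      X_dvd_iff.1 (Dvd.intro _ rfl) _ (by simp)
    change coeff (Finsupp.single 0 a + Finsupp.single 1 0) (X 1 * f) • _ = (0 : S)
    rw [this, zero_smul]
  have hm : g m = 0 := by
    change _ • (x ^ a * y ^ m) = 0
    rw [hy, mul_zero, smul_zero]
  have hsucc : ∀ b, g (b + 1) =
      y * (coeff (Finsupp.single 0 a + Finsupp.single 1 b) f • (x ^ a * y ^ b)) := by
    intro b
    change coeff (Finsupp.single 0 a + Finsupp.single 1 (b + 1)) (X 1 * f) • _ = _
    rw [add_comm b, Finsupp.single_add, add_left_comm, X_def, coeff_add_monomial_mul, one_mul,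
      mul_smul_comm, add_comm 1, pow_succ', ← mul_assoc, ← mul_assoc, (hxy.symm.pow_right a).eq]
  have h := (Finset.sum_range_succ g m).symm.trans (Finset.sum_range_succ' g m)
  rw [h0, hm, add_zero, add_zero] at h
  rw [Finset.mul_sum]
  exact h.trans (Finset.sum_congr rfl fun b _ => hsucc b)

theorem truncLinear_X0_pow_mul {k m : ℕ} {x y : S} (hx : x ^ k = 0) (a : ℕ)
    (f : MvPowerSeries (Fin 2) 𝕜) :
    truncLinear k m x y (X 0 ^ a * f) = x ^ a * truncLinear k m x y f := by
  induction a with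
  | zero => simp
  | succ a ih => rw [pow_succ', mul_assoc, truncLinear_X0_mul hx, ih, pow_succ', mul_assoc]

theorem truncLinear_X1_pow_mul {k m : ℕ} {x y : S} (hxy : Commute x y) (hy : y ^ m = 0) (b : ℕ)
    (f : MvPowerSeries (Fin 2) 𝕜) :
    truncLinear k m x y (X 1 ^ b * f) = y ^ b * truncLinear k m x y f := by
  induction b with
  | zero => simp
  | succ b ih => rw [pow_succ', mul_assoc, truncLinear_X1_mul hxy hy, ih, pow_succ', mul_assoc]

theorem truncLinear_one {k m : ℕ} (hk : 1 ≤ k) (hm : 1 ≤ m) {x y : S} :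
    truncLinear k m x y (1 : MvPowerSeries (Fin 2) 𝕜) = 1 := by
  classical
  rw [truncLinear_apply, Finset.sum_eq_single_of_mem 0 (Finset.mem_range.2 hk),
    Finset.sum_eq_single_of_mem 0 (Finset.mem_range.2 hm)]
  · simp
  · intro b _ hb
    rw [coeff_one, if_neg (by simpa using hb), zero_smul]
  · intro a _ ha
    refine Finset.sum_eq_zero fun b _ => ?_
    rw [coeff_one, if_neg, zero_smul]
    intro h
    have := DFunLike.congr_fun h 0
    simp at this
    exact ha this

theorem truncLinear_C_mul {k m : ℕ} {x y : S} (c : 𝕜) (f : MvPowerSeries (Fin 2) 𝕜) :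
    truncLinear k m x y (C c * f) = c • truncLinear k m x y f := by
  rw [← smul_eq_C_mul, map_smul]

theorem truncLinear_mul {k m : ℕ} {x y : S} (hxy : Commute x y)
    (hx : x ^ k = 0) (hy : y ^ m = 0) (hk : 1 ≤ k) (hm : 1 ≤ m) (f g : MvPowerSeries (Fin 2) 𝕜) :
    truncLinear k m x y (f * g) = truncLinear k m x y f * truncLinear k m x y g := by
  refine truncated_induction k m (p := fun f => truncLinear k m x y (f * g) =
    truncLinear k m x y f * truncLinear k m x y g) (fun f₁ f₂ h₁ h₂ => ?_) (fun c a b => ?_)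
    (fun f => ?_) (fun f => ?_) f
  · rw [add_mul, map_add, h₁, h₂, map_add, add_mul]
  · have h1 : truncLinear k m x y (C c * (X 0 ^ a * X 1 ^ b) * g) =
        c • (x ^ a * (y ^ b * truncLinear k m x y g)) := by
      rw [mul_assoc, truncLinear_C_mul, mul_assoc, truncLinear_X0_pow_mul hx,
        truncLinear_X1_pow_mul hxy hy]
    have h2 : truncLinear k m x y (C c * (X 0 ^ a * (X 1 ^ b * 1))) = c • (x ^ a * (y ^ b * 1)) := by
      rw [truncLinear_C_mul, truncLinear_X0_pow_mul hx, truncLinear_X1_pow_mul hxy hy,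
        truncLinear_one hk hm]
    rw [mul_one, mul_one] at h2
    rw [h1, h2, smul_mul_assoc, mul_assoc]
  · rw [mul_assoc, truncLinear_X0_pow_mul hx, truncLinear_X0_pow_mul hx, hx]; simp
  · rw [mul_assoc, truncLinear_X1_pow_mul hxy hy, truncLinear_X1_pow_mul hxy hy, hy]; simp

/-- Evaluation of a power series at two commuting nilpotent elements. -/
noncomputable def truncHom {k m : ℕ} {x y : S} (hxy : Commute x y)
    (hx : x ^ k = 0) (hy : y ^ m = 0) (hk : 1 ≤ k) (hm : 1 ≤ m) :
    MvPowerSeries (Fin 2) 𝕜 →+* S where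
  toFun := truncLinear k m x y
  map_one' := truncLinear_one hk hm
  map_mul' := truncLinear_mul hxy hx hy hk hm
  map_zero' := map_zero _
  map_add' := map_add _

variable {k m : ℕ} {x y : S} (hxy : Commute x y) (hx : x ^ k = 0) (hy : y ^ m = 0)
  (hk : 1 ≤ k) (hm : 1 ≤ m)

theorem truncHom_X0 : truncHom (𝕜 := 𝕜) hxy hx hy hk hm (X 0) = x := by
  change truncLinear k m x y _ = x
  rw [← mul_one (X 0), truncLinear_X0_mul hx, truncLinear_one hk hm, mul_one]

theorem truncHom_X1 : truncHom (𝕜 := 𝕜) hxy hx hy hk hm (X 1) = y := by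
  change truncLinear k m x y _ = y
  rw [← mul_one (X 1), truncLinear_X1_mul hxy hy, truncLinear_one hk hm, mul_one]

theorem truncHom_C (c : 𝕜) : truncHom hxy hx hy hk hm (C c) = algebraMap 𝕜 S c := by
  change truncLinear k m x y _ = _
  rw [← mul_one (C c), truncLinear_C_mul, truncLinear_one hk hm, Algebra.algebraMap_eq_smul_one]

end Truncation

/-! ### The homomorphism `A → B` and its composition with `B → A / (e_n)`. -/

section Comparison

variable (𝕜 : Type u) [Field 𝕜] (n k : ℕ)

/-- The quotient map from the free algebra to `B`. -/
noncomputable def freeToB : FreeAlgebra 𝕜 Gen →ₐ[𝕜] B 𝕜 n k :=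
  (PreprojToB 𝕜 n k).comp (freeToPreproj 𝕜 n)

/-- The images of the generators in `B`. -/
noncomputable def genB (s : Gen) : B 𝕜 n k := freeToB 𝕜 n k (gen 𝕜 s)

noncomputable def xB : B 𝕜 n k := ∑ a ∈ Finset.Icc 2 (n - 1), genB 𝕜 n k (.x a)

noncomputable def yB : B 𝕜 n k := ∑ a ∈ Finset.Icc 2 (n - 1), genB 𝕜 n k (.y a)

variable {𝕜 n k}

theorem PreprojToB_toPreproj (s : Gen) :
    PreprojToB 𝕜 n k (toPreproj 𝕜 n s) = genB 𝕜 n k s := rfl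

theorem PreprojToB_surjective : Function.Surjective (PreprojToB 𝕜 n k) :=
  RingQuot.mkAlgHom_surjective 𝕜 _

theorem freeToB_surjective : Function.Surjective (freeToB 𝕜 n k) :=
  PreprojToB_surjective.comp (RingQuot.mkAlgHom_surjective 𝕜 _)

theorem freeToB_rel {a b : FreeAlgebra 𝕜 Gen} (h : PreprojRel 𝕜 n a b) :
    freeToB 𝕜 n k a = freeToB 𝕜 n k b :=
  congrArg (PreprojToB 𝕜 n k) (RingQuot.mkAlgHom_rel 𝕜 h)

theorem xB_pow : xB 𝕜 n k ^ k = 0 := by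
  have := RingQuot.mkAlgHom_rel 𝕜 (BRel.x_pow (𝕜 := 𝕜) (n := n) (k := k))
  rw [map_zero, map_pow, xP, map_sum] at this
  exact this

theorem yB_pow : yB 𝕜 n k ^ (n - k) = 0 := by
  have := RingQuot.mkAlgHom_rel 𝕜 (BRel.y_pow (𝕜 := 𝕜) (n := n) (k := k))
  rw [map_zero, map_pow, yP, map_sum] at this
  exact this

theorem xB_comm_yB : Commute (xB 𝕜 n k) (yB 𝕜 n k) := by
  have := freeToB_rel (k := k) (PreprojRel.comm (𝕜 := 𝕜) (n := n))
  simp only [map_mul, map_sum] at this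
  exact this

theorem genB_e_mul_self (j : ℕ) : genB 𝕜 n k (.e j) * genB 𝕜 n k (.e j) = genB 𝕜 n k (.e j) := by
  rw [genB, ← map_mul]
  exact freeToB_rel (.e_idem j)

theorem genB_e_mul_of_ne {i j : ℕ} (h : i ≠ j) :
    genB 𝕜 n k (.e i) * genB 𝕜 n k (.e j) = 0 := by
  rw [genB, genB, ← map_mul, freeToB_rel (.e_orth i j h), map_zero]

theorem genB_e_sum : ∑ j ∈ Finset.Icc 1 (n - 1), genB 𝕜 n k (.e j) = 1 := by
  have := freeToB_rel (k := k) (PreprojRel.e_sum (𝕜 := 𝕜) (n := n))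
  rwa [map_sum, map_one] at this

theorem genB_e_eq_zero {j : ℕ} (h : j ∉ Finset.Icc 1 (n - 1)) : genB 𝕜 n k (.e j) = 0 := by
  rw [genB, freeToB_rel (.e_outside j h), map_zero]

theorem e_mul_genB_x (a : ℕ) : genB 𝕜 n k (.e a) * genB 𝕜 n k (.x a) = genB 𝕜 n k (.x a) := by
  rw [genB, genB, ← map_mul]
  exact freeToB_rel (.x_target a)

theorem genB_x_mul_e (a : ℕ) : genB 𝕜 n k (.x a) * genB 𝕜 n k (.e (a - 1)) =
    genB 𝕜 n k (.x a) := by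
  rw [genB, genB, ← map_mul]
  exact freeToB_rel (.x_source a)

theorem e_mul_genB_y (a : ℕ) : genB 𝕜 n k (.e (a - 1)) * genB 𝕜 n k (.y a) =
    genB 𝕜 n k (.y a) := by
  rw [genB, genB, ← map_mul]
  exact freeToB_rel (.y_target a)

theorem genB_y_mul_e (a : ℕ) : genB 𝕜 n k (.y a) * genB 𝕜 n k (.e a) = genB 𝕜 n k (.y a) := by
  rw [genB, genB, ← map_mul]
  exact freeToB_rel (.y_source a)

/-- The image of `g ∈ G` in `B`. -/
noncomputable def groupToB : G 𝕜 n →* B 𝕜 n k where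
  toFun g := ∑ j ∈ Finset.Icc 1 (n - 1), (G.toUnits 𝕜 n g : 𝕜) ^ j • genB 𝕜 n k (.e j)
  map_one' := by simp [genB_e_sum]
  map_mul' g h := by
    rw [Finset.sum_mul_sum]
    refine Finset.sum_congr rfl fun i hi => ?_
    rw [Finset.sum_eq_single_of_mem i hi]
    · rw [smul_mul_smul_comm, genB_e_mul_self, map_mul, Units.val_mul, mul_pow]
    · intro j _ hji
      rw [smul_mul_smul_comm, genB_e_mul_of_ne hji.symm, smul_zero]

theorem groupToB_mul_e (g : G 𝕜 n) (j : ℕ) :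
    groupToB (k := k) g * genB 𝕜 n k (.e j) = (G.toUnits 𝕜 n g : 𝕜) ^ j • genB 𝕜 n k (.e j) := by
  by_cases hj : j ∈ Finset.Icc 1 (n - 1)
  · change (∑ j ∈ Finset.Icc 1 (n - 1), _) * _ = _
    rw [Finset.sum_mul, Finset.sum_eq_single_of_mem j hj, smul_mul_assoc, genB_e_mul_self]
    intro i _ hij
    rw [smul_mul_assoc, genB_e_mul_of_ne hij, smul_zero]
  · rw [genB_e_eq_zero hj, mul_zero, smul_zero]

theorem e_mul_groupToB (g : G 𝕜 n) (j : ℕ) :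
    genB 𝕜 n k (.e j) * groupToB (k := k) g = (G.toUnits 𝕜 n g : 𝕜) ^ j • genB 𝕜 n k (.e j) := by
  by_cases hj : j ∈ Finset.Icc 1 (n - 1)
  · change _ * (∑ j ∈ Finset.Icc 1 (n - 1), _) = _
    rw [Finset.mul_sum, Finset.sum_eq_single_of_mem j hj, mul_smul_comm, genB_e_mul_self]
    intro i _ hij
    rw [mul_smul_comm, genB_e_mul_of_ne hij.symm, smul_zero]
  · rw [genB_e_eq_zero hj, zero_mul, smul_zero]

theorem groupToB_mul_xB (g : G 𝕜 n) :
    groupToB g * xB 𝕜 n k = (G.toUnits 𝕜 n g : 𝕜) • (xB 𝕜 n k * groupToB g) := by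
  rw [xB, Finset.mul_sum, Finset.sum_mul, Finset.smul_sum]
  refine Finset.sum_congr rfl fun a ha => ?_
  rw [Finset.mem_Icc] at ha
  conv_lhs => rw [← e_mul_genB_x, ← mul_assoc, groupToB_mul_e, smul_mul_assoc, e_mul_genB_x]
  conv_rhs => rw [← genB_x_mul_e, mul_assoc, e_mul_groupToB, mul_smul_comm, genB_x_mul_e,
    smul_smul, ← pow_succ', Nat.sub_add_cancel (by omega)]

theorem groupToB_mul_yB (g : G 𝕜 n) :
    (G.toUnits 𝕜 n g : 𝕜) • (groupToB g * yB 𝕜 n k) = yB 𝕜 n k * groupToB g := by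
  rw [yB, Finset.mul_sum, Finset.sum_mul, Finset.smul_sum]
  refine Finset.sum_congr rfl fun a ha => ?_
  rw [Finset.mem_Icc] at ha
  conv_lhs => rw [← e_mul_genB_y, ← mul_assoc, groupToB_mul_e, smul_mul_assoc, e_mul_genB_y,
    smul_smul, ← pow_succ', Nat.sub_add_cancel (by omega)]
  conv_rhs => rw [← genB_y_mul_e, mul_assoc, e_mul_groupToB, mul_smul_comm, genB_y_mul_e]

variable [hkn : Fact (k < n)] [hk : Fact (1 ≤ k)]

variable (𝕜 n k) in
noncomputable def powerSeriesToB : MvPowerSeries (Fin 2) 𝕜 →+* B 𝕜 n k :=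
  truncHom xB_comm_yB xB_pow yB_pow hk.out (by have := hkn.out; omega)

theorem powerSeriesToB_X0 : powerSeriesToB 𝕜 n k (MvPowerSeries.X 0) = xB 𝕜 n k :=
  truncHom_X0 _ _ _ _ _

theorem powerSeriesToB_X1 : powerSeriesToB 𝕜 n k (MvPowerSeries.X 1) = yB 𝕜 n k :=
  truncHom_X1 _ _ _ _ _

theorem powerSeriesToB_C (c : 𝕜) :
    powerSeriesToB 𝕜 n k (MvPowerSeries.C c) = algebraMap 𝕜 _ c :=
  truncHom_C _ _ _ _ _ c

variable (𝕜 n k) in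
noncomputable def RtoB : R 𝕜 n k →+* B 𝕜 n k :=
  Ideal.Quotient.lift _ (powerSeriesToB 𝕜 n k) fun f hf => by
    rw [curveIdeal, Ideal.mem_span_singleton] at hf
    obtain ⟨g, rfl⟩ := hf
    rw [map_mul, map_sub, map_pow, map_pow, powerSeriesToB_X0, powerSeriesToB_X1, xB_pow, yB_pow,
      sub_zero, zero_mul]

theorem RtoB_mk (f : MvPowerSeries (Fin 2) 𝕜) :
    RtoB 𝕜 n k (Ideal.Quotient.mk _ f) = powerSeriesToB 𝕜 n k f := rfl

/-- This is the twisted commutation rule needed to define a homomorphism on `R * G`. It is checked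
on monomials; multiples of `x ^ k` and `y ^ (n - k)` give zero on both sides. -/
theorem powerSeriesToB_rescaleXY (g : G 𝕜 n) (f : MvPowerSeries (Fin 2) 𝕜) :
    powerSeriesToB 𝕜 n k (rescaleXY 𝕜 (G.toUnits 𝕜 n g) f) * groupToB g =
      groupToB g * powerSeriesToB 𝕜 n k f := by
  have hX0 : powerSeriesToB 𝕜 n k (rescaleXY 𝕜 (G.toUnits 𝕜 n g) (MvPowerSeries.X 0)) =
      (G.toUnits 𝕜 n g : 𝕜) • xB 𝕜 n k := by
    rw [rescaleXY_X0, map_mul, powerSeriesToB_X0, powerSeriesToB_C, Algebra.smul_def]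
  have hX1 : powerSeriesToB 𝕜 n k (rescaleXY 𝕜 (G.toUnits 𝕜 n g) (MvPowerSeries.X 1)) =
      (((G.toUnits 𝕜 n g)⁻¹ : 𝕜ˣ) : 𝕜) • yB 𝕜 n k := by
    rw [rescaleXY_X1, map_mul, powerSeriesToB_X1, powerSeriesToB_C, Algebra.smul_def]
  have hC : ∀ c, powerSeriesToB 𝕜 n k (rescaleXY 𝕜 (G.toUnits 𝕜 n g) (MvPowerSeries.C c)) =
      algebraMap 𝕜 _ c := fun c => by
    rw [← substXY_C, rescaleXY_substXY, substXY_C, powerSeriesToB_C]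
  have hx : ∀ b, (G.toUnits 𝕜 n g : 𝕜) • xB 𝕜 n k * (groupToB g * b) =
      groupToB g * (xB 𝕜 n k * b) := fun b => by
    rw [← mul_assoc, ← mul_assoc, groupToB_mul_xB, smul_mul_assoc]
  have hy : ∀ b, (((G.toUnits 𝕜 n g)⁻¹ : 𝕜ˣ) : 𝕜) • yB 𝕜 n k * (groupToB g * b) =
      groupToB g * (yB 𝕜 n k * b) := fun b => by
    rw [← mul_assoc, ← mul_assoc, smul_mul_assoc, ← groupToB_mul_yB, smul_smul, Units.inv_mul,
      one_smul]
  have hxr : ∀ (a : ℕ) b, ((G.toUnits 𝕜 n g : 𝕜) • xB 𝕜 n k) ^ a * (groupToB g * b) =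
      groupToB g * (xB 𝕜 n k ^ a * b) := fun a => by
    induction a with
    | zero => simp
    | succ a ih => intro b; rw [pow_succ', mul_assoc, ih, hx, pow_succ', mul_assoc]
  have hyr : ∀ (a : ℕ) b, ((((G.toUnits 𝕜 n g)⁻¹ : 𝕜ˣ) : 𝕜) • yB 𝕜 n k) ^ a * (groupToB g * b) =
      groupToB g * (yB 𝕜 n k ^ a * b) := fun a => by
    induction a with
    | zero => simp
    | succ a ih => intro b; rw [pow_succ', mul_assoc, ih, hy, pow_succ', mul_assoc]
  refine truncated_induction k (n - k) (p := fun f => powerSeriesToB 𝕜 n k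
    (rescaleXY 𝕜 (G.toUnits 𝕜 n g) f) * groupToB g = groupToB g * powerSeriesToB 𝕜 n k f)
    (fun f₁ f₂ h₁ h₂ => ?_) (fun c a b => ?_) (fun f => ?_) (fun f => ?_) f
  · simp only [map_add, add_mul, mul_add, h₁, h₂]
  · have := hyr b 1
    rw [mul_one, mul_one] at this
    simp only [map_mul, map_pow, hX0, hX1, hC, powerSeriesToB_X0, powerSeriesToB_X1,
      powerSeriesToB_C, mul_assoc, this, hxr]
    rw [← Algebra.smul_def, ← Algebra.smul_def, mul_smul_comm]
  · simp only [map_mul, map_pow, hX0, powerSeriesToB_X0, smul_pow, xB_pow, smul_zero,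
      zero_mul, mul_zero]
  · simp only [map_mul, map_pow, hX1, powerSeriesToB_X1, smul_pow, yB_pow, smul_zero,
      zero_mul, mul_zero]

variable (𝕜 n k) in
/-- The homomorphism `A → B`. -/
noncomputable def AtoB : A 𝕜 n k →+* B 𝕜 n k :=
  SkewMonoidAlgebra.liftNCRingHom (RtoB 𝕜 n k) groupToB fun {r g} => by
    obtain ⟨f, rfl⟩ := Ideal.Quotient.mk_surjective r
    exact powerSeriesToB_rescaleXY g f

theorem AtoB_sgl (g : G 𝕜 n) (r : R 𝕜 n k) :
    AtoB 𝕜 n k (sgl 𝕜 n k g r) = RtoB 𝕜 n k r * groupToB g :=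
  SkewMonoidAlgebra.liftNC_single _ _ _ _

theorem AtoB_RtoA (r : R 𝕜 n k) : AtoB 𝕜 n k (RtoA 𝕜 n k r) = RtoB 𝕜 n k r := by
  rw [RtoA_apply, AtoB_sgl, map_one, mul_one]

theorem AtoB_xA : AtoB 𝕜 n k (xA 𝕜 n k) = xB 𝕜 n k := by
  rw [xA, AtoB_RtoA, RtoB_mk, powerSeriesToB_X0]

theorem AtoB_yA : AtoB 𝕜 n k (yA 𝕜 n k) = yB 𝕜 n k := by
  rw [yA, AtoB_RtoA, RtoB_mk, powerSeriesToB_X1]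

theorem AtoB_ZtoA_C (c : 𝕜) : AtoB 𝕜 n k (ZtoA 𝕜 n k (PowerSeries.C c)) = algebraMap 𝕜 _ c := by
  rw [ZtoA_apply, substXY_C, AtoB_RtoA, RtoB_mk, powerSeriesToB_C]

variable [NeZero n] [HasEnoughRootsOfUnity 𝕜 n]

/-- Insert the group element given by a primitive root `ζ` between the two factors. It acts as `ζ ^
j` on the left one and as `ζ ^ i` on the right one, and these scalars differ. -/
theorem e_mul_AtoB_E {i : ZMod n} {j : ℕ} (hj : j < n) (hij : i ≠ j) :
    genB 𝕜 n k (.e j) * AtoB 𝕜 n k (E 𝕜 n k i) = 0 := by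
  obtain ⟨ζ, hζ⟩ := HasEnoughRootsOfUnity.exists_primitiveRoot 𝕜 n
  have hζu := hζ.isUnit_unit (NeZero.ne n)
  set z := (hζ.isUnit (NeZero.ne n)).unit with hz
  have hzm : z ∈ rootsOfUnity n 𝕜 := by
    rw [mem_rootsOfUnity]; exact hζu.pow_eq_one
  let g : G 𝕜 n := (⟨z, hzm⟩ : rootsOfUnity n 𝕜)
  have hg : (G.toUnits 𝕜 n g : 𝕜) = ζ := rfl
  have h1 := congrArg (AtoB 𝕜 n k) (sgl_mul_eA (k := k) g 1 i.val)
  rw [map_one, one_mul, map_mul, AtoB_sgl, map_one, one_mul, smul_eq_ZtoA_mul, map_mul,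
    AtoB_ZtoA_C, ← Algebra.smul_def] at h1
  have h2 := congrArg (genB 𝕜 n k (.e j) * ·) h1
  beta_reduce at h2
  rw [← mul_assoc, e_mul_groupToB, smul_mul_assoc, mul_smul_comm, ← sub_eq_zero, ← sub_smul, hg]
    at h2
  refine (smul_eq_zero.1 h2).resolve_left fun h3 => hij ?_
  have := hζ.pow_inj hj (ZMod.val_lt i) (sub_eq_zero.1 h3)
  rw [this, ZMod.natCast_zmod_val]

theorem AtoB_E_zero : AtoB 𝕜 n k (E 𝕜 n k 0) = 0 := by
  rw [← one_mul (AtoB 𝕜 n k _), ← genB_e_sum, Finset.sum_mul]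
  refine Finset.sum_eq_zero fun j hj => ?_
  rw [Finset.mem_Icc] at hj
  have hn := NeZero.pos n
  refine e_mul_AtoB_E (by omega) fun h => ?_
  have := natCast_eq_zero_of_lt (n := n) (r := j) (by omega) h.symm
  omega

theorem AtoB_E {j : ℕ} (hj : j ∈ Finset.Icc 1 (n - 1)) :
    AtoB 𝕜 n k (E 𝕜 n k j) = genB 𝕜 n k (.e j) := by
  have hn := NeZero.pos n
  have h1 : genB 𝕜 n k (.e j) * AtoB 𝕜 n k (E 𝕜 n k j) = genB 𝕜 n k (.e j) := by
    conv_rhs => rw [← mul_one (genB 𝕜 n k _), ← map_one (AtoB 𝕜 n k), ← E_sum, map_sum,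
      Finset.mul_sum]
    rw [Finset.sum_eq_single_of_mem (j : ZMod n) (Finset.mem_univ _)]
    intro i _ hi
    exact e_mul_AtoB_E (by rw [Finset.mem_Icc] at hj; omega) hi
  rw [← h1]
  conv_lhs => rw [← one_mul (AtoB 𝕜 n k _), ← genB_e_sum, Finset.sum_mul]
  rw [Finset.sum_eq_single_of_mem j hj]
  intro i hi hij
  rw [Finset.mem_Icc] at hi hj
  exact e_mul_AtoB_E (by omega) fun h => hij (natCast_inj_of_lt (by omega) (by omega) h.symm)

/-- The arrows are recovered as `x_a = e_a x` and `y_a = y e_a`. Surjectivity is what allows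
`B`-modules and their submodules, homomorphisms and finiteness to be handled through the action of
`A`. -/
theorem AtoB_surjective : Function.Surjective (AtoB 𝕜 n k) := by
  have he : ∀ j, ∃ a, AtoB 𝕜 n k a = genB 𝕜 n k (.e j) := fun j => by
    by_cases hj : j ∈ Finset.Icc 1 (n - 1)
    · exact ⟨_, AtoB_E hj⟩
    · exact ⟨0, by rw [map_zero, genB_e_eq_zero hj]⟩
  intro b
  obtain ⟨f, rfl⟩ := freeToB_surjective b
  induction f using FreeAlgebra.induction with
  | grade0 c => exact ⟨_, (AtoB_ZtoA_C c).trans ((freeToB 𝕜 n k).commutes c).symm⟩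
  | grade1 s =>
    match s with
    | .e j => exact he j
    | .x a =>
      change ∃ b, _ = genB 𝕜 n k (.x a)
      by_cases ha : a ∈ Finset.Icc 2 (n - 1)
      · obtain ⟨c, hc⟩ := he a
        refine ⟨c * xA 𝕜 n k, ?_⟩
        rw [map_mul, hc, AtoB_xA, xB, Finset.mul_sum, Finset.sum_eq_single_of_mem a ha,
          e_mul_genB_x]
        intro b _ hb
        rw [← e_mul_genB_x, ← mul_assoc, genB_e_mul_of_ne hb.symm, zero_mul]
      · refine ⟨0, ?_⟩
        rw [Finset.mem_Icc] at ha
        rw [map_zero]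
        by_cases ha' : a < 2
        · rw [← genB_x_mul_e, genB_e_eq_zero, mul_zero]
          rw [Finset.mem_Icc]
          omega
        · rw [← e_mul_genB_x, genB_e_eq_zero, zero_mul]
          rw [Finset.mem_Icc]
          omega
    | .y a =>
      change ∃ b, _ = genB 𝕜 n k (.y a)
      by_cases ha : a ∈ Finset.Icc 2 (n - 1)
      · obtain ⟨c, hc⟩ := he a
        refine ⟨yA 𝕜 n k * c, ?_⟩
        rw [map_mul, hc, AtoB_yA, yB, Finset.sum_mul, Finset.sum_eq_single_of_mem a ha,
          genB_y_mul_e]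
        intro b _ hb
        rw [← genB_y_mul_e, mul_assoc, genB_e_mul_of_ne hb, mul_zero]
      · refine ⟨0, ?_⟩
        rw [Finset.mem_Icc] at ha
        rw [map_zero]
        by_cases ha' : a < 2
        · rw [← e_mul_genB_y, genB_e_eq_zero, zero_mul]
          rw [Finset.mem_Icc]
          omega
        · rw [← genB_y_mul_e, genB_e_eq_zero, mul_zero]
          rw [Finset.mem_Icc]
          omega
  | mul a b ha hb =>
    obtain ⟨a', ha⟩ := ha
    obtain ⟨b', hb⟩ := hb
    exact ⟨a' * b', by rw [map_mul, map_mul, ha, hb]⟩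
  | add a b ha hb =>
    obtain ⟨a', ha⟩ := ha
    obtain ⟨b', hb⟩ := hb
    exact ⟨a' + b', by rw [map_add, map_add, ha, hb]⟩

theorem BToQuot_genB (s : Gen) : BToQuot 𝕜 n k (genB 𝕜 n k s) = genBar 𝕜 n k s :=
  (RingQuot.liftAlgHom_mkAlgHom_apply 𝕜 _ _ _).trans (PreprojToQuot_toPreproj 𝕜 n k s)

theorem BToQuot_xB : BToQuot 𝕜 n k (xB 𝕜 n k) = Ideal.Quotient.mk _ (xA 𝕜 n k) := by
  rw [xB, map_sum]
  simp only [BToQuot_genB]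
  exact sum_genBar_x 𝕜 n k

theorem BToQuot_yB : BToQuot 𝕜 n k (yB 𝕜 n k) = Ideal.Quotient.mk _ (yA 𝕜 n k) := by
  rw [yB, map_sum]
  simp only [BToQuot_genB]
  exact sum_genBar_y 𝕜 n k

theorem BToQuot_groupToB (g : G 𝕜 n) :
    BToQuot 𝕜 n k (groupToB g) = Ideal.Quotient.mk _ (sgl 𝕜 n k g 1) := by
  have h := congrArg (Ideal.Quotient.mk (idealEn 𝕜 n k)) (mul_one (sgl 𝕜 n k g 1))
  rw [← eA_sum, Finset.mul_sum, map_sum] at h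
  rw [← h]
  have hn : Finset.Icc 1 n = insert n (Finset.Icc 1 (n - 1)) := by
    have := NeZero.pos n
    ext j
    simp only [Finset.mem_Icc, Finset.mem_insert]
    omega
  have hn' : n ∉ Finset.Icc 1 (n - 1) := by
    have := NeZero.pos n
    simp only [Finset.mem_Icc]
    omega
  rw [hn, Finset.sum_insert hn', map_mul, mk_eA_n, mul_zero, zero_add]
  change BToQuot 𝕜 n k (∑ j ∈ Finset.Icc 1 (n - 1), _) = _
  rw [map_sum]
  refine Finset.sum_congr rfl fun j hj => ?_
  have h1 := sgl_mul_eA (k := k) g 1 j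
  rw [map_one, one_mul] at h1
  rw [h1, map_smul, BToQuot_genB, genBar, eBar, if_pos hj]
  rfl

/-- The composition `A → B → A / (e_n)` is the quotient map. -/
theorem BToQuot_AtoB (a : A 𝕜 n k) :
    BToQuot 𝕜 n k (AtoB 𝕜 n k a) = Ideal.Quotient.mk (idealEn 𝕜 n k) a := by
  have hC : ∀ c : 𝕜, (Ideal.Quotient.mk (idealEn 𝕜 n k)) (RtoA 𝕜 n k (Ideal.Quotient.mk _
      (MvPowerSeries.C c))) = algebraMap 𝕜 _ c := fun c => by
    have h1 := smul_eq_ZtoA_mul (n := n) (k := k) c 1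
    rw [mul_one, ZtoA_apply, substXY_C] at h1
    rw [← h1, Algebra.algebraMap_eq_smul_one]
    rfl
  have hxm : (Ideal.Quotient.mk (idealEn 𝕜 n k)) (xA 𝕜 n k ^ k) = 0 :=
    Ideal.Quotient.eq_zero_iff_mem.2 xA_pow_mem
  have hym : (Ideal.Quotient.mk (idealEn 𝕜 n k)) (yA 𝕜 n k ^ (n - k)) = 0 := by
    rw [← xA_pow_eq, hxm]
  have hR : ∀ f, BToQuot 𝕜 n k (powerSeriesToB 𝕜 n k f) = Ideal.Quotient.mk (idealEn 𝕜 n k)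
      (RtoA 𝕜 n k (Ideal.Quotient.mk _ f)) := by
    refine truncated_induction k (n - k) (fun f₁ f₂ h₁ h₂ => ?_) (fun c a b => ?_) (fun f => ?_)
      (fun f => ?_)
    · simp only [map_add, h₁, h₂]
    · simp only [map_mul, map_pow, powerSeriesToB_X0, powerSeriesToB_X1, powerSeriesToB_C,
        BToQuot_xB, BToQuot_yB, hC, AlgHom.commutes]
      rfl
    · simp only [map_mul, map_pow, powerSeriesToB_X0, xB_pow, map_zero, zero_mul]
      change 0 = (Ideal.Quotient.mk (idealEn 𝕜 n k)) (xA 𝕜 n k) ^ k * _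
      rw [← map_pow, hxm, zero_mul]
    · simp only [map_mul, map_pow, powerSeriesToB_X1, yB_pow, map_zero, zero_mul]
      change 0 = (Ideal.Quotient.mk (idealEn 𝕜 n k)) (yA 𝕜 n k) ^ (n - k) * _
      rw [← map_pow, hym, zero_mul]
  let S : AddSubgroup (A 𝕜 n k) :=
    { carrier := {a | BToQuot 𝕜 n k (AtoB 𝕜 n k a) = Ideal.Quotient.mk (idealEn 𝕜 n k) a}
      zero_mem' := by simp
      add_mem' := fun {a b} (ha : _ = _) (hb : _ = _) => show _ = _ by
        rw [map_add, map_add, map_add, ha, hb]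
      neg_mem' := fun {a} (ha : _ = _) => show _ = _ by rw [map_neg, map_neg, map_neg, ha] }
  refine A_addSubgroup_eq_top (S := S) (fun g r => ?_) a
  change BToQuot 𝕜 n k (AtoB 𝕜 n k (sgl 𝕜 n k g r)) = _
  obtain ⟨f, rfl⟩ := Ideal.Quotient.mk_surjective r
  rw [AtoB_sgl, RtoB_mk, map_mul, BToQuot_groupToB, hR, ← map_mul, ← sgl_eq]

end Comparison

end GrassmannianCM

/-! ### The socle condition in terms of paths to the vertex `k`. -/

namespace GrassmannianCM

theorem finite_of_forall_exists_smul {R S N : Type*} [Ring R] [Ring S] [AddCommGroup N] [Module R N]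
    [Module S N] (h : ∀ r : R, ∃ s : S, ∀ m : N, r • m = s • m) [hN : Module.Finite R N] :
    Module.Finite S N := by
  obtain ⟨F, hF⟩ := hN.fg_top
  refine ⟨⟨F, ?_⟩⟩
  rw [eq_top_iff]
  intro m _
  have hm : m ∈ Submodule.span R (F : Set N) := hF ▸ Submodule.mem_top
  induction hm using Submodule.span_induction with
  | mem x hx => exact Submodule.subset_span hx
  | zero => exact zero_mem _
  | add x y _ _ hx hy => exact add_mem (hx trivial) (hy trivial)
  | smul r x _ hx =>
    obtain ⟨s, hs⟩ := h r
    rw [hs]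
    exact Submodule.smul_mem _ _ (hx trivial)

section SubQ

variable {𝕜 : Type u} [Field 𝕜] {n k : ℕ} [Fact (k < n)] [hk : Fact (1 ≤ k)] [NeZero n]
  [HasEnoughRootsOfUnity 𝕜 n]

local notation "𝐱" => xA 𝕜 n k
local notation "𝐲" => yA 𝕜 n k
local notation "𝐭" => tA 𝕜 n k
local notation "𝐞" => E 𝕜 n k
local notation "𝐳" => ZtoA 𝕜 n k

variable (𝕜 n k) in
/-- The modules in `Sub Q_k`, described in terms of the action of `A`. -/
structure IsSubQ (N : Type u) [AddCommGroup N] [Module (A 𝕜 n k) N] : Prop where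
  finite : Module.Finite (A 𝕜 n k) N
  E_zero_smul : ∀ m : N, 𝐞 0 • m = 0
  eq_zero : ∀ (a : ZMod n) (m : N), 𝐞 a • m = m → toK 𝕜 n k a • m = 0 → m = 0

/-- Moving `x` across only shifts the vertex idempotents. Hence `x S` is a submodule whenever `S`
is. -/
theorem exists_mul_xA (a : A 𝕜 n k) : ∃ b, a * 𝐱 = 𝐱 * b := by
  induction a using A_induction with
  | add a b ha hb =>
    obtain ⟨c, hc⟩ := ha
    obtain ⟨d, hd⟩ := hb
    exact ⟨c + d, by rw [add_mul, hc, hd, mul_add]⟩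
  | x c r hr i =>
    refine ⟨𝐳 c * (𝐱 ^ r * 𝐞 (i - 1)), ?_⟩
    rw [← mul_assoc 𝐱, ← ZtoA_mul_comm, mul_assoc, mul_assoc, mul_assoc, ← mul_assoc 𝐱 (𝐱 ^ r),
      ← pow_succ', pow_succ, mul_assoc, xA_mul_E, sub_add_cancel]
  | y c r hr i =>
    refine ⟨𝐳 c * (𝐲 ^ r * 𝐞 (i - 1)), ?_⟩
    rw [← mul_assoc 𝐱, ← ZtoA_mul_comm, mul_assoc, mul_assoc, mul_assoc, ← mul_assoc 𝐱 (𝐲 ^ r),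
      ((show Commute 𝐱 𝐲 from xA_comm_yA).pow_right r).eq, mul_assoc, xA_mul_E, sub_add_cancel]

theorem exists_mul_yA (a : A 𝕜 n k) : ∃ b, a * 𝐲 = 𝐲 * b := by
  induction a using A_induction with
  | add a b ha hb =>
    obtain ⟨c, hc⟩ := ha
    obtain ⟨d, hd⟩ := hb
    exact ⟨c + d, by rw [add_mul, hc, hd, mul_add]⟩
  | x c r hr i =>
    refine ⟨𝐳 c * (𝐱 ^ r * 𝐞 (i + 1)), ?_⟩
    rw [← mul_assoc 𝐲, ← ZtoA_mul_comm, mul_assoc, mul_assoc, mul_assoc, ← mul_assoc 𝐲 (𝐱 ^ r),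
      ((show Commute 𝐲 𝐱 from xA_comm_yA.symm).pow_right r).eq, mul_assoc, yA_mul_E,
      add_sub_cancel_right]
  | y c r hr i =>
    refine ⟨𝐳 c * (𝐲 ^ r * 𝐞 (i + 1)), ?_⟩
    rw [← mul_assoc 𝐲, ← ZtoA_mul_comm, mul_assoc, mul_assoc, mul_assoc, ← mul_assoc 𝐲 (𝐲 ^ r),
      ← pow_succ', pow_succ, mul_assoc, yA_mul_E, add_sub_cancel_right]

/-- On an element at a single vertex that is killed by `x` and `y`, `A` acts by scalars. -/
theorem exists_scalar {N : Type u} [AddCommGroup N] [Module (A 𝕜 n k) N] {j : ZMod n} {m : N}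
    (he : 𝐞 j • m = m) (hx : 𝐱 • m = 0) (hy : 𝐲 • m = 0) (a : A 𝕜 n k) :
    ∃ c : 𝕜, a • m = 𝐳 (PowerSeries.C c) • m := by
  have hz : ∀ c, ∃ d : 𝕜, 𝐳 c • m = 𝐳 (PowerSeries.C d) • m := fun c => by
    refine ⟨PowerSeries.constantCoeff c, ?_⟩
    conv_lhs => rw [PowerSeries.eq_X_mul_shift_add_const c, map_add, map_mul, ZtoA_X,
      tA_mul_comm, add_smul, mul_smul, tA, mul_smul, hy]
    simp
  have h0 : (0 : N) = 𝐳 (PowerSeries.C 0) • m := by simp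
  have hpow : ∀ (b : A 𝕜 n k), b • m = 0 → ∀ c (r : ℕ) i,
      ∃ d : 𝕜, (𝐳 c * (b ^ r * 𝐞 i)) • m = 𝐳 (PowerSeries.C d) • m := by
    intro b hb c r i
    by_cases hi : i = j
    · subst hi
      cases r with
      | zero => rw [pow_zero, one_mul, mul_smul, he]; exact hz c
      | succ r =>
        refine ⟨0, ?_⟩
        rw [mul_smul, mul_smul, he, pow_succ, mul_smul, hb, smul_zero, smul_zero, h0]
    · refine ⟨0, ?_⟩
      rw [mul_smul, mul_smul, E_smul_of_ne hi he, smul_zero, smul_zero, h0]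
  induction a using A_induction with
  | add a b ha hb =>
    obtain ⟨c, hc⟩ := ha
    obtain ⟨d, hd⟩ := hb
    exact ⟨c + d, by rw [add_smul, hc, hd, map_add, map_add, add_smul]⟩
  | x c r hr i => exact hpow _ hx c r i
  | y c r hr i => exact hpow _ hy c r i

variable {N : Type u} [AddCommGroup N] [Module (Preproj 𝕜 n) N] [Module (B 𝕜 n k) N]
  [Module (A 𝕜 n k) N]

section

variable (hP : ∀ (p : Preproj 𝕜 n) (m : N), p • m = PreprojToB 𝕜 n k p • m)
  (hA : ∀ (a : A 𝕜 n k) (m : N), a • m = AtoB 𝕜 n k a • m)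

include hP hA

theorem exists_Preproj_smul (a : A 𝕜 n k) : ∃ p : Preproj 𝕜 n, ∀ m : N, a • m = p • m := by
  obtain ⟨p, hp⟩ := PreprojToB_surjective (AtoB 𝕜 n k a)
  exact ⟨p, fun m => by rw [hA, hP, hp]⟩

theorem exists_A_smul (p : Preproj 𝕜 n) : ∃ a : A 𝕜 n k, ∀ m : N, p • m = a • m := by
  obtain ⟨a, ha⟩ := AtoB_surjective (PreprojToB 𝕜 n k p)
  exact ⟨a, fun m => by rw [hA, hP, ha]⟩

theorem toPreproj_e_smul {j : ℕ} (hj : j < n) (m : N) :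
    toPreproj 𝕜 n (.e j) • m = 𝐞 j • m := by
  rw [hP, hA, PreprojToB_toPreproj]
  by_cases h : j ∈ Finset.Icc 1 (n - 1)
  · rw [AtoB_E h]
  · rw [Finset.mem_Icc] at h
    obtain rfl : j = 0 := by omega
    rw [genB_e_eq_zero (by simp), Nat.cast_zero, AtoB_E_zero]

/-- The algebra acts on such an `m` through scalars, so every nonzero element of the submodule it
generates is a scalar multiple of `m` and generates the same submodule. -/
theorem mem_socle_of_smul_eq_zero {j : ZMod n} {m : N}
    (he : 𝐞 j • m = m) (hx : 𝐱 • m = 0) (hy : 𝐲 • m = 0) : m ∈ socle (Preproj 𝕜 n) N := by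
  by_cases hm : m = 0
  · rw [hm]
    exact zero_mem _
  refine (le_sSup (a := Submodule.span (Preproj 𝕜 n) {m}) ?_) (Submodule.mem_span_singleton_self m)
  change IsSimpleModule _ _
  rw [isSimpleModule_iff_isAtom]
  refine ⟨by simpa using hm, fun S hS => ?_⟩
  by_contra hS0
  obtain ⟨s, hsS, hs0⟩ := Submodule.exists_mem_ne_zero_of_ne_bot hS0
  refine hS.not_ge ?_
  rw [Submodule.span_singleton_le_iff_mem]
  obtain ⟨p, rfl⟩ := Submodule.mem_span_singleton.1 (hS.le hsS)
  obtain ⟨a, ha⟩ := exists_A_smul (N := N) hP hA p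
  obtain ⟨c, hc⟩ := exists_scalar he hx hy a
  rw [ha, hc] at hsS hs0
  have hc0 : c ≠ 0 := by
    rintro rfl
    simp at hs0
  obtain ⟨q, hq⟩ := exists_Preproj_smul (N := N) hP hA (𝐳 (PowerSeries.C c⁻¹))
  have := S.smul_mem q hsS
  rwa [← hq, smul_smul, ← map_mul, ← map_mul, inv_mul_cancel₀ hc0, map_one, map_one, one_smul]
    at this

/-- By `hcomm`, `w S` is a submodule of `S`. If it were all of `S`, then `S = w ^ r S = 0` by
nilpotency; so it is zero. -/
theorem smul_eq_zero_of_isSimpleModule {S : Submodule (Preproj 𝕜 n) N}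
    (hS : IsSimpleModule (Preproj 𝕜 n) S) {w : A 𝕜 n k} {r : ℕ} (hw : AtoB 𝕜 n k w ^ r = 0)
    (hcomm : ∀ a, ∃ b, a * w = w * b) {s : N} (hs : s ∈ S) : w • s = 0 := by
  rw [isSimpleModule_iff_isAtom] at hS
  let T : Submodule (Preproj 𝕜 n) N :=
    { carrier := {m | ∃ s ∈ S, w • s = m}
      zero_mem' := ⟨0, zero_mem _, smul_zero _⟩
      add_mem' := by
        rintro _ _ ⟨s, hs, rfl⟩ ⟨s', hs', rfl⟩
        exact ⟨s + s', add_mem hs hs', smul_add _ _ _⟩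
      smul_mem' := by
        rintro p _ ⟨s, hs, rfl⟩
        obtain ⟨a, ha⟩ := exists_A_smul (N := N) hP hA p
        obtain ⟨b, hb⟩ := hcomm a
        obtain ⟨q, hq⟩ := exists_Preproj_smul (N := N) hP hA b
        refine ⟨q • s, S.smul_mem q hs, ?_⟩
        rw [ha, ← hq, smul_smul, smul_smul, hb] }
  have hT : T ≤ S := by
    rintro _ ⟨s, hs, rfl⟩
    obtain ⟨q, hq⟩ := exists_Preproj_smul (N := N) hP hA w
    rw [hq]
    exact S.smul_mem q hs
  obtain hlt | heq := hT.lt_or_eq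
  · have : w • s ∈ T := ⟨s, hs, rfl⟩
    rwa [hS.2 T hlt, Submodule.mem_bot] at this
  · have key : ∀ r : ℕ, ∀ s ∈ S, ∃ s' ∈ S, w ^ r • s' = s := by
      intro r
      induction r with
      | zero => exact fun s hs => ⟨s, hs, by simp⟩
      | succ r ih =>
        intro s hs
        obtain ⟨s', hs', rfl⟩ := ih s hs
        rw [← heq] at hs'
        obtain ⟨s'', hs'', rfl⟩ := hs'
        exact ⟨s'', hs'', by rw [pow_succ, mul_smul]⟩
    refine absurd ?_ hS.1
    rw [eq_bot_iff]
    intro s hs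
    obtain ⟨s', -, rfl⟩ := key r s hs
    rw [hA, map_pow, hw, zero_smul]
    exact zero_mem _

theorem isSubQ_of_socle (hfin : Module.Finite (Preproj 𝕜 n) N)
    (hsoc : ∀ j : ℕ, j ≠ k → ∀ m ∈ socle (Preproj 𝕜 n) N, toPreproj 𝕜 n (.e j) • m = 0) :
    IsSubQ 𝕜 n k N := by
  have hE0 : ∀ m : N, 𝐞 0 • m = 0 := fun m => by rw [hA, AtoB_E_zero, zero_smul]
  have hs : ∀ (j : ℕ) (m : N), j ≠ k → j < n → 𝐞 j • m = m → 𝐱 • m = 0 → 𝐲 • m = 0 → m = 0 := by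
    intro j m hjk hjn he hx hy
    have := hsoc j hjk m (mem_socle_of_smul_eq_zero hP hA he hx hy)
    rwa [toPreproj_e_smul hP hA hjn, he] at this
  have hkn : k < n := Fact.out
  -- With `m`, also `y m` at the vertex `j - 1` is killed by `x`, so it is zero by induction; the
  -- induction starts at the vertex `0`, where the module vanishes. Then `m` is a socle element at a
  -- vertex other than `k`.
  have hlow : ∀ (j : ℕ) (m : N), j < k → 𝐞 j • m = m → 𝐱 • m = 0 → m = 0 := by
    intro j
    induction j with
    | zero => intro m _ he _; rw [← he, Nat.cast_zero, hE0]
    | succ j ih =>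
      intro m hj he hx
      refine hs (j + 1) m hj.ne (by omega) he hx (ih _ (by omega) ?_ ?_)
      · conv_rhs => rw [← he, y_smul_E_smul, Nat.cast_succ, add_sub_cancel_right]
      · rw [x_smul_y_smul, ← y_smul_x_smul, hx, smul_zero]
  -- The mirror image, by induction on the distance `d` from `j` to the vertex `n`, which is again
  -- the vertex `0`.
  have hhigh : ∀ (d j : ℕ) (m : N), j + d = n → k < j → 𝐞 j • m = m → 𝐲 • m = 0 → m = 0 := by
    intro d
    induction d with
    | zero =>
      intro j m hj _ he _
      rw [add_zero] at hj
      rw [← he, hj, ZMod.natCast_self, hE0]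
    | succ d ih =>
      intro j m hj hkj he hy
      refine hs j m hkj.ne' (by omega) he (ih (j + 1) _ (by omega) (by omega) ?_ ?_) hy
      · conv_rhs => rw [← he, x_smul_E_smul, ← Nat.cast_succ]
      · rw [y_smul_x_smul, ← x_smul_y_smul, hy, smul_zero]
  have hlow' : ∀ (r j : ℕ) (m : N), j + r ≤ k → 𝐞 j • m = m → 𝐱 ^ r • m = 0 → m = 0 := by
    intro r
    induction r with
    | zero => intro j m _ _ h; simpa using h
    | succ r ih =>
      intro j m hj he hx
      refine hlow j m (by omega) he (ih (j + 1) _ (by omega) ?_ ?_)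
      · conv_rhs => rw [← he, x_smul_E_smul, ← Nat.cast_succ]
      · rwa [smul_smul, ← pow_succ]
  have hhigh' : ∀ (r j : ℕ) (m : N), k + r ≤ j → j ≤ n → 𝐞 j • m = m → 𝐲 ^ r • m = 0 → m = 0 := by
    intro r
    induction r with
    | zero => intro j m _ _ _ h; simpa using h
    | succ r ih =>
      intro j m hj hjn he hy
      obtain ⟨j, rfl⟩ : ∃ i, j = i + 1 := ⟨j - 1, by omega⟩
      refine hhigh (n - (j + 1)) (j + 1) m (by omega) (by omega) he
        (ih j _ (by omega) (by omega) ?_ ?_)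
      · conv_rhs => rw [← he, y_smul_E_smul, Nat.cast_succ, add_sub_cancel_right]
      · rwa [smul_smul, ← pow_succ]
  refine ⟨finite_of_forall_exists_smul (exists_A_smul (N := N) hP hA), hE0, fun a m he h => ?_⟩
  have ha := ZMod.val_lt a
  rw [← ZMod.natCast_zmod_val a] at he
  rw [toK] at h
  split_ifs at h with hak
  · exact hlow' _ _ m (by omega) he h
  · exact hhigh' _ _ m (by omega) (by omega) he h

/-- The nilpotent elements `x` and `y` act as zero on simple submodules. For `j ≠ k` the path to `k`
has positive length, so it kills the socle at `j`, whereas it acts injectively by assumption. -/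
theorem IsSubQ.e_smul_eq_zero (hN : IsSubQ 𝕜 n k N) (j : ℕ) (hj : j ≠ k) (m : N)
    (hm : m ∈ socle (Preproj 𝕜 n) N) : toPreproj 𝕜 n (.e j) • m = 0 := by
  rw [socle, sSup_eq_iSup'] at hm
  refine Submodule.iSup_induction _ (motive := fun m => toPreproj 𝕜 n (.e j) • m = 0) hm
    (fun S m hm => ?_) (smul_zero _) fun x y hx hy => by rw [smul_add, hx, hy, add_zero]
  · obtain ⟨S, hS⟩ := S
    by_cases hjn : j < n
    swap
    · rw [hP, PreprojToB_toPreproj, genB_e_eq_zero, zero_smul]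
      rw [Finset.mem_Icc]
      omega
    have hmem := S.smul_mem (toPreproj 𝕜 n (.e j)) hm
    have hx : 𝐱 • toPreproj 𝕜 n (.e j) • m = 0 :=
      smul_eq_zero_of_isSimpleModule hP hA hS (by rw [AtoB_xA, xB_pow]) exists_mul_xA hmem
    have hy : 𝐲 • toPreproj 𝕜 n (.e j) • m = 0 :=
      smul_eq_zero_of_isSimpleModule hP hA hS (by rw [AtoB_yA, yB_pow]) exists_mul_yA hmem
    rw [toPreproj_e_smul hP hA hjn] at hx hy ⊢
    refine hN.eq_zero j _ (E_smul_E_smul _ _) ?_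
    rw [toK, ZMod.val_natCast_of_lt hjn]
    split_ifs with h
    · rw [show k - j = k - j - 1 + 1 by omega, pow_succ, mul_smul, hx, smul_zero]
    · rw [show j - k = j - k - 1 + 1 by omega, pow_succ, mul_smul, hy, smul_zero]

end

variable (𝕜 n k) in
/-- The action of `A` on a `B`-module. -/
noncomputable abbrev moduleA (N : Type u) [AddCommGroup N] [Module (B 𝕜 n k) N] :
    Module (A 𝕜 n k) N :=
  Module.compHom N (AtoB 𝕜 n k)

theorem SubQ_iff (X : ModuleCat.{u} (B 𝕜 n k)) :
    SubQ 𝕜 n k X ↔ @IsSubQ 𝕜 _ n k _ _ X _ (moduleA 𝕜 n k X) := by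
  let _ : Module (A 𝕜 n k) X := moduleA 𝕜 n k X
  let _ : Module (Preproj 𝕜 n) X := Module.compHom X (PreprojToB 𝕜 n k).toRingHom
  have hP : ∀ (p : Preproj 𝕜 n) (m : X), p • m = PreprojToB 𝕜 n k p • m := fun _ _ => rfl
  have hA : ∀ (a : A 𝕜 n k) (m : X), a • m = AtoB 𝕜 n k a • m := fun _ _ => rfl
  constructor
  · rintro ⟨h1, h2⟩
    exact isSubQ_of_socle hP hA h1 h2
  · intro h
    have := h.finite
    have hfin : Module.Finite (Preproj 𝕜 n) X :=
      finite_of_forall_exists_smul (exists_Preproj_smul (N := X) hP hA)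
    exact ⟨hfin, fun j hj m hm => h.e_smul_eq_zero hP hA j hj m hm⟩

end SubQ

end GrassmannianCM

/-! ### Reduction modulo `(e_n)`: exactness, fullness and density at the level of modules. -/

namespace GrassmannianCM

theorem exists_linearMap_comp_eq {S M N L : Type*} [Ring S] [AddCommGroup M] [Module S M]
    [AddCommGroup N] [Module S N] [AddCommGroup L] [Module S L] (g : M →ₗ[S] N)
    (hg : Function.Surjective g) (s : M →ₗ[S] L) (h : ∀ m, g m = 0 → s m = 0) :
    ∃ f : N →ₗ[S] L, ∀ m, f (g m) = s m := by
  have key : ∀ m m', g m = g m' → s m = s m' := fun m m' hm => by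
    rw [← sub_eq_zero, ← map_sub]
    exact h _ (by rw [map_sub, hm, sub_self])
  choose σ hσ using hg
  refine ⟨{ toFun := fun x => s (σ x)
            map_add' := fun x y => ?_
            map_smul' := fun a x => ?_ }, fun m => key _ _ (hσ _)⟩
  · rw [← map_add]
    exact key _ _ (by rw [hσ, map_add, hσ, hσ])
  · rw [← map_smul]
    exact key _ _ (by rw [hσ, map_smul, hσ]; rfl)

section Reduction

variable {𝕜 : Type u} [Field 𝕜] {n k : ℕ} [Fact (k < n)] [hk : Fact (1 ≤ k)] [NeZero n]
  [HasEnoughRootsOfUnity 𝕜 n]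

local notation "𝐱" => xA 𝕜 n k
local notation "𝐲" => yA 𝕜 n k
local notation "𝐭" => tA 𝕜 n k
local notation "𝐞" => E 𝕜 n k
local notation "𝐳" => ZtoA 𝕜 n k

variable (𝕜 n k) in
/-- The submodule `(e_n) M`. -/
noncomputable abbrev subEn (M : Type u) [AddCommGroup M] [Module (A 𝕜 n k) M] : Submodule (A 𝕜 n k) M :=
  idealEn 𝕜 n k • ⊤

variable {M : Type u} [AddCommGroup M] [Module (A 𝕜 n k) M]
variable {N : Type u} [AddCommGroup N] [Module (A 𝕜 n k) N]
variable {X Y W : Type u} [AddCommGroup X] [Module (A 𝕜 n k) X] [AddCommGroup Y]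
  [Module (A 𝕜 n k) Y] [AddCommGroup W] [Module (A 𝕜 n k) W]

theorem IsCM.path_smul_eq_zero (hM : IsCM 𝕜 n k M) {a : ZMod n} {m : M}
    (h : path 𝕜 n k a • m = 0) : m = 0 := by
  rw [path] at h
  split_ifs at h
  · exact hM.x_smul_eq_zero _ h
  · exact hM.y_smul_eq_zero _ h

theorem map_mem_sub (f : M →ₗ[A 𝕜 n k] N) {m : M} (hm : m ∈ subEn 𝕜 n k M) :
    f m ∈ subEn 𝕜 n k N :=
  Submodule.smul_top_le_comap_smul_top _ f hm

theorem mem_sub_sub (v : subEn 𝕜 n k M) : v ∈ subEn 𝕜 n k (subEn 𝕜 n k M) := by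
  rw [mem_idealEn_smul_top]
  intro a
  obtain ⟨w, hw⟩ := mem_idealEn_smul_top.1 v.2 a
  refine ⟨⟨𝐞 0 • w, Submodule.smul_mem_smul E_zero_mem trivial⟩, Subtype.ext ?_⟩
  change 𝐞 a • (v : M) = path 𝕜 n k a • 𝐞 0 • 𝐞 0 • w
  rw [hw, E_smul_E_smul]

theorem E_zero_smul_mem_sub (m : M) : 𝐞 0 • m ∈ subEn 𝕜 n k M :=
  Submodule.smul_mem_smul E_zero_mem trivial

/-- An element at the vertex `a` which is mapped to `(e_n) M` by the path to `k` is in `(e_n) M`. -/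
theorem exists_of_toK_smul_mem {a : ZMod n} {m : M} (he : 𝐞 a • m = m)
    (h : toK 𝕜 n k a • m ∈ subEn 𝕜 n k M) :
    ∃ w, toK 𝕜 n k a • m = toK 𝕜 n k a • path 𝕜 n k a • 𝐞 0 • w := by
  obtain ⟨w, hw⟩ := mem_idealEn_smul_top.1 h k
  refine ⟨w, ?_⟩
  rw [path_natCast, smul_smul, ← toK_mul_E, mul_smul, he] at hw
  rw [hw, smul_smul (toK 𝕜 n k a), toK_mul_path]

/-- If the path from `a` to `k` moves `m` into `(e_n) M`, the result is also the image under this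
path of an element of `(e_n) M` at the vertex `a`. Torsion-freeness cancels the path. -/
theorem IsCM.isSubQ_quotient (hM : IsCM 𝕜 n k M) : IsSubQ 𝕜 n k (M ⧸ subEn 𝕜 n k M) := by
  have := hM.finite
  refine ⟨inferInstance, fun q => ?_, fun a q he h => ?_⟩
  · obtain ⟨m, rfl⟩ := Submodule.Quotient.mk_surjective _ q
    rw [← Submodule.Quotient.mk_smul, Submodule.Quotient.mk_eq_zero]
    exact E_zero_smul_mem_sub m
  · obtain ⟨m, rfl⟩ := Submodule.Quotient.mk_surjective _ q
    rw [← he] at h ⊢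
    rw [← Submodule.Quotient.mk_smul] at h ⊢
    rw [← Submodule.Quotient.mk_smul, Submodule.Quotient.mk_eq_zero] at h
    rw [Submodule.Quotient.mk_eq_zero]
    obtain ⟨w, hw⟩ := exists_of_toK_smul_mem (E_smul_E_smul a m) h
    rw [← sub_eq_zero, ← smul_sub] at hw
    rw [sub_eq_zero.1 (hM.toK_smul_eq_zero hw)]
    exact path_E_zero_smul_mem a w

/-- This gives left exactness of the reduction. If `e_a f x = path • e_0 w`, then the path kills the
image of `e_0 w` in `W`; as `W` is torsion-free, `e_0 w` comes from `X`. -/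
theorem mem_sub_of_map_mem_sub (hW : IsCM 𝕜 n k W) {f : X →ₗ[A 𝕜 n k] Y} {g : Y →ₗ[A 𝕜 n k] W}
    (hf : Function.Injective f) (hfg : Function.Exact f g) {x : X} (h : f x ∈ subEn 𝕜 n k Y) :
    x ∈ subEn 𝕜 n k X := by
  rw [mem_idealEn_smul_top] at h ⊢
  intro a
  obtain ⟨w, hw⟩ := h a
  have h1 : g (𝐞 0 • w) = 0 := by
    refine hW.path_smul_eq_zero (a := a) ?_
    rw [← map_smul, ← hw, ← map_smul, hfg.apply_apply_eq_zero]
  obtain ⟨w', hw'⟩ := (hfg _).1 h1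
  refine ⟨w', hf ?_⟩
  rw [map_smul, hw, map_smul, map_smul, hw', E_smul_E_smul]

theorem exists_mem_sub_map_eq {g : Y →ₗ[A 𝕜 n k] W} (hg : Function.Surjective g) {w : W}
    (hw : w ∈ subEn 𝕜 n k W) : ∃ y ∈ subEn 𝕜 n k Y, g y = w := by
  rw [mem_idealEn_smul_top] at hw
  choose u hu using hw
  choose v hv using fun a => hg (u a)
  refine ⟨∑ a, path 𝕜 n k a • 𝐞 0 • v a, Submodule.sum_mem _ fun a _ => path_E_zero_smul_mem a _, ?_⟩
  rw [map_sum, ← sum_E_smul (𝕜 := 𝕜) (n := n) (k := k) w]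
  refine Finset.sum_congr rfl fun a _ => ?_
  rw [map_smul, map_smul, hv, hu]

/-- The reduction modulo `(e_n)` is full on Cohen–Macaulay modules. -/
theorem IsCM.exists_lift_quotient (hX : IsCM 𝕜 n k X) (hY : IsCM 𝕜 n k Y)
    (φ : (X ⧸ subEn 𝕜 n k X) →ₗ[A 𝕜 n k] Y ⧸ subEn 𝕜 n k Y) :
    ∃ f : X →ₗ[A 𝕜 n k] Y, ∀ x, (Submodule.Quotient.mk (f x) : Y ⧸ subEn 𝕜 n k Y) =
      φ (Submodule.Quotient.mk x) := by
  -- The pullback of `X → Y / (e_n) Y ← Y` is an extension of `X` by the injective object `(e_n) Y`,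
  -- so it splits. With `l` the retraction, the second projection minus `l` kills `(e_n) Y` and
  -- descends to the required lift.
  let P : Submodule (A 𝕜 n k) (X × Y) := LinearMap.eqLocus
    (φ ∘ₗ (subEn 𝕜 n k X).mkQ ∘ₗ LinearMap.fst _ X Y) ((subEn 𝕜 n k Y).mkQ ∘ₗ LinearMap.snd _ X Y)
  have hP : ∀ p : P, φ (Submodule.Quotient.mk p.1.1) = Submodule.Quotient.mk p.1.2 := fun p => p.2
  let g : P →ₗ[A 𝕜 n k] X := LinearMap.fst _ X Y ∘ₗ P.subtype
  let i : subEn 𝕜 n k Y →ₗ[A 𝕜 n k] P := LinearMap.codRestrict P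
    (LinearMap.inr _ X Y ∘ₗ (subEn 𝕜 n k Y).subtype) fun y => by
      change φ (Submodule.Quotient.mk 0) = Submodule.Quotient.mk (y : Y)
      rw [Submodule.Quotient.mk_zero, map_zero, eq_comm, Submodule.Quotient.mk_eq_zero]
      exact y.2
  have hi : Function.Injective i := fun y y' h =>
    Subtype.ext (congrArg (fun p : P => p.1.2) h)
  have hg : Function.Surjective g := fun x => by
    obtain ⟨y, hy⟩ := Submodule.Quotient.mk_surjective _ (φ (Submodule.Quotient.mk x))
    exact ⟨⟨(x, y), hy.symm⟩, rfl⟩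
  have hig : Function.Exact i g := fun p => by
    constructor
    · intro hp
      have h1 := hP p
      change p.1.1 = 0 at hp
      rw [hp, Submodule.Quotient.mk_zero, map_zero, eq_comm, Submodule.Quotient.mk_eq_zero] at h1
      exact ⟨⟨p.1.2, h1⟩, Subtype.ext (Prod.ext hp.symm rfl)⟩
    · rintro ⟨y, rfl⟩
      rfl
  obtain ⟨l, hl⟩ := exists_extension_idealEn hY hX hi hig hg LinearMap.id
  obtain ⟨f, hf⟩ := exists_linearMap_comp_eq g hg
    (LinearMap.snd _ X Y ∘ₗ P.subtype - (subEn 𝕜 n k Y).subtype ∘ₗ l) fun p hp => by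
      obtain ⟨y, rfl⟩ := (hig p).1 hp
      change (y : Y) - (l (i y) : Y) = 0
      rw [hl]
      exact sub_self _
  refine ⟨f, fun x => ?_⟩
  obtain ⟨p, rfl⟩ := hg x
  rw [hf]
  change Submodule.Quotient.mk (p.1.2 - (l p : Y)) = φ (Submodule.Quotient.mk p.1.1)
  rw [hP, Submodule.Quotient.mk_sub, (Submodule.Quotient.mk_eq_zero _).2 (l p).2, sub_zero]

theorem IsSubQ.eq_zero_of_mem_sub (hN : IsSubQ 𝕜 n k N) {m : N} (hm : m ∈ subEn 𝕜 n k N) :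
    m = 0 := by
  refine ext_E (𝕜 := 𝕜) (n := n) (k := k) fun a => ?_
  obtain ⟨w, hw⟩ := mem_idealEn_smul_top.1 hm a
  rw [hw, hN.E_zero_smul, smul_zero, smul_zero]

/-- Every module in `Sub Q_k` is the reduction modulo `(e_n)` of a Cohen–Macaulay module. -/
theorem IsSubQ.exists_isCM (hN : IsSubQ 𝕜 n k N) :
    ∃ (M : Type u) (_ : AddCommGroup M) (_ : Module (A 𝕜 n k) M) (h : M →ₗ[A 𝕜 n k] N),
      IsCM 𝕜 n k M ∧ Function.Surjective h ∧ ∀ m, h m = 0 ↔ m ∈ subEn 𝕜 n k M := by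
  have := hN.finite
  obtain ⟨r, g, hg⟩ := Module.Finite.exists_fin' (A 𝕜 n k) N
  have hP : IsCM 𝕜 n k (Fin r → A 𝕜 n k) := isCM_A.pi
  let K := LinearMap.ker g
  have hK : IsCM 𝕜 n k K := hP.submodule K
  -- `K` need not equal `(e_n) A ^ r`, so `A ^ r` has too large a reduction. In the pushout along `K
  -- → (e_n) T`, the kernel of the map to `N` is the image of `(e_n) T`, which lies in `(e_n) M`;
  -- the converse inclusion holds since `e_0` kills `N`.
  obtain ⟨s, ι, hι, hιt⟩ := hK.exists_map_idealEn
  have hT : IsCM 𝕜 n k (subEn 𝕜 n k (Fin s → A 𝕜 n k)) := IsCM.submodule (isCM_A.pi) _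
  let f := K.subtype.prod ι
  have hM : IsCM 𝕜 n k (((Fin r → A 𝕜 n k) × subEn 𝕜 n k (Fin s → A 𝕜 n k)) ⧸
      LinearMap.range f) := by
    refine isCM_quotient_range (hP.prod hT) f fun m v hv => ?_
    refine exists_eq_tA_smul hK hP hιt (fun a e v he hv h => ?_) (congrArg Prod.fst hv)
      (congrArg Prod.snd hv)
    -- The socle condition on `N` enters here: `g e` is killed by the path from `a` to `k`.
    have he0 : g e = 0 := by
      refine hN.eq_zero a _ (by rw [← map_smul, he]) ?_
      rw [← map_smul, h]
      exact v.2
    exact ⟨⟨e, he0⟩, Subtype.ext h⟩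
  let h := (LinearMap.range f).liftQ (g ∘ₗ LinearMap.fst _ _ _) (by
    rintro _ ⟨x, rfl⟩
    exact x.2)
  refine ⟨_, inferInstance, inferInstance, h, hM, fun x => ?_, fun m => ⟨fun hm => ?_, fun hm => ?_⟩⟩
  · obtain ⟨p, rfl⟩ := hg x
    exact ⟨Submodule.Quotient.mk (p, 0), rfl⟩
  · obtain ⟨⟨p, τ⟩, rfl⟩ := Submodule.Quotient.mk_surjective _ m
    have hp : g p = 0 := hm
    have h1 : (Submodule.Quotient.mk (p, τ) : _ ⧸ LinearMap.range f) =
        ((LinearMap.range f).mkQ ∘ₗ LinearMap.inr _ _ _) (τ - ι ⟨p, hp⟩) := by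
      change _ = Submodule.Quotient.mk (0, τ - ι ⟨p, hp⟩)
      rw [Submodule.Quotient.eq]
      exact ⟨⟨p, hp⟩, Prod.ext (sub_zero _).symm (sub_sub_cancel _ _).symm⟩
    rw [h1]
    exact map_mem_sub _ (mem_sub_sub _)
  · exact hN.eq_zero_of_mem_sub (map_mem_sub h hm)

/-- If the reduction of `f` is an inflation, then so is the map `(f, ι)`. -/
theorem isCM_quotient_range_prod {S : Type u} [AddCommGroup S] [Module (A 𝕜 n k) S]
    (hX : IsCM 𝕜 n k X) (hY : IsCM 𝕜 n k Y) (hW : IsCM 𝕜 n k W) (hS : IsSubQ 𝕜 n k S)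
    {f : X →ₗ[A 𝕜 n k] Y} {ι : X →ₗ[A 𝕜 n k] W} (p : Y →ₗ[A 𝕜 n k] S)
    (hf : ∀ x, f x ∈ subEn 𝕜 n k Y → x ∈ subEn 𝕜 n k X)
    (hp : ∀ y, p y = 0 ↔ ∃ x, y - f x ∈ subEn 𝕜 n k Y)
    (hι : ∀ m v, 𝐞 k • m = m → ι m = 𝐭 • v → ∃ m', m = 𝐭 • m') :
    IsCM 𝕜 n k ((Y × W) ⧸ LinearMap.range (f.prod ι)) := by
  refine isCM_quotient_range (hY.prod hW) _ fun m v hv => ?_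
  refine exists_eq_tA_smul hX hY hι (fun a e v he hkv h => ?_) (congrArg Prod.fst hv)
    (congrArg Prod.snd hv)
  -- The socle condition on `S` gives `e ≡ f w` modulo `(e_n) Y`, and `hf` then gives `v ≡ toK • e_a
  -- • w` modulo `(e_n) X`. At the vertex `k` the error is a value of `x ^ k = toK * path`, so `v`
  -- itself is a value of `toK`.
  have he0 : p e = 0 := by
    refine hS.eq_zero a _ (by rw [← map_smul, he]) ?_
    rw [← map_smul, h, hp]
    exact ⟨v, by rw [sub_self]; exact zero_mem _⟩
  obtain ⟨w, hw⟩ := (hp e).1 he0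
  have h1 : v - toK 𝕜 n k a • 𝐞 a • w ∈ subEn 𝕜 n k X := by
    refine hf _ ?_
    have h2 := Submodule.smul_mem _ (toK 𝕜 n k a) (Submodule.smul_mem _ (𝐞 a) hw)
    rwa [smul_sub, smul_sub, he, h, ← map_smul, ← map_smul, ← map_sub] at h2
  obtain ⟨u, hu⟩ := mem_idealEn_smul_top.1 h1 k
  rw [smul_sub, hkv, smul_smul, ← toK_mul_E, mul_smul, E_smul_E_smul, path_natCast,
    ← toK_mul_path a, mul_smul, sub_eq_iff_eq_add, ← smul_add] at hu
  exact ⟨_, hu.symm⟩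

end Reduction

end GrassmannianCM

namespace GrassmannianCM

open StableCat CategoryTheory.Limits

/-! ### Conflations in categories of modules. -/

section Conflations

variable {S : Type u} [Ring S] {P : ObjectProperty (ModuleCat.{u} S)}

theorem isConflation_iff {X Y Z : P.FullSubcategory} (f : X ⟶ Y) (g : Y ⟶ Z) :
    IsConflation P f g ↔ Function.Injective f.hom.hom ∧ Function.Exact f.hom.hom g.hom.hom ∧
      Function.Surjective g.hom.hom := by
  constructor
  · intro h
    exact ⟨h.shortExact.moduleCat_injective_f,
      (ShortComplex.ShortExact.moduleCat_exact_iff_function_exact _).1 h.shortExact.exact,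
      h.shortExact.moduleCat_surjective_g⟩
  · rintro ⟨hf, hfg, hg⟩
    have w : f.hom ≫ g.hom = 0 := by
      ext x
      exact hfg.apply_apply_eq_zero x
    exact ⟨w, { exact := (ShortComplex.ShortExact.moduleCat_exact_iff_function_exact _).2 hfg
                mono_f := (ModuleCat.mono_iff_injective _).2 hf
                epi_g := (ModuleCat.epi_iff_surjective _).2 hg }⟩

/-- The morphism of a full subcategory of modules given by a linear map. -/
def linHom {X Y : P.FullSubcategory} (f : X.obj →ₗ[S] Y.obj) : X ⟶ Y :=
  P.homMk (ModuleCat.ofHom f)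

theorem linHom_ext {X Y : P.FullSubcategory} {f g : X ⟶ Y}
    (h : ∀ x, f.hom.hom x = g.hom.hom x) : f = g := by
  apply ObjectProperty.hom_ext
  ext x
  exact h x

end Conflations

variable {𝕜 : Type u} [Field 𝕜] {n k : ℕ} [Fact (k < n)] [hk : Fact (1 ≤ k)] [NeZero n]
  [HasEnoughRootsOfUnity 𝕜 n]

/-! ### The Frobenius structure on `CM(A)`. -/

section CohenMacaulay

/-- A Cohen–Macaulay module as an object of `CM(A)`. -/
noncomputable abbrev cmOf (M : Type u) [AddCommGroup M] [Module (A 𝕜 n k) M] (h : IsCM 𝕜 n k M) :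
    (CM 𝕜 n k).FullSubcategory :=
  ⟨ModuleCat.of (A 𝕜 n k) M, (CM_iff _).2 h⟩

theorem isCM_obj (X : (CM 𝕜 n k).FullSubcategory) : IsCM 𝕜 n k X.obj := (CM_iff _).1 X.property

theorem isInjective_pi (ι : Type) [Finite ι] :
    IsInjective (CM 𝕜 n k) (cmOf (ι → A 𝕜 n k) isCM_A.pi) := by
  intro X Y Z f g hfg h
  obtain ⟨hf, he, hg⟩ := (isConflation_iff _ _).1 hfg
  obtain ⟨l, hl⟩ := exists_extension_pi (isCM_obj Z) hf he hg h.hom.hom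
  exact ⟨linHom l, linHom_ext hl⟩

theorem isInjective_subEn {M : Type u} [AddCommGroup M] [Module (A 𝕜 n k) M] (hM : IsCM 𝕜 n k M) :
    IsInjective (CM 𝕜 n k) (cmOf (subEn 𝕜 n k M) (hM.submodule _)) := by
  intro X Y Z f g hfg h
  obtain ⟨hf, he, hg⟩ := (isConflation_iff _ _).1 hfg
  obtain ⟨l, hl⟩ := exists_extension_idealEn hM (isCM_obj Z) hf he hg h.hom.hom
  exact ⟨linHom l, linHom_ext hl⟩

theorem isProjective_pi (ι : Type) [Finite ι] :
    IsProjective (CM 𝕜 n k) (cmOf (ι → A 𝕜 n k) isCM_A.pi) := by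
  intro X Y Z f g hfg h
  obtain ⟨l, hl⟩ := Module.projective_lifting_property g.hom.hom h.hom.hom
    ((isConflation_iff _ _).1 hfg).2.2
  exact ⟨linHom l, linHom_ext fun x => LinearMap.congr_fun hl x⟩

theorem exists_conflation_of_surjective {X Y : (CM 𝕜 n k).FullSubcategory} (g : Y ⟶ X)
    (hg : Function.Surjective g.hom.hom) :
    ∃ (K : (CM 𝕜 n k).FullSubcategory) (f : K ⟶ Y), IsConflation (CM 𝕜 n k) f g :=
  ⟨cmOf (LinearMap.ker g.hom.hom) ((isCM_obj Y).submodule _),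
    linHom (LinearMap.ker g.hom.hom).subtype, (isConflation_iff _ _).2
      ⟨Subtype.val_injective, LinearMap.exact_subtype_ker_map _, hg⟩⟩

theorem exists_conflation_of_injective {X Y : (CM 𝕜 n k).FullSubcategory} (f : X ⟶ Y)
    (hf : Function.Injective f.hom.hom)
    (h : IsCM 𝕜 n k (Y.obj ⧸ LinearMap.range f.hom.hom)) :
    ∃ (W : (CM 𝕜 n k).FullSubcategory) (g : Y ⟶ W), IsConflation (CM 𝕜 n k) f g :=
  ⟨cmOf _ h, linHom (LinearMap.range f.hom.hom).mkQ, (isConflation_iff _ _).2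
      ⟨hf, LinearMap.exact_map_mkQ_range _, Submodule.mkQ_surjective _⟩⟩

theorem exists_projective_cover (X : (CM 𝕜 n k).FullSubcategory) :
    ∃ (r : ℕ) (K : (CM 𝕜 n k).FullSubcategory)
      (f : K ⟶ cmOf (Fin r → A 𝕜 n k) isCM_A.pi) (g : cmOf (Fin r → A 𝕜 n k) isCM_A.pi ⟶ X),
      IsConflation (CM 𝕜 n k) f g := by
  have := (isCM_obj X).finite
  obtain ⟨r, g, hg⟩ := Module.Finite.exists_fin' (A 𝕜 n k) X.obj
  obtain ⟨K, f, h⟩ := exists_conflation_of_surjective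
    (linHom g : cmOf (Fin r → A 𝕜 n k) isCM_A.pi ⟶ X) hg
  exact ⟨r, K, f, _, h⟩

theorem exists_injective_hull (X : (CM 𝕜 n k).FullSubcategory) :
    ∃ (ι : Type) (_ : Finite ι) (W : (CM 𝕜 n k).FullSubcategory)
      (f : X ⟶ cmOf (ι → A 𝕜 n k) isCM_A.pi) (g : cmOf (ι → A 𝕜 n k) isCM_A.pi ⟶ W),
      IsConflation (CM 𝕜 n k) f g := by
  obtain ⟨ι, hι, f, hf, h⟩ := (isCM_obj X).exists_embedding
  obtain ⟨W, g, h⟩ := exists_conflation_of_injective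
    (linHom f : X ⟶ cmOf (ι → A 𝕜 n k) isCM_A.pi) hf h
  exact ⟨ι, hι, W, _, g, h⟩

variable (𝕜 n k) in
/-- The Cohen–Macaulay `A`-modules form a Frobenius category. -/
theorem isFrobenius_CM : IsFrobenius (CM 𝕜 n k) where
  containsZero := ⟨⟨ModuleCat.of _ PUnit.{u+1}, ModuleCat.isZero_of_subsingleton _,
    (CM_iff _).2 ⟨inferInstanceAs (Module.Finite (A 𝕜 n k) PUnit.{u+1}), fun _ _ => rfl⟩⟩⟩
  closedUnderExtensions := ⟨fun {S} hS h₁ h₃ => (CM_iff _).2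
    (((CM_iff _).1 h₁).of_exact ((CM_iff _).1 h₃) S.f.hom S.g.hom hS.moduleCat_injective_f
      ((ShortComplex.ShortExact.moduleCat_exact_iff_function_exact _).1 hS.exact)
      hS.moduleCat_surjective_g)⟩
  enoughProjectives X := by
    obtain ⟨r, K, f, g, h⟩ := exists_projective_cover X
    exact ⟨K, _, f, g, h, isProjective_pi _⟩
  enoughInjectives X := by
    obtain ⟨ι, _, W, f, g, h⟩ := exists_injective_hull X
    exact ⟨_, W, f, g, h, isInjective_pi _⟩
  -- Finite free modules are both projective and injective, and they suffice for covers and for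
  -- embeddings; a projective or injective object is therefore a retract of one of them.
  projective_iff_injective X := by
    constructor
    · intro hX
      obtain ⟨r, K, f, g, h⟩ := exists_projective_cover X
      obtain ⟨s, hs⟩ := hX f g h (𝟙 X)
      exact (isInjective_pi _).of_retract s g hs
    · intro hX
      obtain ⟨ι, _, W, f, g, h⟩ := exists_injective_hull X
      obtain ⟨r, hr⟩ := hX f g h (𝟙 X)
      exact (isProjective_pi _).of_retract f r hr

end CohenMacaulay

/-! ### The functor `π` is a projective quotient. -/

section Reduction

/-- A `B`-module, viewed as an `A`-module. -/
noncomputable abbrev resA (V : ModuleCat.{u} (B 𝕜 n k)) : ModuleCat.{u} (A 𝕜 n k) :=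
  (ModuleCat.restrictScalars (AtoB 𝕜 n k)).obj V

theorem SubQ_iff_resA (V : ModuleCat.{u} (B 𝕜 n k)) : SubQ 𝕜 n k V ↔ IsSubQ 𝕜 n k (resA V) :=
  SubQ_iff V

/-- A `B`-linear map, viewed as an `A`-linear map. -/
noncomputable def toA {V W : ModuleCat.{u} (B 𝕜 n k)} (f : V ⟶ W) :
    resA V →ₗ[A 𝕜 n k] resA W :=
  ((ModuleCat.restrictScalars (AtoB 𝕜 n k)).map f).hom

theorem exists_hom_of_A {V W : ModuleCat.{u} (B 𝕜 n k)} (φ : resA V →ₗ[A 𝕜 n k] resA W) :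
    ∃ f : V ⟶ W, ∀ v : V, f.hom v = φ v := by
  refine ⟨ModuleCat.ofHom
    { toFun := fun v => (φ v : W)
      map_add' := fun v w => map_add φ v w
      map_smul' := fun b v => ?_ }, fun _ => rfl⟩
  obtain ⟨a, rfl⟩ := AtoB_surjective b
  exact φ.map_smul a v

/-- The projection `X → π X`. -/
noncomputable def toPi (X : ModuleCat.{u} (A 𝕜 n k)) :
    X →ₗ[A 𝕜 n k] resA ((piFunctor 𝕜 n k).obj X) where
  toFun x := (Submodule.Quotient.mk x : X ⧸ subEn 𝕜 n k X)
  map_add' _ _ := rfl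
  map_smul' a x := by
    have h : (BToQuot 𝕜 n k (AtoB 𝕜 n k a)) •
        (Submodule.Quotient.mk x : X ⧸ idealEn 𝕜 n k • (⊤ : Submodule (A 𝕜 n k) X)) =
        Submodule.Quotient.mk (a • x) := by
      rw [BToQuot_AtoB]
      rfl
    exact h.symm

theorem toPi_surjective (X : ModuleCat.{u} (A 𝕜 n k)) : Function.Surjective (toPi X) :=
  Submodule.Quotient.mk_surjective _

theorem toPi_eq_zero {X : ModuleCat.{u} (A 𝕜 n k)} {x : X} :
    toPi X x = 0 ↔ x ∈ subEn 𝕜 n k X :=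
  Submodule.Quotient.mk_eq_zero _

theorem toPi_eq_toPi {X : ModuleCat.{u} (A 𝕜 n k)} {x y : X} :
    toPi X x = toPi X y ↔ x - y ∈ subEn 𝕜 n k X := by
  rw [← sub_eq_zero, ← map_sub, toPi_eq_zero]

noncomputable def piEquiv (X : ModuleCat.{u} (A 𝕜 n k)) :
    (X ⧸ subEn 𝕜 n k X) ≃ₗ[A 𝕜 n k] resA ((piFunctor 𝕜 n k).obj X) :=
  LinearEquiv.ofBijective ((subEn 𝕜 n k X).liftQ (toPi X) fun _ hx => toPi_eq_zero.2 hx)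
    ⟨(injective_iff_map_eq_zero _).2 fun q hq => by
      obtain ⟨x, rfl⟩ := Submodule.Quotient.mk_surjective _ q
      exact (Submodule.Quotient.mk_eq_zero _).2 (toPi_eq_zero.1 hq),
    fun v => by
      obtain ⟨x, rfl⟩ := toPi_surjective X v
      exact ⟨Submodule.Quotient.mk x, rfl⟩⟩

theorem piEquiv_mk (X : ModuleCat.{u} (A 𝕜 n k)) (x : X) :
    piEquiv X (Submodule.Quotient.mk x) = toPi X x := rfl

theorem IsSubQ.of_equiv {M N : Type u} [AddCommGroup M] [Module (A 𝕜 n k) M] [AddCommGroup N]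
    [Module (A 𝕜 n k) N] (hM : IsSubQ 𝕜 n k M) (e : M ≃ₗ[A 𝕜 n k] N) : IsSubQ 𝕜 n k N := by
  have := hM.finite
  refine ⟨Module.Finite.equiv e, fun m => ?_, fun a m he h => ?_⟩
  · obtain ⟨m, rfl⟩ := e.surjective m
    rw [← map_smul, hM.E_zero_smul, map_zero]
  · obtain ⟨m, rfl⟩ := e.surjective m
    rw [← map_smul] at he h
    rw [hM.eq_zero a m (e.injective he) (e.map_eq_zero_iff.1 h), map_zero]

theorem IsSubQ.of_exact {M L N : Type u} [AddCommGroup M] [Module (A 𝕜 n k) M] [AddCommGroup L]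
    [Module (A 𝕜 n k) L] [AddCommGroup N] [Module (A 𝕜 n k) N] (hM : IsSubQ 𝕜 n k M)
    (hN : IsSubQ 𝕜 n k N) (f : M →ₗ[A 𝕜 n k] L) (g : L →ₗ[A 𝕜 n k] N)
    (hf : Function.Injective f) (hfg : Function.Exact f g) (hg : Function.Surjective g) :
    IsSubQ 𝕜 n k L := by
  have := hM.finite
  have := hN.finite
  refine ⟨Module.Finite.of_exact hfg hg, fun v => ?_, fun a v he h => ?_⟩
  · obtain ⟨u, hu⟩ := (hfg (E 𝕜 n k 0 • v)).1 (by rw [map_smul, hN.E_zero_smul])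
    rw [← E_smul_E_smul, ← hu, ← map_smul, hM.E_zero_smul, map_zero]
  · obtain ⟨u, rfl⟩ := (hfg v).1 (hN.eq_zero a _ (by rw [← map_smul, he])
      (by rw [← map_smul, h, map_zero]))
    rw [← map_smul] at he h
    rw [hM.eq_zero a u (hf he) (hf (by rw [h, map_zero])), map_zero]

theorem SubQ_containsZero : (SubQ 𝕜 n k).ContainsZero :=
  ⟨⟨ModuleCat.of _ PUnit.{u+1}, ModuleCat.isZero_of_subsingleton _, (SubQ_iff_resA _).2
    ⟨@Module.Finite.of_finite _ _ _ _ _ (inferInstanceAs (Finite PUnit.{u+1})), fun _ => rfl,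
      fun _ _ _ _ => rfl⟩⟩⟩

theorem SubQ_closedUnderExtensions : (SubQ 𝕜 n k).IsClosedUnderExtensions :=
  ⟨fun {S} hS h₁ h₃ => (SubQ_iff_resA _).2
    (((SubQ_iff_resA _).1 h₁).of_exact ((SubQ_iff_resA _).1 h₃) (toA S.f) (toA S.g)
      hS.moduleCat_injective_f
      ((ShortComplex.ShortExact.moduleCat_exact_iff_function_exact _).1 hS.exact)
      hS.moduleCat_surjective_g)⟩

theorem SubQ_piFunctor (X : ModuleCat.{u} (A 𝕜 n k)) (h : CM 𝕜 n k X) :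
    SubQ 𝕜 n k ((piFunctor 𝕜 n k).obj X) :=
  (SubQ_iff_resA _).2 (((CM_iff _).1 h).isSubQ_quotient.of_equiv (piEquiv X))

variable (hπ : ∀ M, CM 𝕜 n k M → SubQ 𝕜 n k ((piFunctor 𝕜 n k).obj M))

theorem piCM_map_toPi {X Y : (CM 𝕜 n k).FullSubcategory} (f : X ⟶ Y) (x : X.obj) :
    ((piCM 𝕜 n k hπ).map f).hom.hom (toPi X.obj x) = toPi Y.obj (f.hom.hom x) := rfl

theorem piCM_map_eq_of {X Y : (CM 𝕜 n k).FullSubcategory}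
    {g : (piCM 𝕜 n k hπ).obj X ⟶ (piCM 𝕜 n k hπ).obj Y} {f : X ⟶ Y}
    (h : ∀ x, g.hom.hom (toPi X.obj x) = toPi Y.obj (f.hom.hom x)) :
    (piCM 𝕜 n k hπ).map f = g := by
  refine linHom_ext fun v => ?_
  obtain ⟨x, rfl⟩ := toPi_surjective X.obj v
  exact (h x).symm

theorem piCM_map_eq {X Y : (CM 𝕜 n k).FullSubcategory} {f g : X ⟶ Y}
    (h : ∀ x, g.hom.hom x - f.hom.hom x ∈ subEn 𝕜 n k Y.obj) :
    (piCM 𝕜 n k hπ).map f = (piCM 𝕜 n k hπ).map g :=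
  piCM_map_eq_of hπ fun x => (piCM_map_toPi hπ g x).trans (toPi_eq_toPi.2 (h x))

theorem piCM_full : (piCM 𝕜 n k hπ).Full where
  map_surjective {X Y} g := by
    obtain ⟨f, hf⟩ := (isCM_obj X).exists_lift_quotient (isCM_obj Y)
      ((piEquiv Y.obj).symm.toLinearMap ∘ₗ toA g.hom ∘ₗ (piEquiv X.obj).toLinearMap)
    refine ⟨linHom f, piCM_map_eq_of hπ fun x => ?_⟩
    have := congrArg (piEquiv Y.obj) (hf x)
    rw [piEquiv_mk] at this
    refine Eq.trans ?_ this.symm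
    exact ((piEquiv Y.obj).apply_symm_apply _).symm

theorem piCM_essSurj : (piCM 𝕜 n k hπ).EssSurj where
  mem_essImage V := by
    obtain ⟨M, _, _, h, hM, hh, hker⟩ := ((SubQ_iff_resA _).1 V.property).exists_isCM
    obtain ⟨ψ, hψ⟩ := exists_linearMap_comp_eq (toPi (cmOf M hM).obj) (toPi_surjective _) h
      fun m hm => (hker m).2 (toPi_eq_zero.1 hm)
    obtain ⟨g, hg⟩ := exists_hom_of_A ψ
    have hbij : Function.Bijective g.hom := by
      constructor
      · rw [injective_iff_map_eq_zero]
        intro v hv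
        obtain ⟨m, rfl⟩ := toPi_surjective _ v
        exact toPi_eq_zero.2 ((hker m).1 ((hψ m).symm.trans ((hg _).symm.trans hv)))
      · intro v
        obtain ⟨m, hm⟩ := hh v
        exact ⟨toPi _ m, (hg _).trans ((hψ m).trans hm)⟩
    exact ⟨cmOf M hM, ⟨(SubQ 𝕜 n k).isoMk (LinearEquiv.ofBijective g.hom hbij).toModuleIso⟩⟩

theorem piCM_map_conflation {X Y Z : (CM 𝕜 n k).FullSubcategory} (f : X ⟶ Y) (g : Y ⟶ Z)
    (h : IsConflation (CM 𝕜 n k) f g) :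
    IsConflation (SubQ 𝕜 n k) ((piCM 𝕜 n k hπ).map f) ((piCM 𝕜 n k hπ).map g) := by
  obtain ⟨hf, hfg, hg⟩ := (isConflation_iff _ _).1 h
  refine (isConflation_iff _ _).2 ⟨(injective_iff_map_eq_zero _).2 fun v hv => ?_, fun v => ?_,
    fun v => ?_⟩
  · obtain ⟨x, rfl⟩ := toPi_surjective X.obj v
    exact toPi_eq_zero.2 (mem_sub_of_map_mem_sub (isCM_obj Z) hf hfg (toPi_eq_zero.1 hv))
  · obtain ⟨y, rfl⟩ := toPi_surjective Y.obj v
    constructor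
    · intro hv
      -- Since `(e_n) Y` surjects onto `(e_n) Z`, the element `y` can be changed within its class to
      -- lie in the kernel of `g`.
      obtain ⟨y', hy', h'⟩ := exists_mem_sub_map_eq hg (toPi_eq_zero.1 hv)
      have h'' : g.hom.hom y' = g.hom.hom y := h'
      obtain ⟨x, hx⟩ := (hfg (y - y')).1 (by rw [map_sub, h'', sub_self])
      refine ⟨toPi X.obj x, (piCM_map_toPi hπ f x).trans (toPi_eq_toPi.2 ?_)⟩
      rw [hx, sub_sub_cancel_left]
      exact neg_mem hy'
    · rintro ⟨v, hv⟩
      obtain ⟨x, rfl⟩ := toPi_surjective X.obj v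
      rw [← hv]
      refine toPi_eq_zero.2 ?_
      have h0 : g.hom.hom (f.hom.hom x) = 0 := hfg.apply_apply_eq_zero x
      change g.hom.hom (f.hom.hom x) ∈ subEn 𝕜 n k Z.obj
      rw [h0]
      exact zero_mem _
  · obtain ⟨z, rfl⟩ := toPi_surjective Z.obj v
    obtain ⟨y, rfl⟩ := hg z
    exact ⟨toPi Y.obj y, rfl⟩

/-- Vanishing of `π f` means that `f` factors through `(e_n) Y`, which is injective and hence
projective in `CM(A)`. -/
theorem mem_projectiveIdeal_of_piCM_map {X Y : (CM 𝕜 n k).FullSubcategory} (f : X ⟶ Y)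
    (h : (piCM 𝕜 n k hπ).map f = 0) : f ∈ projectiveIdeal (CM 𝕜 n k) X Y := by
  have hf : ∀ x, f.hom.hom x ∈ subEn 𝕜 n k Y.obj := fun x =>
    toPi_eq_zero.1 (by rw [← piCM_map_toPi hπ, h]; rfl)
  refine AddSubgroup.subset_closure ⟨_, ((isFrobenius_CM 𝕜 n k).projective_iff_injective _).2
    (isInjective_subEn (isCM_obj Y)), linHom (LinearMap.codRestrict _ f.hom.hom hf),
    linHom (Submodule.subtype _), ?_⟩
  exact linHom_ext fun x => rfl

/-- `f` is surjective modulo `(e_n) X`, so adding the summand `(e_n) X` to its source makes it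
surjective. On that summand the new map takes values in `(e_n) X`, which `π` does not see. -/
theorem piCM_exists_deflation {M X : (CM 𝕜 n k).FullSubcategory} (f : M ⟶ X)
    (K : (SubQ 𝕜 n k).FullSubcategory) (i : K ⟶ (piCM 𝕜 n k hπ).obj M)
    (h : IsConflation (SubQ 𝕜 n k) i ((piCM 𝕜 n k hπ).map f)) :
    ∃ (K' M' : (CM 𝕜 n k).FullSubcategory) (i' : K' ⟶ M') (f' : M' ⟶ X) (r : M' ⟶ M),
      IsConflation (CM 𝕜 n k) i' f' ∧
        (piCM 𝕜 n k hπ).map (r ≫ f) = (piCM 𝕜 n k hπ).map f' := by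
  have hs := ((isConflation_iff _ _).1 h).2.2
  let M' : (CM 𝕜 n k).FullSubcategory := cmOf (M.obj × subEn 𝕜 n k X.obj)
    ((isCM_obj M).prod ((isCM_obj X).submodule _))
  let f' : M' ⟶ X := linHom (f.hom.hom.coprod (Submodule.subtype _))
  let r : M' ⟶ M := linHom (LinearMap.fst _ _ _)
  have hf' : Function.Surjective f'.hom.hom := fun x => by
    obtain ⟨v, hv⟩ := hs (toPi X.obj x)
    obtain ⟨m, rfl⟩ := toPi_surjective M.obj v
    have hm := toPi_eq_toPi.1 ((piCM_map_toPi hπ f m).symm.trans hv).symm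
    refine ⟨(m, ⟨_, hm⟩), ?_⟩
    change f.hom.hom m + (x - f.hom.hom m) = x
    abel
  obtain ⟨K', i', h'⟩ := exists_conflation_of_surjective f' hf'
  refine ⟨K', M', i', f', r, h', piCM_map_eq hπ fun p => ?_⟩
  change f.hom.hom p.1 + (p.2 : X.obj) - f.hom.hom p.1 ∈ _
  rw [add_sub_cancel_left]
  exact p.2.2

/-- An embedding `ι` of `X` into some `(e_n) T`, taken as a second component, makes `f` injective,
with torsion-free cokernel by `isCM_quotient_range_prod`. Since `(e_n) T` equals its own
`(e_n)`-part, this component disappears under `π`. -/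
theorem piCM_exists_inflation {X M : (CM 𝕜 n k).FullSubcategory} (f : X ⟶ M)
    (S : (SubQ 𝕜 n k).FullSubcategory) (p : (piCM 𝕜 n k hπ).obj M ⟶ S)
    (h : IsConflation (SubQ 𝕜 n k) ((piCM 𝕜 n k hπ).map f) p) :
    ∃ (M' S' : (CM 𝕜 n k).FullSubcategory) (f' : X ⟶ M') (p' : M' ⟶ S') (r : M ⟶ M'),
      IsConflation (CM 𝕜 n k) f' p' ∧
        (piCM 𝕜 n k hπ).map (f ≫ r) = (piCM 𝕜 n k hπ).map f' := by
  obtain ⟨hi, he, -⟩ := (isConflation_iff _ _).1 h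
  obtain ⟨s, ι, hι, hιt⟩ := (isCM_obj X).exists_map_idealEn
  have hT : IsCM 𝕜 n k (subEn 𝕜 n k (Fin s → A 𝕜 n k)) := isCM_A.pi.submodule _
  let M' : (CM 𝕜 n k).FullSubcategory := cmOf (M.obj × subEn 𝕜 n k (Fin s → A 𝕜 n k))
    ((isCM_obj M).prod hT)
  let f' : X ⟶ M' := linHom (f.hom.hom.prod ι)
  let r : M ⟶ M' := linHom (LinearMap.inl _ _ _)
  have hf' : Function.Injective f'.hom.hom := fun x y hxy => hι (congrArg Prod.snd hxy)
  have hq := isCM_quotient_range_prod (isCM_obj X) (isCM_obj M) hT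
    ((SubQ_iff_resA _).1 S.property) (f := f.hom.hom) (ι := ι) (toA p.hom ∘ₗ toPi M.obj)
    (fun x hx => toPi_eq_zero.1 (hi ((piCM_map_toPi hπ f x).trans
      ((toPi_eq_zero.2 hx).trans (map_zero _).symm))))
    (fun y => ?_) hιt
  · obtain ⟨S', p', h'⟩ := exists_conflation_of_injective f' hf' hq
    refine ⟨M', S', f', p', r, h', piCM_map_eq hπ fun x => ?_⟩
    have h1 : f'.hom.hom x - (f ≫ r).hom.hom x =
        LinearMap.inr (A 𝕜 n k) M.obj (subEn 𝕜 n k (Fin s → A 𝕜 n k)) (ι x) :=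
      Prod.ext (sub_self (f.hom.hom x)) (sub_zero (ι x))
    rw [h1]
    exact map_mem_sub _ (mem_sub_sub _)
  · refine (he (toPi M.obj y)).trans ⟨?_, ?_⟩
    · rintro ⟨v, hv⟩
      obtain ⟨x, rfl⟩ := toPi_surjective X.obj v
      exact ⟨x, toPi_eq_toPi.1 ((piCM_map_toPi hπ f x).symm.trans hv).symm⟩
    · rintro ⟨x, hx⟩
      exact ⟨toPi X.obj x, (piCM_map_toPi hπ f x).trans (toPi_eq_toPi.2 hx).symm⟩

/-- `π` identifies `Sub Q_k` with a quotient of `CM(A)` by morphisms that factor through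
projectives. -/
theorem isProjectiveQuotient_piCM : IsProjectiveQuotient (piCM 𝕜 n k hπ) where
  additive := ⟨ObjectProperty.hom_ext _ (piFunctor 𝕜 n k).map_add⟩
  full := piCM_full hπ
  essSurj := piCM_essSurj hπ
  map_conflation _ _ _ f g h := piCM_map_conflation hπ f g h
  mem_of_map_eq_zero _ _ f h := mem_projectiveIdeal_of_piCM_map hπ f h
  exists_deflation _ _ f K i h := piCM_exists_deflation hπ f K i h
  exists_inflation _ _ f S p h := piCM_exists_inflation hπ f S p h

theorem exists_projective_presentation {X : ModuleCat.{u} (A 𝕜 n k)} (hX : CM 𝕜 n k X) :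
    ∃ (K T : ModuleCat.{u} (A 𝕜 n k)) (f : K ⟶ T) (g : T ⟶ X) (w : f ≫ g = 0),
      CM 𝕜 n k K ∧ CM 𝕜 n k T ∧ Projective T ∧ (ShortComplex.mk f g w).ShortExact := by
  obtain ⟨r, K, f, g, h⟩ := exists_projective_cover ⟨X, hX⟩
  exact ⟨K.obj, _, f.hom, g.hom, h.zero, K.property, (CM_iff _).2 isCM_A.pi,
    (IsProjective.iff_projective _).1 inferInstance, h.shortExact⟩

end Reduction

end GrassmannianCM

/-! ### Assembly: the transfer results applied to `π`. -/

theorem corollary4p6 (𝕜 : Type u) [Field 𝕜] (n k : ℕ) [NeZero n] [Fact (1 ≤ k)] [Fact (k < n)]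
    [HasEnoughRootsOfUnity 𝕜 n] :
    -- `CM(A)` and `Sub Q_k` are Frobenius categories
    ∃ (hA : StableCat.IsFrobenius (GrassmannianCM.CM 𝕜 n k))
      (hB : StableCat.IsFrobenius (GrassmannianCM.SubQ 𝕜 n k))
      -- `π` restricts to a functor from `CM(A)` to `Sub Q_k`
      (hπ : ∀ M, GrassmannianCM.CM 𝕜 n k M →
        GrassmannianCM.SubQ 𝕜 n k ((GrassmannianCM.piFunctor 𝕜 n k).obj M))
      -- which descends to the stable categories
      (hst : ∀ (X Y : (GrassmannianCM.CM 𝕜 n k).FullSubcategory) (f g : X ⟶ Y),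
        StableCat.stableRel (GrassmannianCM.CM 𝕜 n k) f g →
          (GrassmannianCM.piCM 𝕜 n k hπ ⋙ StableCat.toStable (GrassmannianCM.SubQ 𝕜 n k)).map f =
            (GrassmannianCM.piCM 𝕜 n k hπ ⋙
              StableCat.toStable (GrassmannianCM.SubQ 𝕜 n k)).map g),
      -- the induced functor is a triangle equivalence
      (∀ (HA : StableCat.InjectiveEmbeddings (GrassmannianCM.CM 𝕜 n k))
        (HB : StableCat.InjectiveEmbeddings (GrassmannianCM.SubQ 𝕜 n k)),
        StableCat.IsTriangleEquivalence
          (StableCat.stableTriangles hA HA) (StableCat.stableTriangles hB HB)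
          (CategoryTheory.Quotient.lift (StableCat.stableRel (GrassmannianCM.CM 𝕜 n k))
            (GrassmannianCM.piCM 𝕜 n k hπ ⋙ StableCat.toStable (GrassmannianCM.SubQ 𝕜 n k))
            hst)) ∧
      -- `π` induces isomorphisms of `Ext¹` groups
      (∀ X Y : ModuleCat.{u} (GrassmannianCM.A 𝕜 n k),
        GrassmannianCM.CM 𝕜 n k X → GrassmannianCM.CM 𝕜 n k Y →
        ∃ Φ : CategoryTheory.Abelian.Ext X Y 1 ≃+
            CategoryTheory.Abelian.Ext ((GrassmannianCM.piFunctor 𝕜 n k).obj X)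
              ((GrassmannianCM.piFunctor 𝕜 n k).obj Y) 1,
          ∀ (E : ModuleCat.{u} (GrassmannianCM.A 𝕜 n k)) (f : Y ⟶ E) (g : E ⟶ X) (w : f ≫ g = 0)
            (hS : (CategoryTheory.ShortComplex.mk f g w).ShortExact),
            ∃ hS' : ((CategoryTheory.ShortComplex.mk f g w).map
                (GrassmannianCM.piFunctor 𝕜 n k)).ShortExact,
              Φ hS.extClass = hS'.extClass) := by
  have hA := GrassmannianCM.isFrobenius_CM 𝕜 n k
  have hπ := GrassmannianCM.SubQ_piFunctor (𝕜 := 𝕜) (n := n) (k := k)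
  have hF := GrassmannianCM.isProjectiveQuotient_piCM hπ
  have hB := hF.isFrobenius hA GrassmannianCM.SubQ_containsZero
    GrassmannianCM.SubQ_closedUnderExtensions
  exact ⟨hA, hB, hπ, fun _ _ => hF.toStable_map_eq,
    fun HA HB => hF.isTriangleEquivalence (fun _ _ => hF.toStable_map_eq) hA hB HA HB,
    fun X Y hX hY => hF.exists_extEquiv (GrassmannianCM.piFunctor 𝕜 n k) hπ hA hB hX hY
      (GrassmannianCM.exists_projective_presentation hX)⟩
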